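/- **Theorem.** Let $R$ be a coherent ring, i.e. a ring such that the categories $\mathrm{mod}(R)$ and $\mathrm{mod}(R^{op})$ of finitely presented right and left $R$-modules are abelian. Let $\underline{\mathrm{mod}}(R)$, $\underline{\mathrm{mod}}(R^{op})$ be the stable categories (morphisms modulo those factoring through a projective), $\Omega$ the syzygy endofunctor of each of them, and $\mathrm{Tr}\colon\underline{\mathrm{mod}}(R)\leftrightarrows\underline{\mathrm{mod}}(R^{op})$ the contravariant functors given by the transpose: for a presentation $P_1\to P_0\to M\to 0$ by finitely generated projectives, $\mathrm{Tr}\,M=\mathrm{coker}(\mathrm{Hom}(P_0,R)\to \mathrm{Hom}(P_1,R))$. Let $\mathsf{fp}(\mathrm{Mod}(R),\mathsf{Ab})$ be the category of functors $F\colon\mathrm{Mod}(R)\to\mathsf{Ab}$ with a presentation $\mathrm{Hom}(Y,-)\to \mathrm{Hom}(X,-)\to F\to 0$, and $\mathsf{tfp}(\mathrm{Mod}(R),\mathsf{Ab})$ its full subcategory of totally finitely presented functors, those for which $X,Y$ can be chosen in $\mathrm{mod}(R)$. For an additive functor $F\colon\mathrm{Mod}(R)\to\mathsf{Ab}$ the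 satellites $S^1F$ and $S_1F$ are defined by exact sequences $$F(I)\to F(\Sigma X)\to S^1F(X)\to 0,\qquad 0\to S_1F(X)\to F(\Omega X)\to F(P),$$ where $0\to X\to I\to\Sigma X\to 0$ and $0\to\Omega X\to P\to X\to 0$ are exact with $I$ injective and $P$ projective; $S^n$ and $S_n$ are the $n$-th iterates of $S^1$ and $S_1$. Let $D$ be the zeroth left derived functor, computed by injective resolutions in $\mathsf{fp}(\mathrm{Mod}(R),\mathsf{Ab})$, of the contravariant functor $$\mathsf{fp}(\mathrm{Mod}(R),\mathsf{Ab})\to\mathsf{fp}(\mathrm{Mod}(R^{op}),\mathsf{Ab}),\qquad F\mapsto \mathrm{Hom}(F(R),-).$$ Finally let $\mathsf E(M)=\mathrm{Ext}^1(M,-)$. The same notation is used with $R$ and $R^{op}$ interchanged. Then $\mathsf E$ takes $\underline{\mathrm{mod}}(R)$ to $\mathsf{tfp}(\mathrm{Mod}(R),\mathsf{Ab})$, the functors $S^1$ and $S_1$ restrict to endofunctors of $\mathsf{tfp}(\mathrm{Mod}(R),\mathsf{Ab})$, $D$ restricts to a contravariant functor $\mathsf{tfp}(\mathrm{Mod}(R),\mathsf{Ab})\to\mathsf{tfp}(\mathrm{Mod}(R^{op}),\mathsf{Ab})$,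 the same holds with $R$ and $R^{op}$ interchanged, and the resulting diagram, with vertical arrows $\mathsf E$, upper arrows $\mathrm{Tr},\Omega$ and lower arrows $S^1D,S^1$, has the following properties. 1. The vertical arrows $\mathsf E\colon\underline{\mathrm{mod}}(R)\to\mathsf{tfp}(\mathrm{Mod}(R),\mathsf{Ab})$ and $\mathsf E\colon\underline{\mathrm{mod}}(R^{op})\to\mathsf{tfp}(\mathrm{Mod}(R^{op}),\mathsf{Ab})$ are contravariant embeddings, i.e. fully faithful contravariant functors. 2. There are natural isomorphisms of functors $\underline{\mathrm{mod}}(R)\to\mathsf{tfp}(\mathrm{Mod}(R^{op}),\mathsf{Ab})$ (a) $S^1D\,\mathsf E\cong\mathsf E\,\mathrm{Tr}$, (b) $S^kS^1D\,\mathsf E\cong\mathsf E\,\Omega^k\,\mathrm{Tr}$ for all $k\ge 0$, and likewise with $R$ and $R^{op}$ interchanged. 3. On $\mathsf{tfp}(\mathrm{Mod}(R),\mathsf{Ab})$ and on $\mathsf{tfp}(\mathrm{Mod}(R^{op}),\mathsf{Ab})$ the functor $S^2$ is left adjoint to $S_2$; in particular there is a counit of adjunction $S^2S_2\to 1$. 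-/

import Mathlib

open CategoryTheory CategoryTheory.Limits Opposite
open scoped ZeroObject

universe v u

noncomputable section

namespace Linkage

section General

variable {C : Type u} [Category.{v} C]

/-- The `n`-th iterate of an endofunctor. -/
def iter (F : C ⥤ C) : ℕ → (C ⥤ C)
  | 0 => 𝟭 C
  | n + 1 => iter F n ⋙ F

/-- A morphism lifted to the chosen projectives. -/
def overMap [EnoughProjectives C] {X Y : C} (f : X ⟶ Y) : Projective.over X ⟶ Projective.over Y :=
  Projective.factorThru (Projective.π X ≫ f) (Projective.π Y)

lemma overMap_π [EnoughProjectives C] {X Y : C} (f : X ⟶ Y) :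
    overMap f ≫ Projective.π Y = Projective.π X ≫ f := Projective.factorThru_comp _ _

/-- A morphism extended to the chosen injectives. -/
def underMap [EnoughInjectives C] {X Y : C} (f : X ⟶ Y) : Injective.under X ⟶ Injective.under Y :=
  Injective.factorThru (f ≫ Injective.ι Y) (Injective.ι X)

lemma ι_underMap [EnoughInjectives C] {X Y : C} (f : X ⟶ Y) :
    Injective.ι X ≫ underMap f = f ≫ Injective.ι Y := Injective.comp_factorThru _ _

variable [Preadditive C]

/-- Two parallel morphisms are identified when their difference factors through a projective. -/
def stableRel (C : Type u) [Category.{v} C] [Preadditive C] : HomRel C := fun X Y f g =>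
  ∃ (P : C) (_ : Projective P) (a : X ⟶ P) (b : P ⟶ Y), f - g = a ≫ b

/-- The stable category: same objects, morphisms modulo those factoring through projectives.
(When `C` has finite biproducts, `stableRel` is already an additive congruence.) -/
abbrev Stable (C : Type u) [Category.{v} C] [Preadditive C] : Type u :=
  CategoryTheory.Quotient (stableRel C)

section Syzygy

variable [EnoughProjectives C] [HasKernels C]

/-- The syzygy `0 ⟶ Ω X ⟶ P ⟶ X ⟶ 0` for a chosen projective `P` covering `X`. -/
abbrev syz (X : C) : C := kernel (Projective.π X)

/-- The inclusion of the syzygy. -/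
abbrev syzι (X : C) : syz X ⟶ Projective.over X := kernel.ι _

/-- The morphism induced on syzygies by a lift to projectives. -/
def syzMap {X Y : C} (f : X ⟶ Y) : syz X ⟶ syz Y :=
  kernel.lift _ (syzι X ≫ overMap f) (by
    rw [Category.assoc, overMap_π, kernel.condition_assoc, zero_comp])

lemma syzMap_ι {X Y : C} (f : X ⟶ Y) : syzMap f ≫ syzι Y = syzι X ≫ overMap f :=
  kernel.lift_ι _ _ _

/-- Two morphisms of syzygies induced by lifts of one morphism differ by a map which extends to
the projective. -/
lemma syz_unique {X Y : C} {f : X ⟶ Y} {a a' : Projective.over X ⟶ Projective.over Y}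
    {b b' : syz X ⟶ syz Y} (ha : a ≫ Projective.π Y = Projective.π X ≫ f)
    (ha' : a' ≫ Projective.π Y = Projective.π X ≫ f)
    (hb : b ≫ syzι Y = syzι X ≫ a) (hb' : b' ≫ syzι Y = syzι X ≫ a') :
    ∃ s : Projective.over X ⟶ syz Y, b - b' = syzι X ≫ s := by
  refine ⟨kernel.lift _ (a - a') (by rw [Preadditive.sub_comp, ha, ha', sub_self]), ?_⟩
  rw [← cancel_mono (syzι Y), Preadditive.sub_comp, hb, hb', ← Preadditive.comp_sub,
    Category.assoc, kernel.lift_ι]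

/-- The syzygy functor on the stable category. -/
def Omega (C : Type u) [Category.{v} C] [Preadditive C] [EnoughProjectives C] [HasKernels C] :
    Stable C ⥤ Stable C :=
  CategoryTheory.Quotient.lift _
    { obj := fun X => (CategoryTheory.Quotient.functor (stableRel C)).obj (syz X)
      map := fun f => (CategoryTheory.Quotient.functor (stableRel C)).map (syzMap f)
      map_id := fun X => by
        rw [← CategoryTheory.Functor.map_id]
        obtain ⟨s, hs⟩ := syz_unique (overMap_π (𝟙 X)) (a' := 𝟙 _) (by simp) (syzMap_ι (𝟙 X))
          (b' := 𝟙 _) (by simp)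
        exact CategoryTheory.Quotient.sound _ ⟨_, inferInstance, _, _, hs⟩
      map_comp := fun {X Y Z} f g => by
        rw [← CategoryTheory.Functor.map_comp]
        obtain ⟨s, hs⟩ := syz_unique (overMap_π (f ≫ g)) (a' := overMap f ≫ overMap g)
          (by rw [Category.assoc, overMap_π, reassoc_of% (overMap_π f)]) (syzMap_ι (f ≫ g))
          (b' := syzMap f ≫ syzMap g)
          (by rw [Category.assoc, syzMap_ι, reassoc_of% (syzMap_ι f)])
        exact CategoryTheory.Quotient.sound _ ⟨_, inferInstance, _, _, hs⟩ }
    (by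
      rintro X Y f g ⟨P, hP, a, b, hab⟩
      obtain ⟨s, hs⟩ := syz_unique (f := f) (overMap_π f)
        (a' := overMap g + Projective.π X ≫ a ≫ Projective.factorThru b (Projective.π Y))
        (by
          rw [Preadditive.add_comp, overMap_π, Category.assoc, Category.assoc,
            Projective.factorThru_comp, ← hab, ← Preadditive.comp_add]
          congr 1
          abel)
        (syzMap_ι f) (b' := syzMap g)
        (by rw [syzMap_ι, Preadditive.comp_add, kernel.condition_assoc, zero_comp, add_zero])
      exact CategoryTheory.Quotient.sound _ ⟨_, inferInstance, _, _, hs⟩)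

end Syzygy

section Cosyzygy

variable [EnoughInjectives C] [HasCokernels C]

/-- The cosyzygy `0 ⟶ X ⟶ I ⟶ Σ X ⟶ 0` for a chosen injective `I` containing `X`. -/
abbrev cosyz (X : C) : C := cokernel (Injective.ι X)

/-- The projection onto the cosyzygy. -/
abbrev cosyzπ (X : C) : Injective.under X ⟶ cosyz X := cokernel.π _

/-- The morphism induced on cosyzygies by an extension to injectives. -/
def cosyzMap {X Y : C} (f : X ⟶ Y) : cosyz X ⟶ cosyz Y :=
  cokernel.desc _ (underMap f ≫ cosyzπ Y) (by
    rw [reassoc_of% (ι_underMap f), cokernel.condition, comp_zero])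

lemma π_cosyzMap {X Y : C} (f : X ⟶ Y) : cosyzπ X ≫ cosyzMap f = underMap f ≫ cosyzπ Y :=
  cokernel.π_desc _ _ _

/-- Two morphisms of cosyzygies induced by extensions of one morphism differ by a map which
lifts to the injective. -/
lemma cosyz_unique {X Y : C} {f : X ⟶ Y} {a a' : Injective.under X ⟶ Injective.under Y}
    {b b' : cosyz X ⟶ cosyz Y} (ha : Injective.ι X ≫ a = f ≫ Injective.ι Y)
    (ha' : Injective.ι X ≫ a' = f ≫ Injective.ι Y)
    (hb : cosyzπ X ≫ b = a ≫ cosyzπ Y) (hb' : cosyzπ X ≫ b' = a' ≫ cosyzπ Y) :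
    ∃ s : cosyz X ⟶ Injective.under Y, b - b' = s ≫ cosyzπ Y := by
  refine ⟨cokernel.desc _ (a - a') (by rw [Preadditive.comp_sub, ha, ha', sub_self]), ?_⟩
  rw [← cancel_epi (cosyzπ X), Preadditive.comp_sub, hb, hb', ← Preadditive.sub_comp,
    cokernel.π_desc_assoc]

end Cosyzygy

section LeftSatellite

variable [EnoughProjectives C] [HasKernels C] {D : Type*} [Category* D] [Abelian D]

/-- The value `ker (F (Ω X) ⟶ F P)` of the left satellite. -/
abbrev downPt (F : C ⥤ D) (X : C) : D := kernel (F.map (syzι X))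

/-- The left satellite of an additive functor on morphisms. -/
def downMap (F : C ⥤ D) {X Y : C} (f : X ⟶ Y) : downPt F X ⟶ downPt F Y :=
  kernel.map _ _ (F.map (syzMap f)) (F.map (overMap f)) (by
    rw [← F.map_comp, ← F.map_comp, syzMap_ι])

lemma downMap_ι (F : C ⥤ D) {X Y : C} (f : X ⟶ Y) :
    downMap F f ≫ kernel.ι (F.map (syzι Y)) = kernel.ι (F.map (syzι X)) ≫ F.map (syzMap f) :=
  kernel.lift_ι _ _ _

lemma downMap_eq (F : C ⥤ D) [F.Additive] {X Y : C} (f : X ⟶ Y)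
    {a : Projective.over X ⟶ Projective.over Y} {b : syz X ⟶ syz Y}
    (ha : a ≫ Projective.π Y = Projective.π X ≫ f) (hb : b ≫ syzι Y = syzι X ≫ a) :
    downMap F f ≫ kernel.ι (F.map (syzι Y)) = kernel.ι (F.map (syzι X)) ≫ F.map b := by
  obtain ⟨s, hs⟩ := syz_unique (overMap_π f) ha (syzMap_ι f) hb
  rw [sub_eq_iff_eq_add] at hs
  rw [downMap_ι, hs, F.map_add, F.map_comp, Preadditive.comp_add, kernel.condition_assoc,
    zero_comp, zero_add]

/-- The left satellite `S₁ F`, determined by `0 ⟶ S₁ F X ⟶ F (Ω X) ⟶ F P`. -/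
def downFunctor (F : C ⥤ D) [F.Additive] : C ⥤ D where
  obj X := downPt F X
  map f := downMap F f
  map_id X := by
    rw [← cancel_mono (kernel.ι (F.map (syzι X))),
      downMap_eq F (𝟙 X) (a := 𝟙 _) (b := 𝟙 _) (by simp) (by simp)]
    simp
  map_comp {X Y Z} f g := by
    rw [← cancel_mono (kernel.ι (F.map (syzι Z))),
      downMap_eq F (f ≫ g) (a := overMap f ≫ overMap g) (b := syzMap f ≫ syzMap g)
        (by rw [Category.assoc, overMap_π, reassoc_of% (overMap_π f)])
        (by rw [Category.assoc, syzMap_ι, reassoc_of% (syzMap_ι f)]),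
      Category.assoc, downMap_ι, reassoc_of% (downMap_ι F f), F.map_comp]

instance (F : C ⥤ D) [F.Additive] : (downFunctor F).Additive where
  map_add {X Y f g} := by
    change downMap F (f + g) = downMap F f + downMap F g
    rw [← cancel_mono (kernel.ι (F.map (syzι Y))),
      downMap_eq F (f + g) (a := overMap f + overMap g) (b := syzMap f + syzMap g)
        (by simp [overMap_π]) (by simp [syzMap_ι]),
      Preadditive.add_comp, downMap_ι, downMap_ι, F.map_add, Preadditive.comp_add]

/-- The left satellite of a natural transformation. -/
def downTrans {F G : C ⥤ D} [F.Additive] [G.Additive] (α : F ⟶ G) :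
    downFunctor F ⟶ downFunctor G where
  app X := (kernel.map (F.map (syzι X)) (G.map (syzι X)) (α.app (syz X))
    (α.app (Projective.over X)) (α.naturality _) : downPt F X ⟶ downPt G X)
  naturality X Y f := by
    change downMap F f ≫ kernel.map _ _ _ _ _ = kernel.map _ _ _ _ _ ≫ downMap G f
    rw [← cancel_mono (kernel.ι (G.map (syzι Y))), Category.assoc, Category.assoc, downMap_ι,
      kernel.map, kernel.map, kernel.lift_ι, kernel.lift_ι_assoc, reassoc_of% (downMap_ι F f),
      Category.assoc, α.naturality]

lemma downTrans_app_ι {F G : C ⥤ D} [F.Additive] [G.Additive] (α : F ⟶ G) (X : C) :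
    ((downTrans α).app X : downPt F X ⟶ downPt G X) ≫ kernel.ι (G.map (syzι X)) =
      kernel.ι (F.map (syzι X)) ≫ α.app (syz X) :=
  kernel.lift_ι _ _ _

/-- The left satellite endofunctor `S₁` of the category of additive functors. -/
def down (C : Type u) [Category.{v} C] [Preadditive C] [EnoughProjectives C] [HasKernels C]
    (D : Type*) [Category* D] [Abelian D] : (C ⥤+ D) ⥤ (C ⥤+ D) where
  obj F := AdditiveFunctor.of (downFunctor F.obj)
  map α := ObjectProperty.homMk (downTrans α.hom)
  map_id F := by
    apply ObjectProperty.hom_ext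
    ext X
    refine (cancel_mono (kernel.ι (F.obj.map (syzι X)))).1 ((downTrans_app_ι _ X).trans ?_)
    exact (Category.comp_id _).trans (Category.id_comp _).symm
  map_comp {F G H} α β := by
    apply ObjectProperty.hom_ext
    ext X
    refine (cancel_mono (kernel.ι (H.obj.map (syzι X)))).1 ((downTrans_app_ι _ X).trans ?_)
    refine Eq.trans ?_ (Category.assoc _ _ _).symm
    refine Eq.trans ?_ (congrArg _ (downTrans_app_ι _ X).symm)
    refine Eq.trans ?_ (Category.assoc _ _ _)
    refine Eq.trans ?_ (congrArg (· ≫ _) (downTrans_app_ι _ X).symm)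
    exact (Category.assoc _ _ _).symm

end LeftSatellite

section RightSatellite

variable [EnoughInjectives C] [HasCokernels C] {D : Type*} [Category* D] [Abelian D]

/-- The value `coker (F I ⟶ F (Σ X))` of the right satellite. -/
abbrev upPt (F : C ⥤ D) (X : C) : D := cokernel (F.map (cosyzπ X))

/-- The right satellite of an additive functor on morphisms. -/
def upMap (F : C ⥤ D) {X Y : C} (f : X ⟶ Y) : upPt F X ⟶ upPt F Y :=
  cokernel.map _ _ (F.map (underMap f)) (F.map (cosyzMap f)) (by
    rw [← F.map_comp, ← F.map_comp, π_cosyzMap])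

lemma π_upMap (F : C ⥤ D) {X Y : C} (f : X ⟶ Y) :
    cokernel.π (F.map (cosyzπ X)) ≫ upMap F f =
      F.map (cosyzMap f) ≫ cokernel.π (F.map (cosyzπ Y)) :=
  cokernel.π_desc _ _ _

lemma upMap_eq (F : C ⥤ D) [F.Additive] {X Y : C} (f : X ⟶ Y)
    {a : Injective.under X ⟶ Injective.under Y} {b : cosyz X ⟶ cosyz Y}
    (ha : Injective.ι X ≫ a = f ≫ Injective.ι Y) (hb : cosyzπ X ≫ b = a ≫ cosyzπ Y) :
    cokernel.π (F.map (cosyzπ X)) ≫ upMap F f =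
      F.map b ≫ cokernel.π (F.map (cosyzπ Y)) := by
  obtain ⟨s, hs⟩ := cosyz_unique (ι_underMap f) ha (π_cosyzMap f) hb
  rw [sub_eq_iff_eq_add] at hs
  rw [π_upMap, hs, F.map_add, F.map_comp, Preadditive.add_comp, Category.assoc,
    cokernel.condition, comp_zero, zero_add]

/-- The right satellite `S¹ F`, determined by `F I ⟶ F (Σ X) ⟶ S¹ F X ⟶ 0`. -/
def upFunctor (F : C ⥤ D) [F.Additive] : C ⥤ D where
  obj X := upPt F X
  map f := upMap F f
  map_id X := by
    rw [← cancel_epi (cokernel.π (F.map (cosyzπ X))),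
      upMap_eq F (𝟙 X) (a := 𝟙 _) (b := 𝟙 _) (by simp) (by simp)]
    simp
  map_comp {X Y Z} f g := by
    rw [← cancel_epi (cokernel.π (F.map (cosyzπ X))),
      upMap_eq F (f ≫ g) (a := underMap f ≫ underMap g) (b := cosyzMap f ≫ cosyzMap g)
        (by rw [reassoc_of% (ι_underMap f), ι_underMap, Category.assoc])
        (by rw [reassoc_of% (π_cosyzMap f), π_cosyzMap, Category.assoc]),
      reassoc_of% (π_upMap F f), π_upMap, F.map_comp, Category.assoc]

instance (F : C ⥤ D) [F.Additive] : (upFunctor F).Additive where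
  map_add {X Y f g} := by
    change upMap F (f + g) = upMap F f + upMap F g
    rw [← cancel_epi (cokernel.π (F.map (cosyzπ X))),
      upMap_eq F (f + g) (a := underMap f + underMap g) (b := cosyzMap f + cosyzMap g)
        (by simp [ι_underMap]) (by simp [π_cosyzMap]),
      Preadditive.comp_add, π_upMap, π_upMap, F.map_add, Preadditive.add_comp]

/-- The right satellite of a natural transformation. -/
def upTrans {F G : C ⥤ D} [F.Additive] [G.Additive] (α : F ⟶ G) :
    upFunctor F ⟶ upFunctor G where
  app X := (cokernel.map (F.map (cosyzπ X)) (G.map (cosyzπ X)) (α.app (Injective.under X))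
    (α.app (cosyz X)) (α.naturality _) : upPt F X ⟶ upPt G X)
  naturality X Y f := by
    change upMap F f ≫ cokernel.map _ _ _ _ _ = cokernel.map _ _ _ _ _ ≫ upMap G f
    rw [← cancel_epi (cokernel.π (F.map (cosyzπ X))), reassoc_of% (π_upMap F f),
      cokernel.map, cokernel.map, cokernel.π_desc, cokernel.π_desc_assoc, Category.assoc,
      π_upMap, α.naturality_assoc]

lemma π_upTrans_app {F G : C ⥤ D} [F.Additive] [G.Additive] (α : F ⟶ G) (X : C) :
    cokernel.π (F.map (cosyzπ X)) ≫ ((upTrans α).app X : upPt F X ⟶ upPt G X) =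
      α.app (cosyz X) ≫ cokernel.π (G.map (cosyzπ X)) :=
  cokernel.π_desc _ _ _

/-- The right satellite endofunctor `S¹` of the category of additive functors. -/
def up (C : Type u) [Category.{v} C] [Preadditive C] [EnoughInjectives C] [HasCokernels C]
    (D : Type*) [Category* D] [Abelian D] : (C ⥤+ D) ⥤ (C ⥤+ D) where
  obj F := AdditiveFunctor.of (upFunctor F.obj)
  map α := ObjectProperty.homMk (upTrans α.hom)
  map_id F := by
    apply ObjectProperty.hom_ext
    ext X
    refine (cancel_epi (cokernel.π (F.obj.map (cosyzπ X)))).1 ((π_upTrans_app _ X).trans ?_)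
    exact (Category.id_comp _).trans (Category.comp_id _).symm
  map_comp {F G H} α β := by
    apply ObjectProperty.hom_ext
    ext X
    refine (cancel_epi (cokernel.π (F.obj.map (cosyzπ X)))).1 ((π_upTrans_app _ X).trans ?_)
    refine Eq.trans ?_ (Category.assoc _ _ _)
    refine Eq.trans ?_ (congrArg (· ≫ _) (π_upTrans_app _ X).symm)
    refine Eq.trans ?_ (Category.assoc _ _ _).symm
    refine Eq.trans ?_ (congrArg _ (π_upTrans_app _ X).symm)
    exact Category.assoc _ _ _

end RightSatellite

end General

section FinitelyPresented

/-- Functors `F` admitting an exact sequence `(Y, -) ⟶ (X, -) ⟶ F ⟶ 0`. -/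
def isFP (C : Type u) [Category.{v} C] [Preadditive C] :
    ObjectProperty (C ⥤ AddCommGrpCat.{v}) := fun F =>
  ∃ (X Y : C) (α : preadditiveCoyoneda.obj (op Y) ⟶ preadditiveCoyoneda.obj (op X)),
    Nonempty (F ≅ cokernel α)

variable {C : Type u} [Category.{v} C]

lemma exact_app {F G H : C ⥤ AddCommGrpCat.{v}} {φ : F ⟶ G} {ψ : G ⟶ H} {w : φ ≫ ψ = 0}
    (h : (ShortComplex.mk φ ψ w).Exact) {A : C} {b : G.obj A} (hb : ψ.app A b = 0) :
    ∃ a, φ.app A a = b :=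
  ((ShortComplex.mk φ ψ w).map ((evaluation C AddCommGrpCat.{v}).obj A)).ab_exact_iff.1
    (h.map ((evaluation C AddCommGrpCat.{v}).obj A)) b hb

lemma app_surj {F G : C ⥤ AddCommGrpCat.{v}} (φ : F ⟶ G) [Epi φ] {A : C} (b : G.obj A) :
    ∃ a, φ.app A a = b :=
  (AddCommGrpCat.epi_iff_surjective _).1 inferInstance b

lemma app_inj {F G : C ⥤ AddCommGrpCat.{v}} (φ : F ⟶ G) [Mono φ] {A : C} {a b : F.obj A}
    (h : φ.app A a = φ.app A b) : a = b :=
  (AddCommGrpCat.mono_iff_injective _).1 inferInstance h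

lemma app_nat {F G : C ⥤ AddCommGrpCat.{v}} (φ : F ⟶ G) {A B : C} (g : A ⟶ B) (a : F.obj A) :
    φ.app B (F.map g a) = G.map g (φ.app A a) :=
  ConcreteCategory.congr_hom (φ.naturality g) a

lemma map_comp_el (F : C ⥤ AddCommGrpCat.{v}) {A B D : C} (g : A ⟶ B) (h : B ⟶ D)
    (a : F.obj A) : F.map (g ≫ h) a = F.map h (F.map g a) :=
  ConcreteCategory.congr_hom (F.map_comp g h) a

lemma app_comp_zero {F G H : C ⥤ AddCommGrpCat.{v}} {φ : F ⟶ G} {ψ : G ⟶ H} (w : φ ≫ ψ = 0)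
    {A : C} (a : F.obj A) : ψ.app A (φ.app A a) = 0 :=
  ConcreteCategory.congr_hom (NatTrans.congr_app w A) a

variable [Preadditive C]

lemma map_sub_el (F : C ⥤ AddCommGrpCat.{v}) [F.Additive] {A B : C} (g h : A ⟶ B)
    (a : F.obj A) : F.map (g - h) a = F.map g a - F.map h a :=
  ConcreteCategory.congr_hom (F.map_sub (f := g) (g := h)) a

lemma map_zero_el (F : C ⥤ AddCommGrpCat.{v}) [F.Additive] (A B : C)
    (a : F.obj A) : F.map (0 : A ⟶ B) a = 0 :=
  ConcreteCategory.congr_hom (F.map_zero A B) a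

lemma map_add_el (F : C ⥤ AddCommGrpCat.{v}) [F.Additive] {A B : C} (g h : A ⟶ B)
    (a : F.obj A) : F.map (g + h) a = F.map g a + F.map h a :=
  ConcreteCategory.congr_hom (F.map_add (f := g) (g := h)) a

/-- The element `x` is killed by `f`, weakly universally. -/
structure Ann (F : C ⥤ AddCommGrpCat.{v}) {X Y : C} (f : X ⟶ Y) (x : F.obj X) : Prop where
  ann : F.map f x = 0
  fac : ∀ ⦃A : C⦄ (g : X ⟶ A), F.map g x = 0 → ∃ h : Y ⟶ A, g = f ≫ h

/-- The element `x` generates the functor `F`. -/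
def Gen (F : C ⥤ AddCommGrpCat.{v}) {X : C} (x : F.obj X) : Prop :=
  ∀ ⦃A : C⦄ (a : F.obj A), ∃ g : X ⟶ A, F.map g x = a

/-- The natural transformation out of a representable functor given by an element. -/
def ofElem (F : C ⥤ AddCommGrpCat.{v}) [F.Additive] {X : C} (x : F.obj X) :
    preadditiveCoyoneda.obj (op X) ⟶ F where
  app A := AddCommGrpCat.ofHom
    { toFun := fun g : X ⟶ A => F.map g x
      map_zero' := map_zero_el F X A x
      map_add' := fun g h => map_add_el F g h x }
  naturality A B k := by
    ext g
    exact map_comp_el F g k x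

lemma ofElem_app (F : C ⥤ AddCommGrpCat.{v}) [F.Additive] {X A : C} (x : F.obj X) (g : X ⟶ A) :
    (ofElem F x).app A g = F.map g x := rfl

/-- A presented functor receives a natural transformation to any functor with an element
satisfying the relations. -/
lemma exists_hom {F G : C ⥤ AddCommGrpCat.{v}} [F.Additive] [G.Additive] {X Y : C} {f : X ⟶ Y}
    {x : F.obj X} (hx : Gen F x) (hf : Ann F f x) {w : G.obj X} (hw : G.map f w = 0) :
    ∃ v : F ⟶ G, v.app X x = w := by
  have wd : ∀ ⦃A : C⦄ (g h : X ⟶ A), F.map g x = F.map h x → G.map g w = G.map h w := by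
    intro A g h e
    obtain ⟨k, hk⟩ := hf.fac (g - h) (by rw [map_sub_el, e, sub_self])
    rw [← sub_eq_zero, ← map_sub_el, hk, map_comp_el, hw, map_zero]
  choose c hc using hx
  refine ⟨{ app := fun A => AddCommGrpCat.ofHom
              { toFun := fun a => G.map (c a) w
                map_zero' := ?_
                map_add' := fun a b => ?_ }
            naturality := fun A B g => ?_ }, ?_⟩
  · rw [wd (c 0) 0 (by rw [hc, map_zero_el]), map_zero_el]
  · rw [← map_add_el]
    exact wd _ _ (by rw [hc, map_add_el, hc, hc])
  · ext a
    change G.map (c (F.map g a)) w = G.map g (G.map (c a) w)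
    rw [← map_comp_el]
    exact wd _ _ (by rw [hc, map_comp_el, hc])
  · change G.map (c x) w = w
    rw [wd (c x) (𝟙 X) (by rw [hc]; simp)]
    simp

lemma isFP.additive {F : C ⥤ AddCommGrpCat.{v}} (hF : isFP C F) : F.Additive := by
  obtain ⟨X, Y, α, ⟨e⟩⟩ := hF
  refine (Functor.additive_iff_of_iso e).2 ⟨fun {A B g h} => ?_⟩
  ext b
  obtain ⟨a, rfl⟩ := app_surj (cokernel.π α) b
  change (cokernel α).map (g + h) _ = (cokernel α).map g _ + (cokernel α).map h _
  rw [← app_nat, ← app_nat, ← app_nat, map_add_el, map_add]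

lemma isFP_iff (F : C ⥤ AddCommGrpCat.{v}) :
    isFP C F ↔ F.Additive ∧ ∃ (X Y : C) (f : X ⟶ Y) (x : F.obj X), Gen F x ∧ Ann F f x := by
  constructor
  · intro hF
    refine ⟨hF.additive, ?_⟩
    obtain ⟨X, Y, α, ⟨e⟩⟩ := hF
    obtain ⟨φ, rfl⟩ := preadditiveCoyoneda.map_surjective α
    set p : preadditiveCoyoneda.obj (op X) ⟶ F :=
      cokernel.π (preadditiveCoyoneda.map φ) ≫ e.inv with hp
    have hw : preadditiveCoyoneda.map φ ≫ p = 0 := by simp [hp]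
    have key : ∀ (A : C) (g : X ⟶ A), p.app A g = F.map g (p.app X (𝟙 X)) := by
      intro A g
      refine Eq.trans (congrArg _ ?_) (app_nat p g _)
      exact (Category.id_comp g).symm
    have ex : (ShortComplex.mk _ p hw).Exact := by
      refine (ShortComplex.exact_iff_of_iso ?_).1
        (ShortComplex.exact_cokernel (preadditiveCoyoneda.map φ))
      exact ShortComplex.isoMk (Iso.refl _) (Iso.refl _) e.symm (by simp) (by simp [hp])
    have : Epi p := epi_comp _ _
    refine ⟨X, Y, φ.unop, p.app X (𝟙 X), ?_, ?_, ?_⟩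
    · intro A a
      obtain ⟨g, hg⟩ := app_surj p a
      exact ⟨g, (key A g).symm.trans hg⟩
    · rw [← key]
      have := app_comp_zero hw (A := Y) (𝟙 Y : Y ⟶ Y)
      refine Eq.trans (congrArg _ ?_) this
      exact (Category.comp_id _).symm
    · intro A g hg
      obtain ⟨h, hh⟩ := exact_app ex (b := g) ((key A g).trans hg)
      exact ⟨h, hh.symm⟩
  · rintro ⟨hF, X, Y, f, x, hx, hf⟩
    refine ⟨X, Y, preadditiveCoyoneda.map f.op, ⟨?_⟩⟩
    have w : preadditiveCoyoneda.map f.op ≫ ofElem F x = 0 := by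
      ext A h
      refine (map_comp_el F f h x).trans ?_
      rw [hf.ann, map_zero]
      rfl
    have : IsIso (cokernel.desc _ _ w) := by
      rw [NatTrans.isIso_iff_isIso_app]
      intro A
      have e : ∀ g : X ⟶ A, (cokernel.desc _ _ w).app A
          ((cokernel.π (preadditiveCoyoneda.map f.op)).app A g) = F.map g x :=
        fun g => ConcreteCategory.congr_hom (NatTrans.congr_app (cokernel.π_desc _ _ w) A) g
      rw [ConcreteCategory.isIso_iff_bijective]
      constructor
      · refine (injective_iff_map_eq_zero _).2 fun b hb => ?_
        obtain ⟨g, rfl⟩ := app_surj (cokernel.π (preadditiveCoyoneda.map f.op)) b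
        obtain ⟨h, rfl⟩ := hf.fac g ((e g).symm.trans hb)
        exact app_comp_zero (cokernel.condition (preadditiveCoyoneda.map f.op)) (A := A) h
      · intro a
        obtain ⟨g, rfl⟩ := hx a
        exact ⟨_, e g⟩
    exact (asIso (cokernel.desc _ _ w)).symm

instance : (isFP C).IsClosedUnderIsomorphisms where
  of_iso := by
    rintro F G i ⟨X, Y, α, ⟨e⟩⟩
    exact ⟨X, Y, α, ⟨i.symm ≪≫ e⟩⟩

end FinitelyPresented

section FPAbelian

variable {C : Type u} [Category.{v} C] [Abelian C]

lemma isFP.exists_ann {F : C ⥤ AddCommGrpCat.{v}} (hF : isFP C F) {X : C} (y : F.obj X) :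
    ∃ (Z : C) (f : X ⟶ Z), Ann F f y := by
  obtain ⟨hadd, X', Y', f', x', hx, hf⟩ := (isFP_iff F).1 hF
  obtain ⟨t, rfl⟩ := hx y
  refine ⟨pushout t f', pushout.inl t f', ?_, ?_⟩
  · rw [← map_comp_el, pushout.condition, map_comp_el, hf.ann, map_zero]
  · intro A g hg
    rw [← map_comp_el] at hg
    obtain ⟨h, hh⟩ := hf.fac _ hg
    exact ⟨pushout.desc g h hh, (pushout.inl_desc _ _ _).symm⟩

lemma isFP.of_shortExact_left {K F G : C ⥤ AddCommGrpCat.{v}} {i : K ⟶ F} {φ : F ⟶ G} [Mono i]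
    {w : i ≫ φ = 0} (h : (ShortComplex.mk i φ w).Exact) (hF : isFP C F) (hG : isFP C G) :
    isFP C K := by
  have := hF.additive
  have := hG.additive
  obtain ⟨-, X, Y, f, x, hx, hf⟩ := (isFP_iff F).1 hF
  obtain ⟨Z, k, hk⟩ := hG.exists_ann (φ.app X x)
  obtain ⟨z, hz⟩ := exact_app h (b := F.map k x) (by rw [app_nat, hk.ann])
  obtain ⟨W, l, hl⟩ := hF.exists_ann (F.map k x)
  refine (isFP_iff K).2 ⟨⟨fun {A B g h} => ?_⟩, Z, W, l, z, ?_, ?_, ?_⟩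
  · ext a
    apply app_inj i
    change i.app B (K.map (g + h) a) = i.app B (K.map g a + K.map h a)
    rw [map_add, app_nat, app_nat, app_nat, map_add_el]
  · intro A a
    obtain ⟨g, hg⟩ := hx (i.app A a)
    obtain ⟨m, rfl⟩ := hk.fac g (by rw [← app_nat, hg]; exact app_comp_zero w a)
    refine ⟨m, app_inj i ?_⟩
    rw [app_nat, hz, ← map_comp_el, hg]
  · apply app_inj i
    rw [app_nat, hz, hl.ann, map_zero]
  · intro A g hg
    refine hl.fac g ?_
    rw [← hz, ← app_nat, hg, map_zero]

/-- An annihilator for an element modulo the image of a finitely presented functor. -/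
lemma isFP.exists_ann_mod {F G Q : C ⥤ AddCommGrpCat.{v}} {φ : F ⟶ G} {p : G ⟶ Q} 
    {w : φ ≫ p = 0} (h : (ShortComplex.mk φ p w).Exact) (hF : isFP C F) (hG : isFP C G)
    [Q.Additive] {X : C} {x : G.obj X} (hx : Gen G x) : ∃ (Z : C) (f : X ⟶ Z), 
      Ann Q f (p.app X x) := by
  have := hF.additive
  have := hG.additive
  obtain ⟨-, W, -, -, y, hy, -⟩ := (isFP_iff F).1 hF
  obtain ⟨Y, f, hf⟩ := hG.exists_ann x
  obtain ⟨t, ht⟩ := hx (φ.app W y)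
  refine ⟨W ⊞ Y, biprod.lift t f, ?_, ?_⟩
  · have e : biprod.lift t f = t ≫ biprod.inl + f ≫ biprod.inr := by ext <;> simp
    rw [e, map_add_el, map_comp_el, map_comp_el, ← app_nat, ← app_nat, ← app_nat, ht, hf.ann,
      map_zero, map_zero, add_zero, app_nat]
    rw [app_comp_zero w, map_zero]
  · intro A g hg
    obtain ⟨b, hb⟩ := exact_app h (b := G.map g x) (by rw [app_nat, hg])
    obtain ⟨s, rfl⟩ := hy b
    obtain ⟨m, hm⟩ := hf.fac (g - t ≫ s) (by
      rw [map_sub_el, map_comp_el, ht, ← hb, app_nat, sub_self])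
    exact ⟨biprod.desc s m, by rw [biprod.lift_desc, ← hm]; abel⟩

lemma isFP.of_exact_right {F G Q : C ⥤ AddCommGrpCat.{v}} {φ : F ⟶ G} {p : G ⟶ Q} [Epi p]
    {w : φ ≫ p = 0} (h : (ShortComplex.mk φ p w).Exact) (hF : isFP C F) (hG : isFP C G) :
    isFP C Q := by
  have := hG.additive
  have : Q.Additive := ⟨fun {A B g h} => by
    ext b
    obtain ⟨a, rfl⟩ := app_surj p b
    change Q.map (g + h) _ = Q.map g _ + Q.map h _
    rw [← app_nat, ← app_nat, ← app_nat, map_add_el, map_add]⟩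
  obtain ⟨-, X, -, -, x, hx, -⟩ := (isFP_iff G).1 hG
  obtain ⟨Z, f, hf⟩ := isFP.exists_ann_mod h hF hG hx
  refine (isFP_iff Q).2 ⟨inferInstance, X, Z, f, p.app X x, ?_, hf⟩
  intro A b
  obtain ⟨a, rfl⟩ := app_surj p b
  obtain ⟨g, rfl⟩ := hx a
  exact ⟨g, (app_nat p g x).symm⟩

lemma isFP_representable (X : Cᵒᵖ) : isFP C (preadditiveCoyoneda.obj X) := by
  refine (isFP_iff _).2 ⟨inferInstance, unop X, 0, 0, 𝟙 (unop X), ?_, ?_, ?_⟩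
  · intro A a
    exact ⟨a, Category.id_comp _⟩
  · exact comp_zero
  · intro A g hg
    refine ⟨0, ?_⟩
    rw [comp_zero]
    exact (Category.id_comp g).symm.trans hg

instance : (isFP C).ContainsZero where
  exists_zero := by
    refine ⟨0, isZero_zero _, (isFP_iff _).2 ⟨Functor.Additive.of_isZero (isZero_zero _), 0, 0, 0,
      0, ?_⟩⟩
    have hs : ∀ A : C, Subsingleton ((0 : C ⥤ AddCommGrpCat.{v}).obj A) := fun A =>
      AddCommGrpCat.subsingleton_of_isZero
        (((evaluation C AddCommGrpCat.{v}).obj A).map_isZero (isZero_zero _))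
    exact ⟨fun A a => ⟨0, (hs A).elim _ _⟩, (hs _).elim _ _,
      fun A g _ => ⟨0, (isZero_zero C).eq_of_src _ _⟩⟩

instance : (isFP C).IsClosedUnderKernels where
  kernels_le := by
    rintro _ ⟨φ, k, hk, hF, hG⟩
    have : Mono k.ι := Fork.IsLimit.mono hk
    exact isFP.of_shortExact_left (w := k.condition)
      ((ShortComplex.exact_and_mono_f_iff_f_is_kernel (ShortComplex.mk _ _ k.condition)).2
        ⟨IsLimit.ofIsoLimit hk (Fork.ext (Iso.refl _))⟩).1 hF hG

instance : (isFP C).IsClosedUnderCokernels where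
  cokernels_le := by
    rintro _ ⟨φ, k, hk, hF, hG⟩
    have : Epi k.π := Cofork.IsColimit.epi hk
    exact isFP.of_exact_right (w := k.condition)
      ((ShortComplex.exact_and_epi_g_iff_g_is_cokernel (ShortComplex.mk _ _ k.condition)).2
        ⟨IsColimit.ofIsoColimit hk (Cofork.ext (Iso.refl _))⟩).1 hF hG

lemma isFP.biprod {F G : C ⥤ AddCommGrpCat.{v}} (hF : isFP C F) (hG : isFP C G) :
    isFP C (F ⊞ G) := by
  have := hF.additive
  have := hG.additive
  obtain ⟨-, X, Y, f, x, hx, hf⟩ := (isFP_iff F).1 hF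
  obtain ⟨-, X', Y', f', x', hx', hf'⟩ := (isFP_iff G).1 hG
  have ext0 : ∀ {A : C} {a b : (F ⊞ G).obj A},
      (biprod.fst : F ⊞ G ⟶ F).app A a = (biprod.fst : F ⊞ G ⟶ F).app A b →
      (biprod.snd : F ⊞ G ⟶ G).app A a = (biprod.snd : F ⊞ G ⟶ G).app A b → a = b := by
    intro A a b h1 h2
    have e : ∀ c : (F ⊞ G).obj A, c = (biprod.inl : F ⟶ F ⊞ G).app A
        ((biprod.fst : F ⊞ G ⟶ F).app A c) + (biprod.inr : G ⟶ F ⊞ G).app A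
        ((biprod.snd : F ⊞ G ⟶ G).app A c) := fun c =>
      ConcreteCategory.congr_hom (NatTrans.congr_app (biprod.total (X := F) (Y := G)).symm A) c
    rw [e a, e b, h1, h2]
  have hfl : ∀ {A : C} (a : F.obj A),
      (biprod.fst : F ⊞ G ⟶ F).app A ((biprod.inl : F ⟶ F ⊞ G).app A a) = a := fun {A} a =>
    ConcreteCategory.congr_hom (NatTrans.congr_app (biprod.inl_fst (X := F) (Y := G)) A) a
  have hfr : ∀ {A : C} (a : G.obj A),
      (biprod.fst : F ⊞ G ⟶ F).app A ((biprod.inr : G ⟶ F ⊞ G).app A a) = 0 := fun {A} a =>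
    ConcreteCategory.congr_hom (NatTrans.congr_app (biprod.inr_fst (X := F) (Y := G)) A) a
  have hsl : ∀ {A : C} (a : F.obj A),
      (biprod.snd : F ⊞ G ⟶ G).app A ((biprod.inl : F ⟶ F ⊞ G).app A a) = 0 := fun {A} a =>
    ConcreteCategory.congr_hom (NatTrans.congr_app (biprod.inl_snd (X := F) (Y := G)) A) a
  have hsr : ∀ {A : C} (a : G.obj A),
      (biprod.snd : F ⊞ G ⟶ G).app A ((biprod.inr : G ⟶ F ⊞ G).app A a) = a := fun {A} a =>
    ConcreteCategory.congr_hom (NatTrans.congr_app (biprod.inr_snd (X := F) (Y := G)) A) a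
  set z : (F ⊞ G).obj (X ⊞ X') := (biprod.inl : F ⟶ F ⊞ G).app _ (F.map biprod.inl x) +
    (biprod.inr : G ⟶ F ⊞ G).app _ (G.map biprod.inr x') with hz
  have z1 : ∀ {A : C} (g : X ⊞ X' ⟶ A), (biprod.fst : F ⊞ G ⟶ F).app A ((F ⊞ G).map g z) =
      F.map (biprod.inl ≫ g) x := by
    intro A g
    rw [app_nat, hz, map_add, hfl, hfr, add_zero, map_comp_el]
  have z2 : ∀ {A : C} (g : X ⊞ X' ⟶ A), (biprod.snd : F ⊞ G ⟶ G).app A ((F ⊞ G).map g z) =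
      G.map (biprod.inr ≫ g) x' := by
    intro A g
    rw [app_nat, hz, map_add, hsl, hsr, zero_add, map_comp_el]
  refine (isFP_iff _).2 ⟨⟨fun {A B g h} => ?_⟩, X ⊞ X', Y ⊞ Y', biprod.map f f', z, ?_, ?_, ?_⟩
  · ext a
    change (F ⊞ G).map (g + h) a = (F ⊞ G).map g a + (F ⊞ G).map h a
    apply ext0
    · rw [map_add, app_nat, app_nat, app_nat, map_add_el]
    · rw [map_add, app_nat, app_nat, app_nat, map_add_el]
  · intro A a
    obtain ⟨g, hg⟩ := hx ((biprod.fst : F ⊞ G ⟶ F).app A a)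
    obtain ⟨h, hh⟩ := hx' ((biprod.snd : F ⊞ G ⟶ G).app A a)
    exact ⟨biprod.desc g h, ext0 (by rw [z1, biprod.inl_desc, hg]) (by rw [z2, biprod.inr_desc, hh])⟩
  · apply ext0
    · rw [z1, biprod.inl_map, map_comp_el, hf.ann, map_zero, map_zero]
    · rw [z2, biprod.inr_map, map_comp_el, hf'.ann, map_zero, map_zero]
  · intro A g hg
    obtain ⟨h, hh⟩ := hf.fac (biprod.inl ≫ g) (by rw [← z1, hg, map_zero])
    obtain ⟨h', hh'⟩ := hf'.fac (biprod.inr ≫ g) (by rw [← z2, hg, map_zero])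
    refine ⟨biprod.desc h h', ?_⟩
    ext
    · simpa using hh
    · simpa using hh'

instance : (isFP C).IsClosedUnderBinaryProducts where
  limitsOfShape_le := by
    rintro Z ⟨p⟩
    have h := isFP.biprod (p.prop_diag_obj ⟨.left⟩) (p.prop_diag_obj ⟨.right⟩)
    refine (isFP C).prop_of_iso ?_ h
    refine biprod.isoProd _ _ ≪≫ ?_
    exact IsLimit.conePointUniqueUpToIso (prodIsProd _ _)
      ((IsLimit.postcomposeHomEquiv (diagramIsoPair p.diag) _).symm p.isLimit)

instance : (isFP C).IsClosedUnderFiniteProducts := .mk'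

/-- The category `fp(C, Ab)` of finitely presented functors. -/
abbrev FP (C : Type u) [Category.{v} C] [Abelian C] : Type (max u (v + 1)) :=
  (isFP C).FullSubcategory

end FPAbelian

section EnoughInjectives

variable {C : Type u} [Category.{v} C] [Abelian C]

/-- A functor presented by a morphism of projectives is right exact. -/
lemma right_exact_of_projective {I : C ⥤ AddCommGrpCat.{v}} [I.Additive] {P Q : C} [Projective P]
    [Projective Q] {f : P ⟶ Q} {x : I.obj P} (hx : Gen I x) (hf : Ann I f x)
    {X Y Z : C} {u : X ⟶ Y} {c : Y ⟶ Z} {w : u ≫ c = 0} (h : (ShortComplex.mk u c w).Exact)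
    [Epi c] {y : I.obj Y} (hy : I.map c y = 0) : ∃ x' : I.obj X, I.map u x' = y := by
  obtain ⟨s, rfl⟩ := hx y
  rw [← map_comp_el] at hy
  obtain ⟨k, hk⟩ := hf.fac _ hy
  have e : (s - f ≫ Projective.factorThru k c) ≫ c = 0 := by
    rw [Preadditive.sub_comp, Category.assoc, Projective.factorThru_comp, hk, sub_self]
  refine ⟨I.map (h.liftFromProjective (s - f ≫ Projective.factorThru k c) e) x, ?_⟩
  rw [← map_comp_el, h.liftFromProjective_comp, map_sub_el, map_comp_el, hf.ann, map_zero, sub_zero]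

/-- A finitely presented functor presented by a morphism of projectives is injective. -/
lemma injective_of_projective (I : FP C) {P Q : C} [Projective P]
    [Projective Q] {f : P ⟶ Q} {x : I.obj.obj P} (hx : Gen I.obj x) (hf : Ann I.obj f x) :
    Injective I where
  factors {F G} u i _ := by
    have := (isFP C).preservesMonomorphisms_ι_of_isNormalEpiCategory
    have hi : Mono i.hom := inferInstanceAs (Mono ((isFP C).ι.map i))
    have := F.property.additive
    have := G.property.additive
    have := I.property.additive
    obtain ⟨-, X, Y, g, y, hy, hg⟩ := (isFP_iff G.obj).1 G.property
    have hex := ShortComplex.exact_cokernel i.hom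
    have : (cokernel i.hom).Additive :=
      (isFP.of_exact_right hex F.property G.property).additive
    obtain ⟨Z, k, hk⟩ := isFP.exists_ann_mod hex F.property G.property hy
    obtain ⟨a, ha⟩ := exact_app hex (b := G.obj.map k y) (by rw [app_nat, hk.ann])
    obtain ⟨w, hw⟩ := right_exact_of_projective hx hf (ShortComplex.exact_cokernel k)
      (y := u.hom.app Z a) (by
        rw [← app_nat]
        have : F.obj.map (cokernel.π k) a = 0 := by
          apply app_inj i.hom
          rw [app_nat, ha, ← map_comp_el, cokernel.condition, map_zero_el, map_zero]
        rw [this, map_zero])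
    have key : ∀ {A : C} (b : F.obj.obj A) (h : X ⟶ A), i.hom.app A b = G.obj.map h y →
        u.hom.app A b = I.obj.map h w := by
      intro A b h e
      obtain ⟨m, rfl⟩ := hk.fac h (by
        rw [← app_nat, ← e]
        exact app_comp_zero (cokernel.condition i.hom) b)
      have : b = F.obj.map m a := by
        apply app_inj i.hom
        rw [e, app_nat, ha, map_comp_el]
      rw [this, app_nat, ← hw, map_comp_el]
    obtain ⟨v, hv⟩ := exists_hom hy hg (w := w) (by
      rw [← key 0 g (by rw [hg.ann, map_zero]), map_zero])
    refine ⟨ObjectProperty.homMk v, ?_⟩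
    apply ObjectProperty.hom_ext
    ext A b
    obtain ⟨h, hh⟩ := hy (i.hom.app A b)
    change v.app A (i.hom.app A b) = u.hom.app A b
    rw [key b h hh.symm, ← hh, app_nat, hv]

instance [EnoughProjectives C] : EnoughInjectives (FP C) where
  presentation F := by
    have := F.property.additive
    obtain ⟨-, X, Y, f, x, hx, hf⟩ := (isFP_iff F.obj).1 F.property
    let p := Projective.π X
    let q := Projective.π Y
    let κ := Projective.π (kernel q) ≫ kernel.ι q
    let α := Projective.factorThru (p ≫ f) q
    have hα : α ≫ q = p ≫ f := Projective.factorThru_comp _ _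
    have hκ : κ ≫ q = 0 := by simp [κ]
    let t := biprod.desc α κ
    let I : FP C := ⟨cokernel (preadditiveCoyoneda.map t.op), _, _, _, ⟨Iso.refl _⟩⟩
    have hI := I.property.additive
    let π : preadditiveCoyoneda.obj (op (Projective.over X ⊞ Projective.over (kernel q))) ⟶ I.obj :=
      cokernel.π (preadditiveCoyoneda.map t.op)
    have hπ : Epi π := inferInstanceAs (Epi (cokernel.π _))
    let z := π.app _ (𝟙 _ : Projective.over X ⊞ Projective.over (kernel q) ⟶ _)
    have hz : ∀ {A : C} (g : Projective.over X ⊞ Projective.over (kernel q) ⟶ A),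
        π.app A g = I.obj.map g z := fun g =>
      (congrArg _ (Category.id_comp g).symm).trans (app_nat π g _)
    have hgen : Gen I.obj z := fun A a => by
      obtain ⟨g, hg⟩ := app_surj π a
      exact ⟨g, (hz g).symm.trans hg⟩
    have hann : Ann I.obj t z := by
      constructor
      · rw [← hz]
        refine Eq.trans (congrArg _ (Category.comp_id t).symm) ?_
        exact app_comp_zero (cokernel.condition (preadditiveCoyoneda.map t.op)) (𝟙 _)
      · intro A g hg
        obtain ⟨h, hh⟩ := exact_app (ShortComplex.exact_cokernel (preadditiveCoyoneda.map t.op))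
          (b := g) ((hz g).trans hg)
        exact ⟨h, hh.symm⟩
    obtain ⟨v, hv⟩ := exists_hom hx hf (G := I.obj) (w := I.obj.map (biprod.desc p 0) z) (by
      have : biprod.desc p 0 ≫ f = t ≫ q := by
        ext
        · simp [t, hα]
        · simp [t, hκ]
      rw [← map_comp_el, this, map_comp_el, hann.ann, map_zero])
    have hmono : Mono v := by
      rw [NatTrans.mono_iff_mono_app]
      intro A
      rw [AddCommGrpCat.mono_iff_injective]
      refine (injective_iff_map_eq_zero _).2 fun a ha => ?_
      obtain ⟨h, rfl⟩ := hx a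
      rw [app_nat, hv, ← map_comp_el] at ha
      obtain ⟨m, hm⟩ := hann.fac _ ha
      have h1 : p ≫ h = α ≫ m := by simpa [t] using congrArg (biprod.inl ≫ ·) hm
      have h2 : κ ≫ m = 0 := by simpa [t] using (congrArg (biprod.inr ≫ ·) hm).symm
      have h3 : kernel.ι q ≫ m = 0 := by
        rw [← cancel_epi (Projective.π (kernel q)), ← Category.assoc, comp_zero]
        exact h2
      have h4 : h = f ≫ (Abelian.epiIsCokernelOfKernel _ (kernelIsKernel q)).desc
          (CokernelCofork.ofπ m h3) := by
        rw [← cancel_epi p, h1, ← Category.assoc, ← hα, Category.assoc]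
        congr 1
        exact ((Abelian.epiIsCokernelOfKernel _ (kernelIsKernel q)).fac
          (CokernelCofork.ofπ m h3) WalkingParallelPair.one).symm
      rw [h4, map_comp_el, hf.ann, map_zero]
    exact ⟨{ J := I
             injective := injective_of_projective I hgen hann
             f := ObjectProperty.homMk v
             mono := (isFP C).ι.mono_of_mono_map hmono }⟩

end EnoughInjectives

section Modules

variable (A B U : Type u) [Ring A] [Ring B] [AddCommGroup U] [Module A U] [Module B U]

/-- Finitely presented modules. -/
def isFPMod : ObjectProperty (ModuleCat.{u} A) := fun M => Module.FinitePresentation A M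

/-- The category `mod(A)` of finitely presented left `A`-modules; right `R`-modules are
modules over `Rᵐᵒᵖ`. -/
abbrev FPMod : Type (u + 1) := (isFPMod A).FullSubcategory

/-- The category `mod(A)` is abelian. -/
class IsModAbelian : Prop where
  nonempty_abelian : Nonempty (Abelian (FPMod A))

/-- A ring is coherent if `mod` is abelian on both sides. -/
class IsCoherent (R : Type u) [Ring R] : Prop where
  left : IsModAbelian R
  right : IsModAbelian Rᵐᵒᵖ

instance (R : Type u) [Ring R] [IsCoherent R] : IsModAbelian R := IsCoherent.left

instance (R : Type u) [Ring R] [IsCoherent R] : IsModAbelian Rᵐᵒᵖ := IsCoherent.right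

instance [h : IsModAbelian A] : HasKernels (FPMod A) := by
  have := h.nonempty_abelian.some
  have : HasEqualizers (FPMod A) := Abelian.hasEqualizers
  exact hasKernels_of_hasEqualizers _

variable {A}

instance (M : FPMod A) : Module.FinitePresentation A M.obj := M.property

/-- A finitely presented module as an object of `mod(A)`. -/
abbrev FPMod.of (M : Type u) [AddCommGroup M] [Module A M] [h : Module.FinitePresentation A M] :
    FPMod A := ⟨ModuleCat.of A M, h⟩

/-- A linear map as a morphism of `mod(A)`. -/
abbrev FPMod.ofHom {M N : FPMod A} (f : M.obj →ₗ[A] N.obj) : M ⟶ N :=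
  ObjectProperty.homMk (ModuleCat.ofHom f)

lemma FPMod.surjective_of_epi {M N : FPMod A} (e : M ⟶ N) [Epi e] :
    Function.Surjective e.hom.hom := by
  rw [← LinearMap.range_eq_top]
  have : Module.FinitePresentation A (N.obj ⧸ LinearMap.range e.hom.hom) :=
    Module.finitePresentation_of_surjective (LinearMap.range e.hom.hom).mkQ
      (Submodule.mkQ_surjective _) (by
        rw [Submodule.ker_mkQ, LinearMap.range_eq_map]
        exact (Module.Finite.fg_top).map _)
  let q : N ⟶ FPMod.of (N.obj ⧸ LinearMap.range e.hom.hom) :=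
    FPMod.ofHom (LinearMap.range e.hom.hom).mkQ
  have hq : q = 0 := by
    rw [← cancel_epi e, comp_zero]
    apply ObjectProperty.hom_ext
    ext x
    exact (Submodule.Quotient.mk_eq_zero _).2 ⟨x, rfl⟩
  rw [← Submodule.ker_mkQ (LinearMap.range e.hom.hom), LinearMap.ker_eq_top]
  exact congrArg (fun t : N ⟶ FPMod.of (N.obj ⧸ LinearMap.range e.hom.hom) => t.hom.hom) hq

lemma FPMod.epi_of_surjective {M N : FPMod A} (e : M ⟶ N) (h : Function.Surjective e.hom.hom) :
    Epi e :=
  (isFPMod A).ι.epi_of_epi_map ((ModuleCat.epi_iff_surjective e.hom).2 h)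

instance (P : FPMod A) [Module.Projective A P.obj] : Projective P where
  factors {M N} f e _ := by
    obtain ⟨g, hg⟩ := Module.projective_lifting_property e.hom.hom f.hom.hom
      (FPMod.surjective_of_epi e)
    exact ⟨FPMod.ofHom g, ObjectProperty.hom_ext _ (ModuleCat.hom_ext hg)⟩

lemma FPMod.exists_free (M : FPMod A) :
    ∃ (n : ℕ) (f : (Fin n → A) →ₗ[A] M.obj), Function.Surjective f := by
  obtain ⟨n, m, f, g, hf, -⟩ := Module.FinitePresentation.exists_fin' A M.obj
  exact ⟨n, f, hf⟩

lemma FPMod.module_projective (P : FPMod A) [Projective P] : Module.Projective A P.obj := by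
  obtain ⟨n, f, hf⟩ := P.exists_free
  let e : FPMod.of (Fin n → A) ⟶ P := FPMod.ofHom f
  have := FPMod.epi_of_surjective e hf
  have hs := Projective.factorThru_comp (𝟙 P) e
  exact Module.Projective.of_split (Projective.factorThru (𝟙 P) e).hom.hom f
    (congrArg (fun t : P ⟶ P => t.hom.hom) hs)

instance : EnoughProjectives (FPMod A) where
  presentation M := by
    obtain ⟨n, f, hf⟩ := M.exists_free
    have := FPMod.epi_of_surjective (FPMod.ofHom f : FPMod.of (Fin n → A) ⟶ M) hf
    exact ⟨{ p := FPMod.of (Fin n → A), f := FPMod.ofHom f }⟩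

end Modules

section Transpose

variable {A : Type u} [Ring A]

/-- A presentation of a module by finitely generated free modules. -/
structure FreePres (M : Type u) [AddCommGroup M] [Module A M] where
  /-- rank of the generators -/
  n : ℕ
  /-- rank of the relations -/
  m : ℕ
  /-- the relations -/
  d₁ : (Fin m → A) →ₗ[A] (Fin n → A)
  /-- the generators -/
  d₀ : (Fin n → A) →ₗ[A] M
  surj : Function.Surjective d₀
  exact : Function.Exact d₁ d₀

/-- A chosen presentation of a finitely presented module. -/
def freePres (M : FPMod A) : FreePres (A := A) M.obj :=
  Nonempty.some (by
    obtain ⟨n, m, f, g, hf, hg⟩ := Module.FinitePresentation.exists_fin' A M.obj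
    exact ⟨⟨n, m, g, f, hf, hg⟩⟩)

/-- A lift of a linear map to presentations. -/
structure PresHom {M N : Type u} [AddCommGroup M] [Module A M] [AddCommGroup N] [Module A N]
    (p : FreePres (A := A) M) (q : FreePres (A := A) N) (f : M →ₗ[A] N) where
  /-- lift to the generators -/
  f₀ : (Fin p.n → A) →ₗ[A] (Fin q.n → A)
  /-- lift to the relations -/
  f₁ : (Fin p.m → A) →ₗ[A] (Fin q.m → A)
  comm₀ : q.d₀ ∘ₗ f₀ = f ∘ₗ p.d₀
  comm₁ : q.d₁ ∘ₗ f₁ = f₀ ∘ₗ p.d₁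

lemma FreePres.exists_lift {M P : Type u} [AddCommGroup M] [Module A M] [AddCommGroup P]
    [Module A P] [Module.Projective A P] (q : FreePres (A := A) M) (g : P →ₗ[A] (Fin q.n → A))
    (h : q.d₀ ∘ₗ g = 0) : ∃ s : P →ₗ[A] (Fin q.m → A), q.d₁ ∘ₗ s = g := by
  obtain ⟨s, hs⟩ := Module.projective_lifting_property q.d₁.rangeRestrict
    (g.codRestrict (LinearMap.range q.d₁) fun x => (q.exact _).1 (LinearMap.congr_fun h x))
    q.d₁.surjective_rangeRestrict
  refine ⟨s, ?_⟩
  ext1 x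
  exact congrArg Subtype.val (LinearMap.congr_fun hs x)

variable {M N L : Type u} [AddCommGroup M] [Module A M] [AddCommGroup N] [Module A N]
  [AddCommGroup L] [Module A L]

lemma PresHom.nonempty (p : FreePres (A := A) M) (q : FreePres (A := A) N) (f : M →ₗ[A] N) :
    Nonempty (PresHom p q f) := by
  obtain ⟨f₀, h₀⟩ := Module.projective_lifting_property q.d₀ (f ∘ₗ p.d₀) q.surj
  obtain ⟨f₁, h₁⟩ := q.exists_lift (f₀ ∘ₗ p.d₁) (by
    rw [← LinearMap.comp_assoc, h₀, LinearMap.comp_assoc, p.exact.linearMap_comp_eq_zero,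
      LinearMap.comp_zero])
  exact ⟨⟨f₀, f₁, h₀, h₁⟩⟩

variable (B U : Type u) [Ring B] [AddCommGroup U] [Module A U] [Module B U] [SMulCommClass A B U]
  [Module.Finite B U] [Module.Projective B U]

instance (m : ℕ) : Module.Finite B ((Fin m → A) →ₗ[A] U) :=
  Module.Finite.equiv (LinearEquiv.piRing A U (Fin m) B).symm

instance (m : ℕ) : Module.Projective B ((Fin m → A) →ₗ[A] U) :=
  Module.Projective.of_equiv
    ((DFinsupp.linearEquivFunOnFintype (R := B) (M := fun _ : Fin m => U)).trans
      (LinearEquiv.piRing A U (Fin m) B).symm)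

instance (m : ℕ) : Module.FinitePresentation B ((Fin m → A) →ₗ[A] U) :=
  Module.finitePresentation_of_projective _ _

/-- The transpose: the cokernel of the dual of the relations, the dual being `Hom(-, U)`. -/
abbrev trModule (p : FreePres (A := A) M) : Type u :=
  ((Fin p.m → A) →ₗ[A] U) ⧸ LinearMap.range (p.d₁.lcomp B U)

instance (p : FreePres (A := A) M) : Module.FinitePresentation B (trModule B U p) :=
  Module.finitePresentation_of_surjective (LinearMap.range (p.d₁.lcomp B U)).mkQ
    (Submodule.mkQ_surjective _) (by
      rw [Submodule.ker_mkQ, LinearMap.range_eq_map]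
      exact (Module.Finite.fg_top).map _)

/-- The map induced on transposes. -/
def trLin {p : FreePres (A := A) M} {q : FreePres (A := A) N} {f : M →ₗ[A] N}
    (F : PresHom p q f) : trModule B U q →ₗ[B] trModule B U p :=
  Submodule.mapQ _ _ (F.f₁.lcomp B U) (by
    rintro _ ⟨φ, rfl⟩
    refine ⟨φ ∘ₗ F.f₀, ?_⟩
    change (φ ∘ₗ F.f₀) ∘ₗ p.d₁ = (φ ∘ₗ q.d₁) ∘ₗ F.f₁
    rw [LinearMap.comp_assoc, LinearMap.comp_assoc, F.comm₁])

lemma trLin_rel {p : FreePres (A := A) M} {q : FreePres (A := A) N} {f g : M →ₗ[A] N}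
    (F : PresHom p q f) (G : PresHom p q g) (h : M →ₗ[A] (Fin q.n → A))
    (e : f - g = q.d₀ ∘ₗ h) :
    stableRel (FPMod B) (X := FPMod.of (trModule B U q)) (Y := FPMod.of (trModule B U p))
      (FPMod.ofHom (trLin B U F)) (FPMod.ofHom (trLin B U G)) := by
  obtain ⟨s, hs⟩ := q.exists_lift (F.f₀ - G.f₀ - h ∘ₗ p.d₀) (by
    rw [LinearMap.comp_sub, LinearMap.comp_sub, F.comm₀, G.comm₀, ← LinearMap.comp_assoc, ← e,
      LinearMap.sub_comp, sub_self])
  have hu : q.d₁ ∘ₗ (F.f₁ - G.f₁ - s ∘ₗ p.d₁) = 0 := by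
    rw [LinearMap.comp_sub, LinearMap.comp_sub, F.comm₁, G.comm₁, ← LinearMap.comp_assoc, hs,
      LinearMap.sub_comp, LinearMap.sub_comp, LinearMap.comp_assoc p.d₁ p.d₀ h,
      p.exact.linearMap_comp_eq_zero, LinearMap.comp_zero, sub_zero, sub_self]
  refine ⟨FPMod.of ((Fin p.m → A) →ₗ[A] U), inferInstance,
    FPMod.ofHom ((LinearMap.range (q.d₁.lcomp B U)).liftQ
      ((F.f₁ - G.f₁ - s ∘ₗ p.d₁).lcomp B U) ?_),
    FPMod.ofHom (LinearMap.range (p.d₁.lcomp B U)).mkQ, ?_⟩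
  · rintro _ ⟨φ, rfl⟩
    change (φ ∘ₗ q.d₁) ∘ₗ _ = 0
    rw [LinearMap.comp_assoc, hu, LinearMap.comp_zero]
  · apply ObjectProperty.hom_ext
    apply ModuleCat.hom_ext
    apply Submodule.linearMap_qext
    ext1 φ
    change (Submodule.Quotient.mk (φ ∘ₗ F.f₁) - Submodule.Quotient.mk (φ ∘ₗ G.f₁) :
      trModule B U p) = Submodule.Quotient.mk (φ ∘ₗ (F.f₁ - G.f₁ - s ∘ₗ p.d₁))
    rw [← Submodule.Quotient.mk_sub, Submodule.Quotient.eq]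
    refine ⟨φ ∘ₗ s, ?_⟩
    change (φ ∘ₗ s) ∘ₗ p.d₁ = _
    rw [LinearMap.comp_sub, LinearMap.comp_sub, LinearMap.comp_assoc]
    abel

/-- The transpose of a finitely presented module. -/
def trObj (M : FPMod A) : FPMod B := FPMod.of (trModule B U (freePres M))

/-- A chosen lift of a morphism to the chosen presentations. -/
def presHom {M N : FPMod A} (f : M ⟶ N) : PresHom (freePres M) (freePres N) f.hom.hom :=
  (PresHom.nonempty _ _ _).some

/-- A morphism of transposes induced by a lift to presentations. -/
def trHom {M N : FPMod A} {f : M.obj →ₗ[A] N.obj} (F : PresHom (freePres M) (freePres N) f) :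
    trObj B U N ⟶ trObj B U M :=
  FPMod.ofHom (trLin B U F)

lemma trHom_rel {M N : FPMod A} {f g : M.obj →ₗ[A] N.obj}
    (F : PresHom (freePres M) (freePres N) f) (G : PresHom (freePres M) (freePres N) g)
    (h : M.obj →ₗ[A] (Fin (freePres N).n → A)) (e : f - g = (freePres N).d₀ ∘ₗ h) :
    (CategoryTheory.Quotient.functor (stableRel (FPMod B))).map (trHom B U F) =
      (CategoryTheory.Quotient.functor (stableRel (FPMod B))).map (trHom B U G) :=
  CategoryTheory.Quotient.sound _ (trLin_rel B U F G h e)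

/-- The transpose as a contravariant functor between stable categories. Here `U` is an
`A`-`B`-bimodule; the transpose proper is the case where `U` is a ring `R` and `A`, `B` are `R` and
`Rᵐᵒᵖ` in either order. -/
def Tr : Stable (FPMod A) ⥤ (Stable (FPMod B))ᵒᵖ :=
  CategoryTheory.Quotient.lift _
    { obj := fun M => op ((CategoryTheory.Quotient.functor _).obj (trObj B U M))
      map := fun f => ((CategoryTheory.Quotient.functor _).map (trHom B U (presHom f))).op
      map_id := fun M => by
        rw [trHom_rel B U (presHom (𝟙 M)) ⟨LinearMap.id, LinearMap.id, rfl, rfl⟩ 0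
          (by rw [LinearMap.comp_zero, sub_self])]
        have : trHom B U (M := M) (N := M) (f := (𝟙 M : M ⟶ M).hom.hom)
            ⟨LinearMap.id, LinearMap.id, rfl, rfl⟩ = 𝟙 _ := by
          apply ObjectProperty.hom_ext
          apply ModuleCat.hom_ext
          apply Submodule.linearMap_qext
          rfl
        rw [this, CategoryTheory.Functor.map_id]
        rfl
      map_comp := fun {M N L} f g => by
        let F := presHom f
        let G := presHom g
        rw [← op_comp, ← CategoryTheory.Functor.map_comp]
        rw [trHom_rel B U (g := (f ≫ g).hom.hom) (presHom (f ≫ g)) ⟨G.f₀ ∘ₗ F.f₀, G.f₁ ∘ₗ F.f₁, by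
            rw [← LinearMap.comp_assoc, G.comm₀, LinearMap.comp_assoc, F.comm₀]; rfl, by
            rw [← LinearMap.comp_assoc, G.comm₁, LinearMap.comp_assoc, F.comm₁]; rfl⟩ 0
          (by rw [LinearMap.comp_zero, sub_self])]
        congr 2
        apply ObjectProperty.hom_ext
        apply ModuleCat.hom_ext
        apply Submodule.linearMap_qext
        rfl }
    (by
      rintro M N f g ⟨P, hP, a, b, hab⟩
      have := P.module_projective
      obtain ⟨b', hb'⟩ := Module.projective_lifting_property (freePres N).d₀ b.hom.hom
        (freePres N).surj
      refine congrArg Quiver.Hom.op (trHom_rel B U _ _ (b' ∘ₗ a.hom.hom) ?_)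
      rw [← LinearMap.comp_assoc, hb']
      exact congrArg (fun t : M ⟶ N => t.hom.hom) hab)

end Transpose

section RightModules

variable (R : Type u) [Ring R]

/-- A ring as a free module of rank one over its opposite. -/
def selfEquivOp : Rᵐᵒᵖ ≃ₗ[Rᵐᵒᵖ] R where
  toFun := MulOpposite.unop
  invFun := MulOpposite.op
  map_add' _ _ := rfl
  map_smul' _ _ := rfl
  left_inv _ := rfl
  right_inv _ := rfl

instance : Module.Finite Rᵐᵒᵖ R := Module.Finite.equiv (selfEquivOp R)

instance : Module.Projective Rᵐᵒᵖ R := Module.Projective.of_equiv (selfEquivOp R)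

end RightModules

section HiltonRees

variable (A : Type u) [Ring A]

/-- The functor `M ↦ Ext¹(M, -)` on the stable category. -/
def stableExt : Stable (FPMod A) ⥤ (ModuleCat.{u} A ⥤ AddCommGrpCat.{u})ᵒᵖ :=
  CategoryTheory.Quotient.lift _
    ((isFPMod A).ι ⋙ (Abelian.extFunctor (C := ModuleCat.{u} A) 1).rightOp)
    (by
      rintro M N f g ⟨P, hP, a, b, hab⟩
      have hP' := P.module_projective
      have : Projective P.obj := (IsProjective.iff_projective (R := A) P.obj).1 hP'
      refine congrArg Quiver.Hom.op ?_
      ext X (x : Abelian.Ext N.obj X 1)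
      have hf : f.hom = g.hom + a.hom ≫ b.hom := by
        rw [sub_eq_iff_eq_add] at hab
        rw [hab, add_comm]
        rfl
      change (Abelian.Ext.mk₀ f.hom).comp x (zero_add 1) =
        (Abelian.Ext.mk₀ g.hom).comp x (zero_add 1)
      rw [hf, Abelian.Ext.mk₀_add, Abelian.Ext.add_comp, ← Abelian.Ext.mk₀_comp_mk₀_assoc,
        Abelian.Ext.eq_zero_of_projective ((Abelian.Ext.mk₀ b.hom).comp x (zero_add 1)),
        Abelian.Ext.comp_zero, add_zero])

end HiltonRees

section Duality

variable (A B U : Type u) [Ring A] [Ring B] [AddCommGroup U] [Module A U] [Module B U]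
  [SMulCommClass A B U]

/-- Multiplication by an element of `B` as an `A`-linear endomorphism of `U`. -/
def mulEnd (b : B) : ModuleCat.of A U ⟶ ModuleCat.of A U :=
  have := SMulCommClass.symm A B U
  ModuleCat.ofHom (DistribSMul.toLinearMap A U b)

/-- The `B`-module structure induced by functoriality on the value at `U` of an additive functor. -/
abbrev evModule (F : ModuleCat.{u} A ⥤ AddCommGrpCat.{u}) [F.Additive] :
    Module B (F.obj (ModuleCat.of A U)) where
  smul b x := F.map (mulEnd A B U b) x
  one_smul x := by
    have : mulEnd A B U 1 = 𝟙 _ := by ext u; exact one_smul B u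
    change F.map (mulEnd A B U 1) x = x
    rw [this, F.map_id]; rfl
  mul_smul b c x := by
    have : mulEnd A B U (b * c) = mulEnd A B U c ≫ mulEnd A B U b := by
      ext u; exact mul_smul b c u
    change F.map (mulEnd A B U (b * c)) x = F.map (mulEnd A B U b) (F.map (mulEnd A B U c) x)
    rw [this, map_comp_el]
  smul_zero b := map_zero (F.map (mulEnd A B U b)).hom
  smul_add b := map_add (F.map (mulEnd A B U b)).hom
  add_smul b c x := by
    have : mulEnd A B U (b + c) = mulEnd A B U b + mulEnd A B U c := by
      ext u; exact add_smul b c u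
    change F.map (mulEnd A B U (b + c)) x =
      F.map (mulEnd A B U b) x + F.map (mulEnd A B U c) x
    rw [this, map_add_el]
  zero_smul x := by
    have : mulEnd A B U 0 = 0 := by ext u; exact zero_smul B u
    change F.map (mulEnd A B U 0) x = 0
    rw [this, map_zero_el]

instance (F : FP (ModuleCat.{u} A)) : F.obj.Additive := F.property.additive

/-- Evaluation at `U`, with values in `B`-modules. -/
def ev : FP (ModuleCat.{u} A) ⥤ ModuleCat.{u} B where
  obj F := @ModuleCat.of B _ (F.obj.obj (ModuleCat.of A U)) _ (evModule A B U F.obj)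
  map {F G} φ := @ModuleCat.ofHom B _ _ _ _ (evModule A B U F.obj) _ (evModule A B U G.obj)
    (@LinearMap.mk B B _ _ _ _ _ _ _ (evModule A B U F.obj) (evModule A B U G.obj)
      (φ.hom.app (ModuleCat.of A U)).hom.toAddHom (fun b x => app_nat φ.hom (mulEnd A B U b) x))
  map_id _ := rfl
  map_comp _ _ := rfl

instance : (ev A B U).Additive where
  map_add := rfl

instance (C : Type*) [Category* C] [Preadditive C] :
    (preadditiveCoyoneda : Cᵒᵖ ⥤ C ⥤ AddCommGrpCat).Additive where
  map_add {X Y f g} := by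
    ext Z h
    exact Preadditive.add_comp _ _ _ f.unop g.unop h

/-- The Yoneda embedding into finitely presented functors. -/
def yonedaFP (C : Type*) [Category* C] [Abelian C] : Cᵒᵖ ⥤ FP C :=
  (isFP C).lift preadditiveCoyoneda isFP_representable

instance (C : Type*) [Category* C] [Abelian C] : (yonedaFP C).Additive where
  map_add := by
    intros
    apply ObjectProperty.hom_ext
    exact preadditiveCoyoneda.map_add

/-- The contravariant functor `F ↦ (F(U), -)`. -/
def yonedaEv : (FP (ModuleCat.{u} A))ᵒᵖ ⥤ FP (ModuleCat.{u} B) :=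
  (ev A B U).op ⋙ yonedaFP (ModuleCat.{u} B)

instance : (yonedaEv A B U).Additive := inferInstanceAs ((ev A B U).op ⋙ yonedaFP _).Additive

/-- The zeroth left derived functor of `F ↦ (F(U), -)`, computed by injective resolutions of
finitely presented functors (projective resolutions in the opposite category). The case of interest
is that of a ring `U = R` where `A`, `B` are `R` and `Rᵐᵒᵖ` in either order. -/
def dual : (FP (ModuleCat.{u} A))ᵒᵖ ⥤ FP (ModuleCat.{u} B) :=
  (yonedaEv A B U).leftDerived 0

end Duality

section TotallyFinitelyPresented

variable (A : Type u) [Ring A]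

/-- Functors `F` admitting an exact sequence `(Y, -) ⟶ (X, -) ⟶ F ⟶ 0` with `X` and `Y` finitely
presented modules. -/
def isTFP : ObjectProperty (ModuleCat.{u} A ⥤ AddCommGrpCat.{u}) := fun F =>
  ∃ (X Y : FPMod A)
    (α : preadditiveCoyoneda.obj (op Y.obj) ⟶ preadditiveCoyoneda.obj (op X.obj)),
    Nonempty (F ≅ cokernel α)

/-- The category `tfp(Mod(A), Ab)` of totally finitely presented functors. -/
abbrev TFP : Type (u + 1) := (isTFP A).FullSubcategory

lemma isTFP_le_isFP : isTFP A ≤ isFP (ModuleCat.{u} A) :=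
  fun _ ⟨X, Y, α, h⟩ => ⟨X.obj, Y.obj, α, h⟩

/-- Totally finitely presented functors are finitely presented. -/
abbrev TFP.toFP : TFP A ⥤ FP (ModuleCat.{u} A) := ObjectProperty.ιOfLE (isTFP_le_isFP A)

/-- Totally finitely presented functors are additive. -/
abbrev TFP.toAdd : TFP A ⥤ (ModuleCat.{u} A ⥤+ AddCommGrpCat.{u}) :=
  ObjectProperty.ιOfLE fun F hF => (isTFP_le_isFP A F hF).additive

variable (B U : Type u) [Ring B] [AddCommGroup U] [Module A U] [Module B U] [SMulCommClass A B U]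

/-- `Ext¹(M, -)` for finitely presented `M`, the satellites and the dual of a totally finitely
presented functor are totally finitely presented. -/
structure ArrowsRestrict : Prop where
  ext : ∀ M : Stable (FPMod A), isTFP A ((stableExt A).obj M).unop
  up : ∀ F : TFP A, isTFP A
    ((Linkage.up (ModuleCat.{u} A) AddCommGrpCat.{u}).obj ((TFP.toAdd A).obj F)).obj
  down : ∀ F : TFP A, isTFP A
    ((Linkage.down (ModuleCat.{u} A) AddCommGrpCat.{u}).obj ((TFP.toAdd A).obj F)).obj
  dual : ∀ F : (TFP A)ᵒᵖ, isTFP B ((Linkage.dual A B U).obj ((TFP.toFP A).op.obj F)).obj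

namespace ArrowsRestrict

variable {A B U} (h : ArrowsRestrict A B U)

/-- The Hilton–Rees functor `E(M) = Ext¹(M, -)`, as a functor to the opposite category. -/
def E : Stable (FPMod A) ⥤ (TFP A)ᵒᵖ :=
  ((isTFP A).lift (stableExt A).leftOp fun M => h.ext M.unop).rightOp

/-- The right satellite `S¹` on totally finitely presented functors. -/
def S1 : TFP A ⥤ TFP A :=
  (isTFP A).lift (TFP.toAdd A ⋙ Linkage.up (ModuleCat.{u} A) AddCommGrpCat.{u} ⋙
    AdditiveFunctor.forget _ _) h.up

/-- The left satellite `S₁` on totally finitely presented functors. -/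
def S_1 : TFP A ⥤ TFP A :=
  (isTFP A).lift (TFP.toAdd A ⋙ Linkage.down (ModuleCat.{u} A) AddCommGrpCat.{u} ⋙
    AdditiveFunctor.forget _ _) h.down

/-- The duality `D` on totally finitely presented functors. -/
def D : (TFP A)ᵒᵖ ⥤ TFP B :=
  (isTFP B).lift ((TFP.toFP A).op ⋙ Linkage.dual A B U ⋙ (isFP _).ι) h.dual

end ArrowsRestrict

end TotallyFinitelyPresented

end Linkage

end

noncomputable section

namespace Linkage

section SatelliteAdjunction

variable {C : Type u} [Category.{v} C] [Abelian C]

/-- Two extensions of one morphism along an exact sequence induce maps on the cokernels which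
differ by a map into the middle. -/
lemma exists_sub_eq_comp_right {S : ShortComplex C} (hS : S.Exact) [Epi S.g] {Y Z : C} {p : Y ⟶ Z}
    {a a' : S.X₂ ⟶ Y} {b b' : S.X₃ ⟶ Z} (h : S.f ≫ a = S.f ≫ a') (hb : S.g ≫ b = a ≫ p)
    (hb' : S.g ≫ b' = a' ≫ p) : ∃ s, b - b' = s ≫ p := by
  refine ⟨hS.desc (a - a') (by rw [Preadditive.comp_sub, h, sub_self]), ?_⟩
  rw [← cancel_epi S.g, Preadditive.comp_sub, hb, hb', ← Preadditive.sub_comp, hS.g_desc_assoc]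

/-- Two lifts of one morphism to an exact sequence induce maps on the kernels which differ by a
map out of the middle. -/
lemma exists_sub_eq_comp_left {S : ShortComplex C} (hS : S.Exact) [Mono S.f] {X Y : C} {i : X ⟶ Y}
    {a a' : Y ⟶ S.X₂} {b b' : X ⟶ S.X₁} (h : a ≫ S.g = a' ≫ S.g) (hb : b ≫ S.f = i ≫ a)
    (hb' : b' ≫ S.f = i ≫ a') : ∃ s, b - b' = i ≫ s := by
  refine ⟨hS.lift (a - a') (by rw [Preadditive.sub_comp, h, sub_self]), ?_⟩
  rw [← cancel_mono S.f, Preadditive.sub_comp, hb, hb', ← Preadditive.comp_sub, Category.assoc,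
    hS.lift_f]

/-- The sequence `Ω Z ⟶ P ⟶ Z`. -/
abbrev syzSeq [EnoughProjectives C] (Z : C) : ShortComplex C :=
  ShortComplex.mk (syzι Z) (Projective.π Z) (kernel.condition _)

lemma syzSeq_exact [EnoughProjectives C] (Z : C) : (syzSeq Z).Exact := ShortComplex.exact_kernel _

instance [EnoughProjectives C] (Z : C) : Epi (syzSeq Z).g := inferInstanceAs (Epi (Projective.π Z))

instance [EnoughProjectives C] (Z : C) : Mono (syzSeq Z).f := inferInstanceAs (Mono (syzι Z))

/-- The sequence `Z ⟶ I ⟶ Σ Z`. -/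
abbrev cosyzSeq [EnoughInjectives C] (Z : C) : ShortComplex C :=
  ShortComplex.mk (Injective.ι Z) (cosyzπ Z) (cokernel.condition _)

lemma cosyzSeq_exact [EnoughInjectives C] (Z : C) : (cosyzSeq Z).Exact :=
  ShortComplex.exact_cokernel _

instance [EnoughInjectives C] (Z : C) : Mono (cosyzSeq Z).f :=
  inferInstanceAs (Mono (Injective.ι Z))

instance [EnoughInjectives C] (Z : C) : Epi (cosyzSeq Z).g := inferInstanceAs (Epi (cosyzπ Z))

lemma cosyzSeq_shortExact [EnoughInjectives C] (Z : C) : (cosyzSeq Z).ShortExact :=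
  .mk' (cosyzSeq_exact Z) inferInstance inferInstance

section

variable {D : Type*} [Category* D] [Abelian D] (F : C ⥤ D) [F.Additive]

/-- The projection `F (Σ X) ⟶ S¹ F X`. -/
def upMk [EnoughInjectives C] (X : C) : F.obj (cosyz X) ⟶ (upFunctor F).obj X :=
  cokernel.π (F.map (cosyzπ X))

instance [EnoughInjectives C] (X : C) : Epi (upMk F X) :=
  inferInstanceAs (Epi (cokernel.π (F.map (cosyzπ X))))

lemma map_cosyzπ_upMk [EnoughInjectives C] (X : C) : F.map (cosyzπ X) ≫ upMk F X = 0 :=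
  cokernel.condition _

lemma upMk_map [EnoughInjectives C] {X Y : C} (f : X ⟶ Y) :
    upMk F X ≫ (upFunctor F).map f = F.map (cosyzMap f) ≫ upMk F Y :=
  π_upMap F f

lemma upMk_trans [EnoughInjectives C] {F G : C ⥤ D} [F.Additive] [G.Additive] (α : F ⟶ G) (X : C) :
    upMk F X ≫ (upTrans α).app X = α.app (cosyz X) ≫ upMk G X :=
  π_upTrans_app α X

/-- A morphism out of `S¹ F X`. -/
def upDesc [EnoughInjectives C] {X : C} {T : D} (t : F.obj (cosyz X) ⟶ T)
    (h : F.map (cosyzπ X) ≫ t = 0) : (upFunctor F).obj X ⟶ T :=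
  cokernel.desc _ t h

lemma upMk_upDesc [EnoughInjectives C] {X : C} {T : D} (t : F.obj (cosyz X) ⟶ T)
    (h : F.map (cosyzπ X) ≫ t = 0) : upMk F X ≫ upDesc F t h = t :=
  cokernel.π_desc _ _ _

/-- The inclusion `S₁ F X ⟶ F (Ω X)`. -/
def downι [EnoughProjectives C] (X : C) : (downFunctor F).obj X ⟶ F.obj (syz X) :=
  kernel.ι (F.map (syzι X))

instance [EnoughProjectives C] (X : C) : Mono (downι F X) :=
  inferInstanceAs (Mono (kernel.ι (F.map (syzι X))))

lemma downι_map_syzι [EnoughProjectives C] (X : C) : downι F X ≫ F.map (syzι X) = 0 :=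
  kernel.condition _

lemma map_downι [EnoughProjectives C] {X Y : C} (f : X ⟶ Y) :
    (downFunctor F).map f ≫ downι F Y = downι F X ≫ F.map (syzMap f) :=
  downMap_ι F f

lemma trans_downι [EnoughProjectives C] {F G : C ⥤ D} [F.Additive] [G.Additive] (α : F ⟶ G)
    (X : C) : (downTrans α).app X ≫ downι G X = downι F X ≫ α.app (syz X) :=
  downTrans_app_ι α X

/-- A morphism into `S₁ F X`. -/
def downLift [EnoughProjectives C] {X : C} {T : D} (t : T ⟶ F.obj (syz X))
    (h : t ≫ F.map (syzι X) = 0) : T ⟶ (downFunctor F).obj X :=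
  kernel.lift _ t h

lemma downLift_downι [EnoughProjectives C] {X : C} {T : D} (t : T ⟶ F.obj (syz X))
    (h : t ≫ F.map (syzι X) = 0) : downLift F t h ≫ downι F X = t :=
  kernel.lift_ι _ _ _

lemma map_comp_upMk_eq [EnoughInjectives C] {S : ShortComplex C} (hS : S.Exact) [Epi S.g] {K : C}
    {a a' : S.X₂ ⟶ Injective.under K} {b b' : S.X₃ ⟶ cosyz K} (h : S.f ≫ a = S.f ≫ a')
    (hb : S.g ≫ b = a ≫ cosyzπ K) (hb' : S.g ≫ b' = a' ≫ cosyzπ K) :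
    F.map b ≫ upMk F K = F.map b' ≫ upMk F K := by
  obtain ⟨s, hs⟩ := exists_sub_eq_comp_right hS h hb hb'
  rw [← sub_eq_zero, ← Preadditive.sub_comp, ← F.map_sub, hs, F.map_comp, Category.assoc,
    map_cosyzπ_upMk, comp_zero]

lemma downι_comp_map_eq [EnoughProjectives C] {S : ShortComplex C} (hS : S.Exact) [Mono S.f]
    {Z : C} {a a' : Projective.over Z ⟶ S.X₂} {b b' : syz Z ⟶ S.X₁} (h : a ≫ S.g = a' ≫ S.g)
    (hb : b ≫ S.f = syzι Z ≫ a) (hb' : b' ≫ S.f = syzι Z ≫ a') :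
    downι F Z ≫ F.map b = downι F Z ≫ F.map b' := by
  obtain ⟨s, hs⟩ := exists_sub_eq_comp_left hS h hb hb'
  rw [← sub_eq_zero, ← Preadditive.comp_sub, ← F.map_sub, hs, F.map_comp, reassoc_of% downι_map_syzι,
    zero_comp]

end

variable [EnoughInjectives C] [EnoughProjectives C]

/-- An extension of `Ω Z ⟶ P` to the injective containing `Ω Z`. -/
def toUnder (Z : C) : Projective.over Z ⟶ Injective.under (syz Z) :=
  Injective.factorThru (Injective.ι (syz Z)) (syzι Z)

lemma syzι_toUnder (Z : C) : syzι Z ≫ toUnder Z = Injective.ι (syz Z) :=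
  Injective.comp_factorThru _ _

/-- The comparison `Z ⟶ Σ Ω Z`. -/
def toCosyzSyz (Z : C) : Z ⟶ cosyz (syz Z) :=
  (syzSeq_exact Z).desc (toUnder Z ≫ cosyzπ _) (by
    change syzι Z ≫ _ = 0
    rw [reassoc_of% syzι_toUnder, cokernel.condition])

lemma π_toCosyzSyz (Z : C) : Projective.π Z ≫ toCosyzSyz Z = toUnder Z ≫ cosyzπ _ :=
  (syzSeq_exact Z).g_desc _ _

/-- A lift of `P ⟶ Σ Z` to the injective containing `Z`. -/
def ofOver (Z : C) : Projective.over (cosyz Z) ⟶ Injective.under Z :=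
  Projective.factorThru (Projective.π (cosyz Z)) (cosyzπ Z)

lemma ofOver_π (Z : C) : ofOver Z ≫ cosyzπ Z = Projective.π (cosyz Z) :=
  Projective.factorThru_comp _ _

/-- The comparison `Ω Σ Z ⟶ Z`. -/
def ofSyzCosyz (Z : C) : syz (cosyz Z) ⟶ Z :=
  (cosyzSeq_exact Z).lift (syzι _ ≫ ofOver Z) (by
    change (_ ≫ _) ≫ cosyzπ Z = 0
    rw [Category.assoc, ofOver_π, kernel.condition])

lemma ofSyzCosyz_ι (Z : C) : ofSyzCosyz Z ≫ Injective.ι Z = syzι _ ≫ ofOver Z :=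
  (cosyzSeq_exact Z).lift_f _ _

variable {D : Type*} [Category* D] [Abelian D]

/-- The unit `F ⟶ S₁ S¹ F` at an object. -/
def unitApp (F : C ⥤ D) [F.Additive] (Z : C) : F.obj Z ⟶ (downFunctor (upFunctor F)).obj Z :=
  downLift _ (F.map (toCosyzSyz Z) ≫ upMk F (syz Z)) (by
    rw [Category.assoc, upMk_map, ← F.map_comp_assoc]
    refine (map_comp_upMk_eq F (syzSeq_exact Z) (b' := 0)
      (a := toUnder Z ≫ underMap (syzι Z)) (a' := Injective.ι _) ?_ ?_ ?_).trans (by simp)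
    · exact ((reassoc_of% (syzι_toUnder Z)) _).trans (ι_underMap _)
    · change Projective.π Z ≫ _ = _
      rw [reassoc_of% π_toCosyzSyz, π_cosyzMap, Category.assoc]
    · rw [comp_zero, cokernel.condition])

lemma unitApp_ι (F : C ⥤ D) [F.Additive] (Z : C) :
    unitApp F Z ≫ downι (upFunctor F) Z = F.map (toCosyzSyz Z) ≫ upMk F (syz Z) :=
  downLift_downι _ _ _

/-- The counit `S¹ S₁ F ⟶ F` at an object. -/
def counitApp (F : C ⥤ D) [F.Additive] (Z : C) : (upFunctor (downFunctor F)).obj Z ⟶ F.obj Z :=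
  upDesc _ (downι F (cosyz Z) ≫ F.map (ofSyzCosyz Z)) (by
    rw [reassoc_of% map_downι, ← F.map_comp]
    refine (downι_comp_map_eq F (cosyzSeq_exact Z) (b' := 0)
      (a := overMap (cosyzπ Z) ≫ ofOver Z) (a' := Projective.π _) ?_ ?_ ?_).trans (by simp)
    · change (_ ≫ _) ≫ cosyzπ Z = _
      rw [Category.assoc, ofOver_π, overMap_π]
    · change (_ ≫ _) ≫ Injective.ι Z = _
      rw [Category.assoc, ofSyzCosyz_ι, reassoc_of% (syzMap_ι (cosyzπ Z))]
    · rw [zero_comp, kernel.condition])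

lemma π_counitApp (F : C ⥤ D) [F.Additive] (Z : C) :
    upMk (downFunctor F) Z ≫ counitApp F Z = downι F (cosyz Z) ≫ F.map (ofSyzCosyz Z) :=
  upMk_upDesc _ _ _

lemma unitApp_naturality (F : C ⥤ D) [F.Additive] {Z Z' : C} (f : Z ⟶ Z') :
    F.map f ≫ unitApp F Z' = unitApp F Z ≫ (downFunctor (upFunctor F)).map f := by
  rw [← cancel_mono (downι _ _), Category.assoc, Category.assoc, map_downι, unitApp_ι,
    reassoc_of% unitApp_ι, upMk_map, ← F.map_comp_assoc, ← F.map_comp_assoc]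
  refine map_comp_upMk_eq F (syzSeq_exact Z) (a := overMap f ≫ toUnder Z')
    (a' := toUnder Z ≫ underMap (syzMap f)) ?_ ?_ ?_
  · change syzι Z ≫ _ = syzι Z ≫ _
    rw [reassoc_of% syzι_toUnder, ι_underMap, ← reassoc_of% (syzMap_ι f), syzι_toUnder]
  · change Projective.π Z ≫ _ = _
    rw [← reassoc_of% (overMap_π f), π_toCosyzSyz, Category.assoc]
  · change Projective.π Z ≫ _ = _
    rw [reassoc_of% π_toCosyzSyz, π_cosyzMap, Category.assoc]

lemma counitApp_naturality (F : C ⥤ D) [F.Additive] {Z Z' : C} (f : Z ⟶ Z') :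
    (upFunctor (downFunctor F)).map f ≫ counitApp F Z' = counitApp F Z ≫ F.map f := by
  rw [← cancel_epi (upMk _ _), reassoc_of% upMk_map, π_counitApp, reassoc_of% π_counitApp, reassoc_of% map_downι,
    ← F.map_comp, ← F.map_comp]
  refine downι_comp_map_eq F (cosyzSeq_exact Z') (a := overMap (cosyzMap f) ≫ ofOver Z')
    (a' := ofOver Z ≫ underMap f) ?_ ?_ ?_
  · change (_ ≫ _) ≫ cosyzπ Z' = (_ ≫ _) ≫ cosyzπ Z'
    rw [Category.assoc, Category.assoc, ofOver_π, overMap_π, ← π_cosyzMap, reassoc_of% ofOver_π]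
  · change (_ ≫ _) ≫ Injective.ι Z' = _
    rw [Category.assoc, ofSyzCosyz_ι, reassoc_of% (syzMap_ι (cosyzMap f))]
  · change (_ ≫ _) ≫ Injective.ι Z' = _
    rw [Category.assoc, ← ι_underMap, reassoc_of% ofSyzCosyz_ι]

lemma unitApp_trans {F G : C ⥤ D} [F.Additive] [G.Additive] (α : F ⟶ G) (Z : C) :
    α.app Z ≫ unitApp G Z = unitApp F Z ≫ (downTrans (upTrans α)).app Z := by
  rw [← cancel_mono (downι _ _), Category.assoc, Category.assoc, trans_downι, unitApp_ι,
    reassoc_of% unitApp_ι, upMk_trans, α.naturality_assoc]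

lemma counitApp_trans {F G : C ⥤ D} [F.Additive] [G.Additive] (α : F ⟶ G) (Z : C) :
    (upTrans (downTrans α)).app Z ≫ counitApp G Z = counitApp F Z ≫ α.app Z := by
  rw [← cancel_epi (upMk _ _), reassoc_of% upMk_trans, π_counitApp, reassoc_of% π_counitApp, reassoc_of% trans_downι,
    α.naturality]

lemma unitApp_counitApp_up (F : C ⥤ D) [F.Additive] (η : F ⟶ downFunctor (upFunctor F))
    (hη : ∀ Z, η.app Z = unitApp F Z) (Z : C) :
    (upTrans η).app Z ≫ counitApp (upFunctor F) Z = 𝟙 _ := by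
  rw [← cancel_epi (upMk _ _), reassoc_of% upMk_trans, π_counitApp, hη, reassoc_of% unitApp_ι, upMk_map,
    ← F.map_comp_assoc, Category.comp_id]
  refine (map_comp_upMk_eq F (syzSeq_exact (cosyz Z)) (b' := 𝟙 _)
    (a := toUnder _ ≫ underMap (ofSyzCosyz Z)) (a' := ofOver Z) ?_ ?_ ?_).trans (by simp)
  · change syzι _ ≫ _ = syzι _ ≫ _
    rw [reassoc_of% syzι_toUnder, ι_underMap, ofSyzCosyz_ι]
  · change Projective.π _ ≫ _ = _
    rw [reassoc_of% π_toCosyzSyz, π_cosyzMap, Category.assoc]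
  · change Projective.π _ ≫ _ = _
    rw [Category.comp_id, ofOver_π]

lemma unitApp_counitApp_down (F : C ⥤ D) [F.Additive] (ε : upFunctor (downFunctor F) ⟶ F)
    (hε : ∀ Z, ε.app Z = counitApp F Z) (Z : C) :
    unitApp (downFunctor F) Z ≫ (downTrans ε).app Z = 𝟙 _ := by
  rw [← cancel_mono (downι _ _), Category.assoc, trans_downι, reassoc_of% unitApp_ι, hε, π_counitApp,
    reassoc_of% map_downι, ← F.map_comp, Category.id_comp]
  refine (downι_comp_map_eq F (cosyzSeq_exact (syz Z)) (b' := 𝟙 _)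
    (a := overMap (toCosyzSyz Z) ≫ ofOver _) (a' := toUnder Z) ?_ ?_ ?_).trans (by simp)
  · change (_ ≫ _) ≫ cosyzπ _ = _ ≫ cosyzπ _
    rw [Category.assoc, ofOver_π, overMap_π, π_toCosyzSyz]
  · change (_ ≫ _) ≫ Injective.ι _ = _
    rw [Category.assoc, ofSyzCosyz_ι, reassoc_of% (syzMap_ι (toCosyzSyz Z))]
  · change _ ≫ Injective.ι _ = _
    rw [Category.id_comp, syzι_toUnder]

variable (C D) in
/-- The right satellite is left adjoint to the left satellite. -/
def upDownAdjunction : up C D ⊣ down C D :=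
  Adjunction.mkOfUnitCounit
    { unit :=
        { app := fun F => ObjectProperty.homMk
            { app := fun Z => unitApp F.obj Z
              naturality := fun _ _ f => unitApp_naturality F.obj f }
          naturality := fun F G α => by
            apply ObjectProperty.hom_ext
            ext Z
            exact unitApp_trans α.hom Z }
      counit :=
        { app := fun F => ObjectProperty.homMk
            { app := fun Z => counitApp F.obj Z
              naturality := fun _ _ f => counitApp_naturality F.obj f }
          naturality := fun F G α => by
            apply ObjectProperty.hom_ext
            ext Z
            exact counitApp_trans α.hom Z }
      left_triangle := by
        ext F Z
        refine (congrArg (_ ≫ ·) (Category.id_comp _)).trans ?_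
        exact unitApp_counitApp_up F.obj
          ⟨fun Z => unitApp F.obj Z, fun _ _ f => unitApp_naturality F.obj f⟩ (fun _ => rfl) Z
      right_triangle := by
        ext F Z
        refine (congrArg (_ ≫ ·) (Category.id_comp _)).trans ?_
        exact unitApp_counitApp_down F.obj
          ⟨fun Z => counitApp F.obj Z, fun _ _ f => counitApp_naturality F.obj f⟩ (fun _ => rfl) Z }

end SatelliteAdjunction

section

variable {A B U : Type u} [Ring A] [Ring B] [AddCommGroup U] [Module A U] [Module B U]
  [SMulCommClass A B U] (h : ArrowsRestrict A B U)

/-- The adjunction of satellites on totally finitely presented functors. -/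
def ArrowsRestrict.adjunction : h.S1 ⊣ h.S_1 :=
  (upDownAdjunction (ModuleCat.{u} A) AddCommGrpCat.{u}).restrictFullyFaithful
    (iC := TFP.toAdd A) (iD := TFP.toAdd A)
    (ObjectProperty.fullyFaithfulιOfLE _) (ObjectProperty.fullyFaithfulιOfLE _)
    (NatIso.ofComponents (fun _ => Iso.refl _)) (NatIso.ofComponents (fun _ => Iso.refl _))

/-- The iterated adjunction of satellites. -/
def ArrowsRestrict.adjunctionTwo : iter h.S1 2 ⊣ iter h.S_1 2 :=
  (Adjunction.id.comp h.adjunction).comp (h.adjunction.comp Adjunction.id)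

end

section Presentations

variable {C : Type u} [Category.{v} C] [Preadditive C]

/-- The functor presented by a morphism of representables. -/
def presFun {X Y : C} (f : X ⟶ Y) : C ⥤ AddCommGrpCat.{v} :=
  cokernel (preadditiveCoyoneda.map f.op)

/-- The projection onto a presented functor. -/
def presπ {X Y : C} (f : X ⟶ Y) : preadditiveCoyoneda.obj (op X) ⟶ presFun f :=
  cokernel.π (preadditiveCoyoneda.map f.op)

instance {X Y : C} (f : X ⟶ Y) : Epi (presπ f) := inferInstanceAs (Epi (cokernel.π _))

instance {X Y : C} (f : X ⟶ Y) : (presFun f).Additive :=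
  isFP.additive ⟨X, Y, _, ⟨Iso.refl _⟩⟩

/-- The generator of a presented functor. -/
def presGen {X Y : C} (f : X ⟶ Y) : (presFun f).obj X := (presπ f).app X (𝟙 X)

lemma presπ_app {X Y A : C} (f : X ⟶ Y) (g : X ⟶ A) :
    (presπ f).app A g = (presFun f).map g (presGen f) :=
  (congrArg _ (Category.id_comp g).symm).trans (app_nat (presπ f) g _)

lemma gen_presGen {X Y : C} (f : X ⟶ Y) : Gen (presFun f) (presGen f) := fun A a => by
  obtain ⟨g, hg⟩ := app_surj (presπ f) a
  exact ⟨g, (presπ_app f g).symm.trans hg⟩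

lemma ann_presGen {X Y : C} (f : X ⟶ Y) : Ann (presFun f) f (presGen f) where
  ann := by
    rw [← presπ_app]
    refine Eq.trans (congrArg _ (Category.comp_id f).symm) ?_
    exact app_comp_zero (cokernel.condition (preadditiveCoyoneda.map f.op)) (𝟙 Y)
  fac A g hg := by
    obtain ⟨h, hh⟩ := exact_app (ShortComplex.exact_cokernel (preadditiveCoyoneda.map f.op))
      (b := g) ((presπ_app f g).trans hg)
    exact ⟨h, hh.symm⟩

/-- Natural transformations out of a functor with a generator are determined by the image of the
generator. -/
lemma Gen.hom_ext {C : Type u} [Category.{v} C] {F G : C ⥤ AddCommGrpCat.{v}} {X : C} {x : F.obj X} (hx : Gen F x)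
    {φ ψ : F ⟶ G} (h : φ.app X x = ψ.app X x) : φ = ψ := by
  ext A a
  obtain ⟨g, rfl⟩ := hx a
  rw [app_nat, app_nat, h]

/-- A natural transformation carrying a presentation to a presentation is an isomorphism. -/
lemma isIso_of_gen_ann {F G : C ⥤ AddCommGrpCat.{v}} [F.Additive] [G.Additive] {X Y : C}
    {f : X ⟶ Y} {x : F.obj X} (hx : Gen F x) (hf : Ann F f x) {φ : F ⟶ G}
    (hx' : Gen G (φ.app X x)) (hf' : Ann G f (φ.app X x)) : IsIso φ := by
  obtain ⟨ψ, hψ⟩ := exists_hom (G := F) hx' hf' hf.ann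
  refine ⟨ψ, hx.hom_ext ?_, hx'.hom_ext ?_⟩
  · exact hψ
  · change φ.app X (ψ.app X (φ.app X x)) = _
    rw [hψ]
    rfl

lemma nonempty_iso_cokernel {F : C ⥤ AddCommGrpCat.{v}} [F.Additive] {X Y : C}
    {f : X ⟶ Y} {x : F.obj X} (hx : Gen F x) (hf : Ann F f x) :
    Nonempty (F ≅ cokernel (preadditiveCoyoneda.map f.op)) := by
  obtain ⟨φ, hφ⟩ := exists_hom (gen_presGen f) (ann_presGen f) (G := F) (w := x) hf.ann
  have := isIso_of_gen_ann (gen_presGen f) (ann_presGen f) (φ := φ) (by rwa [hφ]) (by rwa [hφ])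
  exact ⟨(asIso φ).symm⟩

lemma gen_of_iso {C : Type u} [Category.{v} C] {F G : C ⥤ AddCommGrpCat.{v}} (e : F ≅ G) {X : C} {x : F.obj X} (hx : Gen F x) :
    Gen G (e.hom.app X x) := fun A a => by
  obtain ⟨g, hg⟩ := hx (e.inv.app A a)
  refine ⟨g, ?_⟩
  rw [← app_nat, hg]
  exact ConcreteCategory.congr_hom (NatTrans.congr_app e.inv_hom_id A) a

lemma ann_of_iso {C : Type u} [Category.{v} C] {F G : C ⥤ AddCommGrpCat.{v}} (e : F ≅ G) {X Y : C} {f : X ⟶ Y} {x : F.obj X}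
    (hf : Ann F f x) : Ann G f (e.hom.app X x) where
  ann := by rw [← app_nat, hf.ann, map_zero]
  fac A g hg := by
    refine hf.fac g (app_inj e.hom ?_)
    rw [app_nat, hg, map_zero]

lemma additive_of_surjective {G Q : C ⥤ AddCommGrpCat.{v}} [G.Additive] (p : G ⟶ Q)
    (hp : ∀ (A : C) (b : Q.obj A), ∃ a, p.app A a = b) : Q.Additive := ⟨fun {A B g h} => by
  ext b
  obtain ⟨a, rfl⟩ := hp _ b
  change Q.map (g + h) _ = Q.map g _ + Q.map h _
  rw [← app_nat, ← app_nat, ← app_nat, map_add_el, map_add]⟩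

end Presentations

section TFPClosure

variable {A : Type u} [Ring A]

lemma isTFP_iff (F : ModuleCat.{u} A ⥤ AddCommGrpCat.{u}) :
    isTFP A F ↔ F.Additive ∧ ∃ (X Y : ModuleCat.{u} A) (_ : isFPMod A X) (_ : isFPMod A Y)
      (f : X ⟶ Y) (x : F.obj X), Gen F x ∧ Ann F f x := by
  constructor
  · intro hF
    refine ⟨(isTFP_le_isFP A F hF).additive, ?_⟩
    obtain ⟨X, Y, α, ⟨e⟩⟩ := hF
    obtain ⟨φ, rfl⟩ := preadditiveCoyoneda.map_surjective α
    exact ⟨X.obj, Y.obj, X.property, Y.property, φ.unop, _,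
      gen_of_iso (F := presFun φ.unop) e.symm (gen_presGen φ.unop),
      ann_of_iso (F := presFun φ.unop) e.symm (ann_presGen φ.unop)⟩
  · rintro ⟨hF, X, Y, hX, hY, f, x, hx, hf⟩
    exact ⟨⟨X, hX⟩, ⟨Y, hY⟩, _, nonempty_iso_cokernel hx hf⟩

lemma isTFP.additive {F : ModuleCat.{u} A ⥤ AddCommGrpCat.{u}} (hF : isTFP A F) : F.Additive :=
  (isTFP_le_isFP A F hF).additive

lemma isTFP_presFun {X Y : ModuleCat.{u} A} (hX : isFPMod A X) (hY : isFPMod A Y) (f : X ⟶ Y) :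
    isTFP A (presFun f) :=
  (isTFP_iff _).2 ⟨inferInstance, X, Y, hX, hY, f, _, gen_presGen f, ann_presGen f⟩

lemma isFPMod_of_iso {X Y : ModuleCat.{u} A} (e : X ≅ Y) (hX : isFPMod A X) : isFPMod A Y :=
  have : Module.FinitePresentation A X := hX
  Module.FinitePresentation.of_equiv e.toLinearEquiv

lemma isFPMod_biprod {X Y : ModuleCat.{u} A} (hX : isFPMod A X) (hY : isFPMod A Y) :
    isFPMod A (X ⊞ Y) := by
  have : Module.FinitePresentation A X := hX
  have : Module.FinitePresentation A Y := hY
  exact isFPMod_of_iso (ModuleCat.biprodIsoProd X Y).symm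
    (inferInstanceAs (Module.FinitePresentation A (X × Y)))

lemma isFPMod_cokernel {X Y : ModuleCat.{u} A} (f : X ⟶ Y) (hX : isFPMod A X) (hY : isFPMod A Y) :
    isFPMod A (cokernel f) := by
  have : Module.FinitePresentation A X := hX
  have : Module.FinitePresentation A Y := hY
  refine isFPMod_of_iso (ModuleCat.cokernelIsoRangeQuotient f).symm ?_
  exact Module.finitePresentation_of_surjective (LinearMap.range f.hom).mkQ
    (Submodule.mkQ_surjective _) (by
      rw [Submodule.ker_mkQ, LinearMap.range_eq_map]
      exact (Module.Finite.fg_top).map _)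

lemma isFPMod_pushout {X Y Z : ModuleCat.{u} A} (f : X ⟶ Y) (g : X ⟶ Z) (hX : isFPMod A X)
    (hY : isFPMod A Y) (hZ : isFPMod A Z) : isFPMod A (pushout f g) := by
  refine isFPMod_of_iso ?_ (isFPMod_cokernel (biprod.lift f (-g)) hX (isFPMod_biprod hY hZ))
  refine IsColimit.coconePointUniqueUpToIso (colimit.isColimit _)
    (Cofork.IsColimit.mk (CokernelCofork.ofπ (biprod.desc (pushout.inl f g) (pushout.inr f g))
      (by simp [pushout.condition])) (fun s => pushout.desc (biprod.inl ≫ s.π) (biprod.inr ≫ s.π)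
        ?_) ?_ ?_)
  · have := CokernelCofork.condition s
    have e : biprod.lift f (-g) = f ≫ biprod.inl - g ≫ biprod.inr := by
      apply biprod.hom_ext <;> simp
    rw [← sub_eq_zero, ← Category.assoc, ← Category.assoc, ← Preadditive.sub_comp, ← e]
    exact this
  · intro s
    apply biprod.hom_ext'
    · simpa using pushout.inl_desc _ _ _
    · simpa using pushout.inr_desc _ _ _
  · intro s m hm
    apply pushout.hom_ext
    · rw [pushout.inl_desc, ← hm]
      simp
    · rw [pushout.inr_desc, ← hm]
      simp

/-- Totally finitely presented functors are closed under cokernels. -/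
lemma isTFP.of_exact_right {F G Q : ModuleCat.{u} A ⥤ AddCommGrpCat.{u}} (hF : isTFP A F)
    (hG : isTFP A G) (φ : F ⟶ G) (p : G ⟶ Q)
    (hp : ∀ (A : ModuleCat.{u} A) (b : Q.obj A), ∃ a, p.app A a = b)
    (w : ∀ (A : ModuleCat.{u} A) (a : F.obj A), p.app A (φ.app A a) = 0)
    (h : ∀ (A : ModuleCat.{u} A) (b : G.obj A), p.app A b = 0 → ∃ a, φ.app A a = b) :
    isTFP A Q := by
  have := hF.additive
  have := hG.additive
  have := additive_of_surjective p hp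
  obtain ⟨-, W, -, hW, -, -, y, hy, -⟩ := (isTFP_iff F).1 hF
  obtain ⟨-, X, Y, hX, hY, f, x, hx, hf⟩ := (isTFP_iff G).1 hG
  obtain ⟨t, ht⟩ := hx (φ.app W y)
  refine (isTFP_iff Q).2 ⟨inferInstance, X, W ⊞ Y, hX, isFPMod_biprod hW hY, biprod.lift t f,
    p.app X x, ?_, ?_, ?_⟩
  · intro A b
    obtain ⟨a, rfl⟩ := hp _ b
    obtain ⟨g, rfl⟩ := hx a
    exact ⟨g, (app_nat p g x).symm⟩
  · have e : biprod.lift t f = t ≫ biprod.inl + f ≫ biprod.inr := by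
      apply biprod.hom_ext <;> simp
    rw [e, map_add_el, map_comp_el, map_comp_el, ← app_nat, ← app_nat, ← app_nat, ht, hf.ann,
      map_zero, map_zero, add_zero, app_nat, w, map_zero]
  · intro A g hg
    obtain ⟨b, hb⟩ := h _ (G.map g x) (by rw [app_nat, hg])
    obtain ⟨s, rfl⟩ := hy b
    obtain ⟨m, hm⟩ := hf.fac (g - t ≫ s) (by
      rw [map_sub_el, map_comp_el, ht, ← hb, app_nat, sub_self])
    exact ⟨biprod.desc s m, by rw [biprod.lift_desc, ← hm]; abel⟩

end TFPClosure

section ExtFunctors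

variable {C : Type u} [Category.{v} C] [Abelian C]

/-- The inclusion of projectives into an exact sequence presents `Ext¹`. -/
lemma gen_extClass [HasExt.{v} C] {S : ShortComplex C} (hS : S.ShortExact) [Projective S.X₂] :
    Gen ((Abelian.extFunctor.{v} 1).obj (op S.X₃)) hS.extClass := by
  intro Z e
  obtain ⟨x, hx⟩ := Abelian.Ext.contravariant_sequence_exact₃ hS Z e
    (Abelian.Ext.eq_zero_of_projective _) (add_zero 1)
  obtain ⟨g, rfl⟩ := Abelian.Ext.addEquiv₀.symm.surjective x
  exact ⟨g, hx⟩

lemma ann_extClass [HasExt.{v} C] {S : ShortComplex C} (hS : S.ShortExact) :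
    Ann ((Abelian.extFunctor.{v} 1).obj (op S.X₃)) S.f hS.extClass where
  ann := hS.extClass_comp
  fac Z g hg := by
    obtain ⟨x, hx⟩ := Abelian.Ext.contravariant_sequence_exact₁ hS Z (Abelian.Ext.mk₀ g)
      (add_zero 1) hg
    obtain ⟨h, rfl⟩ := Abelian.Ext.addEquiv₀.symm.surjective x
    refine ⟨h, ?_⟩
    have : Abelian.Ext.mk₀ (S.f ≫ h) = Abelian.Ext.mk₀ g := by
      rw [← Abelian.Ext.mk₀_comp_mk₀]
      exact hx
    exact (Abelian.Ext.mk₀_bijective _ _).1 this.symm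

section

variable [EnoughInjectives C] (F : C ⥤ AddCommGrpCat.{v}) [F.Additive]

lemma upMk_surjective {Z : C} (y : (upFunctor F).obj Z) : ∃ b, upMk F Z b = y :=
  (AddCommGrpCat.epi_iff_surjective _).1 (inferInstanceAs (Epi (upMk F Z))) y

lemma upMk_apply_map_cosyzπ {Z : C} (c : F.obj (Injective.under Z)) :
    upMk F Z (F.map (cosyzπ Z) c) = 0 :=
  ConcreteCategory.congr_hom (map_cosyzπ_upMk F Z) c

lemma upMk_apply_eq_zero {Z : C} {b : F.obj (cosyz Z)} (h : upMk F Z b = 0) :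
    ∃ c, F.map (cosyzπ Z) c = b :=
  (ShortComplex.ab_exact_iff _).1 (ShortComplex.exact_cokernel (F.map (cosyzπ Z))) b h

lemma upTrans_upMk {F G : C ⥤ AddCommGrpCat.{v}} [F.Additive] [G.Additive] (α : F ⟶ G) {Z : C}
    (b : F.obj (cosyz Z)) : (upTrans α).app Z (upMk F Z b) = upMk G Z (α.app _ b) :=
  ConcreteCategory.congr_hom (upMk_trans α Z) b

lemma upTrans_comp {F G H : C ⥤ AddCommGrpCat.{v}} [F.Additive] [G.Additive] [H.Additive]
    (α : F ⟶ G) (β : G ⟶ H) : upTrans (α ≫ β) = upTrans α ≫ upTrans β := by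
  apply NatTrans.ext
  funext Z
  rw [← cancel_epi (upMk F Z), NatTrans.comp_app, upMk_trans, reassoc_of% upMk_trans, upMk_trans,
    NatTrans.comp_app, Category.assoc]

end

section

variable [EnoughInjectives C]

/-- The class in `S¹(X, -)(Z)` of a morphism `X ⟶ Σ Z`. -/
def upCoyMk {X Z : C} (h : X ⟶ cosyz Z) : (upFunctor (preadditiveCoyoneda.obj (op X))).obj Z :=
  upMk (preadditiveCoyoneda.obj (op X)) Z h

lemma upCoyMk_surjective {X Z : C} (y : (upFunctor (preadditiveCoyoneda.obj (op X))).obj Z) :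
    ∃ h : X ⟶ cosyz Z, upCoyMk h = y :=
  upMk_surjective (preadditiveCoyoneda.obj (op X)) y

lemma upCoyMk_add {X Z : C} (g h : X ⟶ cosyz Z) : upCoyMk (g + h) = upCoyMk g + upCoyMk h :=
  map_add (upMk (preadditiveCoyoneda.obj (op X)) Z).hom _ _

lemma upCoyMk_comp {X Z : C} (k : X ⟶ Injective.under Z) : upCoyMk (k ≫ cosyzπ Z) = 0 :=
  upMk_apply_map_cosyzπ (preadditiveCoyoneda.obj (op X)) k

lemma map_upCoyMk {X Z Z' : C} (f : Z ⟶ Z') (h : X ⟶ cosyz Z) :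
    (upFunctor (preadditiveCoyoneda.obj (op X))).map f (upCoyMk h) = upCoyMk (h ≫ cosyzMap f) :=
  ConcreteCategory.congr_hom (upMk_map (preadditiveCoyoneda.obj (op X)) f) h

lemma upTrans_ofElem_upCoyMk {F : C ⥤ AddCommGrpCat.{v}} [F.Additive] {X Z : C} (x : F.obj X)
    (h : X ⟶ cosyz Z) : (upTrans (ofElem F x)).app Z (upCoyMk h) = upMk F Z (F.map h x) :=
  upTrans_upMk (F := preadditiveCoyoneda.obj (op X)) (ofElem F x) h

lemma upTrans_map_upCoyMk {X Y Z : C} (u : X ⟶ Y) (h : Y ⟶ cosyz Z) :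
    (upTrans (preadditiveCoyoneda.map u.op)).app Z (upCoyMk h) = upCoyMk (u ≫ h) :=
  upTrans_upMk (preadditiveCoyoneda.map u.op) h

end

variable [HasExt.{v} C]

lemma extFunctor_obj_map {X Z Z' : C} (f : Z ⟶ Z') (e : Abelian.Ext.{v} X Z 1) :
    ((Abelian.extFunctor.{v} 1).obj (op X)).map f e = e.comp (Abelian.Ext.mk₀ f) (add_zero 1) := rfl

lemma extFunctor_map_app {X Y Z : C} (u : X ⟶ Y) (e : Abelian.Ext.{v} Y Z 1) :
    ((Abelian.extFunctor.{v} 1).map u.op).app Z e = (Abelian.Ext.mk₀ u).comp e (zero_add 1) := rfl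

variable [EnoughInjectives C]

/-- The extension class of a morphism `X ⟶ Σ Z`. -/
def extOfCosyz (X Z : C) : (X ⟶ cosyz Z) →+ Abelian.Ext.{v} X Z 1 where
  toFun h := (Abelian.Ext.mk₀ h).comp (cosyzSeq_shortExact Z).extClass (zero_add 1)
  map_zero' := by rw [Abelian.Ext.mk₀_zero, Abelian.Ext.zero_comp]
  map_add' g h := by rw [Abelian.Ext.mk₀_add, Abelian.Ext.add_comp]

lemma extOfCosyz_apply {X Z : C} (h : X ⟶ cosyz Z) : extOfCosyz X Z h =
    (Abelian.Ext.mk₀ h).comp (cosyzSeq_shortExact Z).extClass (zero_add 1) := rfl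

lemma extOfCosyz_comp {X Z : C} (k : X ⟶ Injective.under Z) :
    extOfCosyz X Z (k ≫ cosyzπ Z) = 0 := by
  rw [extOfCosyz_apply, ← Abelian.Ext.mk₀_comp_mk₀]
  refine (Abelian.Ext.comp_assoc_of_second_deg_zero _ _ _ _).trans ?_
  exact (congrArg (fun t => Abelian.Ext.comp _ t _)
    (cosyzSeq_shortExact Z).comp_extClass).trans (Abelian.Ext.comp_zero _ _ _ _ _)

/-- The connecting map from the right satellite of `(X, -)` to `Ext¹(X, -)` at an object. -/
def upToExtApp (X Z : C) : (upFunctor (preadditiveCoyoneda.obj (op X))).obj Z ⟶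
    ((Abelian.extFunctor.{v} 1).obj (op X)).obj Z :=
  upDesc (preadditiveCoyoneda.obj (op X)) (AddCommGrpCat.ofHom (extOfCosyz X Z)) (by
    ext h
    exact extOfCosyz_comp h)

lemma upToExtApp_upCoyMk {X Z : C} (h : X ⟶ cosyz Z) :
    upToExtApp X Z (upCoyMk h) = extOfCosyz X Z h :=
  ConcreteCategory.congr_hom (upMk_upDesc (preadditiveCoyoneda.obj (op X))
    (AddCommGrpCat.ofHom (extOfCosyz X Z)) _) h

/-- The connecting map from the right satellite of `(X, -)` to `Ext¹(X, -)`. -/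
def upToExt (X : C) : upFunctor (preadditiveCoyoneda.obj (op X)) ⟶
    (Abelian.extFunctor.{v} 1).obj (op X) where
  app Z := upToExtApp X Z
  naturality Z Z' f := by
    ext y
    obtain ⟨h, rfl⟩ := upCoyMk_surjective y
    have e := (cosyzSeq_shortExact Z).extClass_naturality (cosyzSeq_shortExact Z')
      ⟨f, underMap f, cosyzMap f, (ι_underMap f).symm, (π_cosyzMap f).symm⟩
    change upToExtApp X Z' ((upFunctor (preadditiveCoyoneda.obj (op X))).map f (upCoyMk h)) =
      ((Abelian.extFunctor.{v} 1).obj (op X)).map f (upToExtApp X Z (upCoyMk h))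
    rw [map_upCoyMk, upToExtApp_upCoyMk, upToExtApp_upCoyMk, extFunctor_obj_map, extOfCosyz_apply,
      extOfCosyz_apply, Abelian.Ext.comp_assoc _ _ _ (zero_add 1) (add_zero 1) (by lia),
      ← Abelian.Ext.mk₀_comp_mk₀, Abelian.Ext.comp_assoc_of_second_deg_zero]
    exact congrArg (fun t => Abelian.Ext.comp _ t _) e.symm

lemma upToExt_upCoyMk {X Z : C} (h : X ⟶ cosyz Z) :
    (upToExt X).app Z (upCoyMk h) = extOfCosyz X Z h :=
  upToExtApp_upCoyMk h

instance (X : C) : IsIso (upToExt X) := by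
  rw [NatTrans.isIso_iff_isIso_app]
  intro Z
  rw [ConcreteCategory.isIso_iff_bijective]
  constructor
  · refine (injective_iff_map_eq_zero _).2 fun y hy => ?_
    obtain ⟨h, rfl⟩ := upCoyMk_surjective y
    obtain ⟨x, hx⟩ := Abelian.Ext.covariant_sequence_exact₃ X (cosyzSeq_shortExact Z)
      (Abelian.Ext.mk₀ h) (zero_add 1) ((upToExt_upCoyMk h).symm.trans hy)
    obtain ⟨k, rfl⟩ := Abelian.Ext.addEquiv₀.symm.surjective x
    have e : k ≫ cosyzπ Z = h := by
      apply (Abelian.Ext.mk₀_bijective _ _).1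
      rw [← Abelian.Ext.mk₀_comp_mk₀]
      exact hx
    rw [← e]
    exact upCoyMk_comp k
  · intro e
    obtain ⟨x, hx⟩ := Abelian.Ext.covariant_sequence_exact₁ X (cosyzSeq_shortExact Z) e
      (Abelian.Ext.eq_zero_of_injective _) (zero_add 1)
    obtain ⟨h, rfl⟩ := Abelian.Ext.addEquiv₀.symm.surjective x
    exact ⟨upCoyMk h, (upToExt_upCoyMk h).trans hx⟩

lemma upToExt_naturality {X Y : C} (u : X ⟶ Y) :
    upTrans (preadditiveCoyoneda.map u.op) ≫ upToExt X =
      upToExt Y ≫ (Abelian.extFunctor.{v} 1).map u.op := by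
  ext Z y
  obtain ⟨h, rfl⟩ := upCoyMk_surjective y
  change (upToExt X).app Z ((upTrans (preadditiveCoyoneda.map u.op)).app Z (upCoyMk h)) =
    ((Abelian.extFunctor.{v} 1).map u.op).app Z ((upToExt Y).app Z (upCoyMk h))
  rw [upTrans_map_upCoyMk, upToExt_upCoyMk, upToExt_upCoyMk, extFunctor_map_app, extOfCosyz_apply,
    extOfCosyz_apply, Abelian.Ext.mk₀_comp_mk₀_assoc]

lemma extFunctor_map_upToExt {X Y Z : C} (u : X ⟶ Y) (h : Y ⟶ cosyz Z) :
    ((Abelian.extFunctor.{v} 1).map u.op).app Z ((upToExt Y).app Z (upCoyMk h)) =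
      (upToExt X).app Z (upCoyMk (u ≫ h)) := by
  rw [← upTrans_map_upCoyMk]
  exact (ConcreteCategory.congr_hom (NatTrans.congr_app (upToExt_naturality u) Z) _).symm

variable (F : C ⥤ AddCommGrpCat.{v}) [F.Additive]

/-- The natural transformation `Ext¹(X, -) ⟶ S¹ F` given by an element of `F X`. -/
def extToUp {X : C} (x : F.obj X) : (Abelian.extFunctor.{v} 1).obj (op X) ⟶ upFunctor F :=
  inv (upToExt X) ≫ upTrans (ofElem F x)

lemma upToExt_extToUp {X : C} (x : F.obj X) :
    upToExt X ≫ extToUp F x = upTrans (ofElem F x) := by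
  rw [extToUp, IsIso.hom_inv_id_assoc]

lemma extToUp_apply {X Z : C} (x : F.obj X) (h : X ⟶ cosyz Z) :
    (extToUp F x).app Z ((upToExt X).app Z (upCoyMk h)) = upMk F Z (F.map h x) := by
  rw [← upTrans_ofElem_upCoyMk]
  exact ConcreteCategory.congr_hom (NatTrans.congr_app (upToExt_extToUp F x) Z) _

lemma exists_upToExt {X Z : C} (e : ((Abelian.extFunctor.{v} 1).obj (op X)).obj Z) :
    ∃ h : X ⟶ cosyz Z, (upToExt X).app Z (upCoyMk h) = e := by
  obtain ⟨y, rfl⟩ := app_surj (upToExt X) e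
  obtain ⟨h, rfl⟩ := upCoyMk_surjective y
  exact ⟨h, rfl⟩

lemma extToUp_surjective {X : C} {x : F.obj X} (hx : Gen F x) {Z : C} (y : (upFunctor F).obj Z) :
    ∃ e, (extToUp F x).app Z e = y := by
  obtain ⟨b, rfl⟩ := upMk_surjective F y
  obtain ⟨h, rfl⟩ := hx b
  exact ⟨_, extToUp_apply F x h⟩

lemma extToUp_exact {X Y : C} {f : X ⟶ Y} {x : F.obj X} (hx : Gen F x) (hf : Ann F f x) {Z : C}
    (e : ((Abelian.extFunctor.{v} 1).obj (op X)).obj Z) (he : (extToUp F x).app Z e = 0) :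
    ∃ e', ((Abelian.extFunctor.{v} 1).map f.op).app Z e' = e := by
  obtain ⟨h, rfl⟩ := exists_upToExt e
  rw [extToUp_apply] at he
  obtain ⟨c, hc⟩ := upMk_apply_eq_zero F he
  obtain ⟨k, rfl⟩ := hx c
  obtain ⟨m, hm⟩ := hf.fac (h - k ≫ cosyzπ Z) (by
    rw [map_sub_el, ← hc, map_comp_el, sub_self])
  refine ⟨(upToExt Y).app Z (upCoyMk m), ?_⟩
  rw [extFunctor_map_upToExt, ← hm]
  congr 1
  have e := upCoyMk_add (h - k ≫ cosyzπ Z) (k ≫ cosyzπ Z)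
  rwa [sub_add_cancel, upCoyMk_comp, add_zero, eq_comm] at e

lemma extToUp_comp {X Y : C} {f : X ⟶ Y} {x : F.obj X} (hf : Ann F f x) {Z : C}
    (e : ((Abelian.extFunctor.{v} 1).obj (op Y)).obj Z) :
    (extToUp F x).app Z (((Abelian.extFunctor.{v} 1).map f.op).app Z e) = 0 := by
  obtain ⟨h, rfl⟩ := exists_upToExt e
  rw [extFunctor_map_upToExt, extToUp_apply, map_comp_el, hf.ann, map_zero, map_zero]

lemma isIso_extToUp {X P : C} [Projective P] {f : X ⟶ P} {x : F.obj X} (hx : Gen F x)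
    (hf : Ann F f x) : IsIso (extToUp F x) := by
  rw [NatTrans.isIso_iff_isIso_app]
  intro Z
  rw [ConcreteCategory.isIso_iff_bijective]
  refine ⟨(injective_iff_map_eq_zero _).2 fun e he => ?_, extToUp_surjective F hx⟩
  obtain ⟨e', rfl⟩ := extToUp_exact F hx hf e he
  have : e' = 0 := Abelian.Ext.eq_zero_of_projective (P := P) e'
  rw [this, map_zero]

lemma extToUp_naturality {F G : C ⥤ AddCommGrpCat.{v}} [F.Additive] [G.Additive] (φ : F ⟶ G)
    {X Y : C} (x : F.obj X) (y : G.obj Y) (u : Y ⟶ X) (h : φ.app X x = G.map u y) :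
    extToUp F x ≫ upTrans φ = (Abelian.extFunctor.{v} 1).map u.op ≫ extToUp G y := by
  rw [← cancel_epi (upToExt X), ← Category.assoc, upToExt_extToUp, ← upTrans_comp,
    ← Category.assoc, ← upToExt_naturality, Category.assoc, upToExt_extToUp, ← upTrans_comp]
  congr 1
  ext Z (g : X ⟶ Z)
  change φ.app Z (F.map g x) = G.map (u ≫ g) y
  rw [app_nat, h, map_comp_el]

end ExtFunctors

section LeftDerivedZero

variable {C D : Type*} [Category* C] [Category* D] [Abelian C] [Abelian D]
  [HasProjectiveResolutions C] (T : C ⥤ D) [T.Additive]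

/-- A right exact sequence, as a property of two morphisms. -/
structure RightExact {X Y Z : D} (f : X ⟶ Y) (g : Y ⟶ Z) : Prop where
  zero : f ≫ g = 0
  epi : Epi g
  exists_desc : ∀ ⦃W : D⦄ (t : Y ⟶ W), f ≫ t = 0 → ∃ s : Z ⟶ W, g ≫ s = t

lemma RightExact.congr {X Y Z X' Y' Z' : D} {f : X ⟶ Y} {g : Y ⟶ Z} (h : RightExact f g)
    {f' : X' ⟶ Y'} {g' : Y' ⟶ Z'} (a : X ≅ X') (b : Y ≅ Y') (c : Z ≅ Z')
    (hf : f ≫ b.hom = a.hom ≫ f') (hg : g ≫ c.hom = b.hom ≫ g') : RightExact f' g' where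
  zero := by
    rw [← cancel_epi a.hom, ← reassoc_of% hf, ← hg, reassoc_of% h.zero, zero_comp, comp_zero]
  epi := by
    have := h.epi
    have e : g' = b.inv ≫ g ≫ c.hom := by rw [hg, Iso.inv_hom_id_assoc]
    rw [e]
    infer_instance
  exists_desc W t ht := by
    obtain ⟨s, hs⟩ := h.exists_desc (b.hom ≫ t) (by rw [reassoc_of% hf, ht, comp_zero])
    refine ⟨c.inv ≫ s, ?_⟩
    rw [← cancel_epi b.hom, ← reassoc_of% hg, Iso.hom_inv_id_assoc, hs]

/-- The projection of a chain complex onto its zeroth homology. -/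
def homologyπ₀ (K : ChainComplex D ℕ) : K.X 0 ⟶ K.homology 0 :=
  K.pOpcycles 0 ≫ (ChainComplex.isoHomologyι₀ K).inv

lemma homologyπ₀_ι (K : ChainComplex D ℕ) :
    homologyπ₀ K ≫ (ChainComplex.isoHomologyι₀ K).hom = K.pOpcycles 0 := by
  rw [homologyπ₀, Category.assoc, Iso.inv_hom_id, Category.comp_id]

lemma homologyπ₀_naturality {K L : ChainComplex D ℕ} (φ : K ⟶ L) :
    φ.f 0 ≫ homologyπ₀ L = homologyπ₀ K ≫ HomologicalComplex.homologyMap φ 0 := by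
  rw [homologyπ₀, homologyπ₀, Category.assoc, ChainComplex.isoHomologyι₀_inv_naturality,
    HomologicalComplex.p_opcyclesMap_assoc]

lemma rightExact_homologyπ₀ (K : ChainComplex D ℕ) : RightExact (K.d 1 0) (homologyπ₀ K) where
  zero := by rw [homologyπ₀, ← Category.assoc, K.d_pOpcycles, zero_comp]
  epi := epi_comp _ _
  exists_desc W t ht :=
    ⟨(ChainComplex.isoHomologyι₀ K).hom ≫ K.descOpcycles t 1 (by simp) ht, by simp [homologyπ₀]⟩

/-- The zeroth left derived functor as zeroth homology. -/
def homologyIso {X : C} (P : ProjectiveResolution X) :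
    ((T.mapHomologicalComplex _).obj P.complex).homology 0 ≅ (T.leftDerived 0).obj X :=
  (P.isoLeftDerivedObj T 0).symm

/-- The projection onto the zeroth left derived functor, computed by a resolution. -/
def resπ {X : C} (P : ProjectiveResolution X) :
    T.obj (P.complex.X 0) ⟶ (T.leftDerived 0).obj X :=
  homologyπ₀ ((T.mapHomologicalComplex _).obj P.complex) ≫ (homologyIso T P).hom

lemma rightExact_resπ {X : C} (P : ProjectiveResolution X) :
    RightExact (T.map (P.complex.d 1 0)) (resπ T P) :=
  (rightExact_homologyπ₀ ((T.mapHomologicalComplex _).obj P.complex)).congr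
    (Iso.refl _) (Iso.refl _) (homologyIso T P)
    ((Category.comp_id _).trans (Category.id_comp _).symm) (Category.id_comp _).symm

lemma resπ_naturality {X Y : C} (f : X ⟶ Y) (P : ProjectiveResolution X)
    (Q : ProjectiveResolution Y) (g : P.complex ⟶ Q.complex)
    (w : g ≫ Q.π = P.π ≫ (ChainComplex.single₀ C).map f) :
    T.map (g.f 0) ≫ resπ T Q = resπ T P ≫ (T.leftDerived 0).map f := by
  have e : (T.leftDerived 0).map f = (homologyIso T P).inv ≫
      HomologicalComplex.homologyMap ((T.mapHomologicalComplex _).map g) 0 ≫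
        (homologyIso T Q).hom := T.leftDerived_map_eq 0 f g w
  rw [e]
  change ((T.mapHomologicalComplex _).map g).f 0 ≫ homologyπ₀ _ ≫ _ = (homologyπ₀ _ ≫ _) ≫ _
  rw [Category.assoc, Iso.hom_inv_id_assoc, reassoc_of%
    (homologyπ₀_naturality ((T.mapHomologicalComplex (ComplexShape.down ℕ)).map g))]

lemma resπ_fromLeftDerivedZero {X : C} (P : ProjectiveResolution X) :
    resπ T P ≫ T.fromLeftDerivedZero.app X = T.map (P.π.f 0) := by
  have e : T.fromLeftDerivedZero.app X = (homologyIso T P).inv ≫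
      (ChainComplex.isoHomologyι₀ _).hom ≫ P.fromLeftDerivedZero' T := P.fromLeftDerivedZero_eq T
  rw [e]
  change (homologyπ₀ _ ≫ _) ≫ _ = _
  rw [Category.assoc, Iso.hom_inv_id_assoc, reassoc_of%
    (homologyπ₀_ι ((T.mapHomologicalComplex (ComplexShape.down ℕ)).obj P.complex))]
  exact P.pOpcycles_comp_fromLeftDerivedZero' T

/-- The comparison of the zeroth left derived functor with the functor on projectives. -/
def projIso (P : C) [Projective P] : (T.leftDerived 0).obj P ≅ T.obj P :=
  asIso (T.fromLeftDerivedZero.app P)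

lemma map_projIso {P Q : C} [Projective P] [Projective Q] (f : P ⟶ Q) :
    (T.leftDerived 0).map f ≫ (projIso T Q).hom = (projIso T P).hom ≫ T.map f :=
  T.fromLeftDerivedZero.naturality f

lemma leftDerived_zero_map_zero {P X : C} [Projective P] :
    (T.leftDerived 0).map (0 : P ⟶ X) = 0 := by
  have h : IsZero ((T.leftDerived 0).obj (0 : C)) :=
    (T.map_isZero (isZero_zero C)).of_iso (projIso T 0)
  rw [← zero_comp (X := P) (Y := 0) (f := (0 : (0 : C) ⟶ X)), Functor.map_comp,
    h.eq_of_tgt ((T.leftDerived 0).map (0 : P ⟶ 0)) 0, zero_comp]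

lemma leftDerived_zero_map_sub {P Q : C} [Projective P] [Projective Q] (f g : P ⟶ Q) :
    (T.leftDerived 0).map (f - g) = (T.leftDerived 0).map f - (T.leftDerived 0).map g := by
  rw [← cancel_mono (projIso T Q).hom, Preadditive.sub_comp, map_projIso, map_projIso, map_projIso,
    T.map_sub, Preadditive.comp_sub]

lemma rightExact_leftDerived_resolution {X : C} (Q : ProjectiveResolution X) :
    RightExact ((T.leftDerived 0).map (Q.complex.d 1 0))
      ((T.leftDerived 0).map (Q.π.f 0 : Q.complex.X 0 ⟶ X)) := by
  refine (rightExact_resπ T Q).congr (projIso T _).symm (projIso T _).symm (Iso.refl _) ?_ ?_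
  · rw [Iso.symm_hom, Iso.symm_hom, Iso.comp_inv_eq, Category.assoc, map_projIso,
      Iso.inv_hom_id_assoc]
  · let g : (ProjectiveResolution.self (Q.complex.X 0)).complex ⟶ Q.complex :=
      (ChainComplex.fromSingle₀Equiv _ _).symm (𝟙 _)
    have hg : g.f 0 = 𝟙 (Q.complex.X 0) := ChainComplex.fromSingle₀Equiv_symm_apply_f_zero _
    have hw : g ≫ Q.π = (ProjectiveResolution.self (Q.complex.X 0)).π ≫
        (ChainComplex.single₀ C).map (Q.π.f 0 : Q.complex.X 0 ⟶ X) := by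
      refine (ChainComplex.fromSingle₀Equiv _ _).injective ?_
      change g.f 0 ≫ Q.π.f 0 =
        𝟙 (Q.complex.X 0) ≫ ((ChainComplex.single₀ C).map (Q.π.f 0 : Q.complex.X 0 ⟶ X)).f 0
      rw [hg, ChainComplex.single₀_map_f_zero]
      rfl
    obtain ⟨r, h1, h3⟩ : ∃ r : T.obj (Q.complex.X 0) ⟶ (T.leftDerived 0).obj (Q.complex.X 0),
        T.map (g.f 0) ≫ resπ T Q =
          r ≫ (T.leftDerived 0).map (Q.π.f 0 : Q.complex.X 0 ⟶ X) ∧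
        r ≫ (projIso T (Q.complex.X 0)).hom = 𝟙 _ :=
      ⟨_, resπ_naturality T _ _ _ g hw,
        (resπ_fromLeftDerivedZero T (ProjectiveResolution.self (Q.complex.X 0))).trans (T.map_id _)⟩
    rw [← Iso.eq_comp_inv, Category.id_comp] at h3
    rw [hg, h3] at h1
    refine (Category.comp_id _).trans (Eq.trans ?_ h1)
    exact ((congrArg (· ≫ _) (T.map_id _)).trans (Category.id_comp _)).symm

/-- The zeroth left derived functor is right exact on presentations by projectives. -/
lemma rightExact_leftDerived {P₁ P₀ X : C} [Projective P₁] [Projective P₀] {d : P₁ ⟶ P₀}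
    {p : P₀ ⟶ X} [Epi p] {w : d ≫ p = 0} (hS : (ShortComplex.mk d p w).Exact) :
    RightExact ((T.leftDerived 0).map d) ((T.leftDerived 0).map p) := by
  let Q := projectiveResolution X
  let q : Q.complex.X 0 ⟶ X := Q.π.f 0
  have hq : Epi q := inferInstanceAs (Epi (Q.π.f 0))
  have hQ : RightExact ((T.leftDerived 0).map (Q.complex.d 1 0)) ((T.leftDerived 0).map q) :=
    rightExact_leftDerived_resolution T Q
  have hq0 : Q.complex.d 1 0 ≫ q = 0 := Q.complex_d_comp_π_f_zero
  let a : Q.complex.X 0 ⟶ P₀ := Projective.factorThru q p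
  have ha : a ≫ p = q := Projective.factorThru_comp _ _
  let b : P₀ ⟶ Q.complex.X 0 := Projective.factorThru p q
  have hb : b ≫ q = p := Projective.factorThru_comp _ _
  refine ⟨by rw [← Functor.map_comp, w, leftDerived_zero_map_zero], ?_, ?_⟩
  · have := hQ.epi
    rw [← ha, Functor.map_comp] at this
    exact epi_of_epi ((T.leftDerived 0).map a) _
  · intro W t ht
    have hk : ∀ {P : C} [Projective P] (k : P ⟶ P₀), k ≫ p = 0 →
        (T.leftDerived 0).map k ≫ t = 0 := by
      intro P _ k hk
      have e : hS.liftFromProjective k hk ≫ d = k := hS.liftFromProjective_comp k hk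
      rw [← e, Functor.map_comp, Category.assoc, ht, comp_zero]
    obtain ⟨s, hs⟩ := hQ.exists_desc ((T.leftDerived 0).map a ≫ t) (by
      rw [← Functor.map_comp_assoc]
      exact hk _ (by rw [Category.assoc, ha, hq0]))
    refine ⟨s, ?_⟩
    have h0 := hk (b ≫ a - 𝟙 P₀) (by
      rw [Preadditive.sub_comp, Category.assoc, ha, hb, Category.id_comp, sub_self])
    rw [leftDerived_zero_map_sub, Preadditive.sub_comp, CategoryTheory.Functor.map_id,
      Category.id_comp, sub_eq_zero] at h0
    rw [← hb, Functor.map_comp, Category.assoc, hs, ← Functor.map_comp_assoc, h0]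

end LeftDerivedZero

section LeftSatellitePresentation

variable {C : Type u} [Category.{v} C] [Abelian C] [EnoughProjectives C]
  (F : C ⥤ AddCommGrpCat.{v}) [F.Additive]

lemma downι_injective {Z : C} {y y' : (downFunctor F).obj Z} (h : downι F Z y = downι F Z y') :
    y = y' :=
  (AddCommGrpCat.mono_iff_injective _).1 (inferInstanceAs (Mono (downι F Z))) h

lemma map_syzι_downι {Z : C} (y : (downFunctor F).obj Z) : F.map (syzι Z) (downι F Z y) = 0 :=
  ConcreteCategory.congr_hom (downι_map_syzι F Z) y

lemma exists_downι {Z : C} {y : F.obj (syz Z)} (h : F.map (syzι Z) y = 0) :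
    ∃ z, downι F Z z = y :=
  (ShortComplex.ab_exact_iff _).1 (ShortComplex.exact_kernel (F.map (syzι Z))) y h

lemma downι_map {Z Z' : C} (f : Z ⟶ Z') (y : (downFunctor F).obj Z) :
    downι F Z' ((downFunctor F).map f y) = F.map (syzMap f) (downι F Z y) :=
  ConcreteCategory.congr_hom (map_downι F f) y

/-- A morphism through which every morphism to a projective factors. -/
def IsProjApprox {Y Q : C} (c : Y ⟶ Q) : Prop :=
  Projective Q ∧ ∀ ⦃P : C⦄ [Projective P] (l : Y ⟶ P), ∃ l' : Q ⟶ P, l = c ≫ l'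

variable {F} {X Y : C} {f : X ⟶ Y} {x : F.obj X}

lemma Ann.map_eq_of_lift (hf : Ann F f x) {Z : C} {l l' : Y ⟶ Projective.over Z} {g g' : X ⟶ syz Z}
    (h : l ≫ Projective.π Z = l' ≫ Projective.π Z) (hg : g ≫ syzι Z = f ≫ l)
    (hg' : g' ≫ syzι Z = f ≫ l') : F.map g x = F.map g' x := by
  obtain ⟨s, hs⟩ := exists_sub_eq_comp_left (syzSeq_exact Z) h hg hg'
  rw [← sub_eq_zero, ← map_sub_el, hs, map_comp_el, hf.ann, map_zero]

/-- A presentation of the left satellite. -/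
lemma exists_gen_ann_down (hx : Gen F x) (hf : Ann F f x) {Q Q' : C} {cY : Y ⟶ Q}
    {cC : cokernel f ⟶ Q'} (hY : IsProjApprox cY) (hC : IsProjApprox cC) :
    ∃ w : (downFunctor F).obj (pushout (cokernel.π f) cY), Gen (downFunctor F) w ∧
      Ann (downFunctor F) (pushout.inl (pushout.inl (cokernel.π f) cY) cC) w := by
  have := hY.1
  have := hC.1
  let p := cokernel.π f
  have hp : f ≫ p = 0 := cokernel.condition f
  let W := pushout p cY
  let i : cokernel f ⟶ W := pushout.inl p cY
  let k : Q ⟶ Projective.over W := Projective.factorThru (pushout.inr p cY) (Projective.π W)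
  have hk : k ≫ Projective.π W = pushout.inr p cY := Projective.factorThru_comp _ _
  have hlW : (cY ≫ k) ≫ Projective.π W = p ≫ i := by
    rw [Category.assoc, hk, ← pushout.condition]
  let g : X ⟶ syz W := kernel.lift _ (f ≫ cY ≫ k) (by
    rw [Category.assoc, hlW, reassoc_of% hp, zero_comp])
  have hg : g ≫ syzι W = f ≫ cY ≫ k := kernel.lift_ι _ _ _
  have hmap : ∀ {Z : C} (m : W ⟶ Z),
      (g ≫ syzMap m) ≫ syzι Z = f ≫ (cY ≫ k) ≫ overMap m := by
    intro Z m
    rw [Category.assoc, syzMap_ι, reassoc_of% hg, Category.assoc]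
  have hπ : ∀ {Z : C} (m : W ⟶ Z),
      ((cY ≫ k) ≫ overMap m) ≫ Projective.π Z = p ≫ i ≫ m := by
    intro Z m
    rw [Category.assoc, overMap_π, ← Category.assoc, hlW, Category.assoc]
  obtain ⟨w, hw⟩ := exists_downι F (Z := W) (y := F.map g x) (by
    rw [← map_comp_el, hg, map_comp_el, hf.ann, map_zero])
  have hval : ∀ {Z : C} (m : W ⟶ Z),
      downι F Z ((downFunctor F).map m w) = F.map (g ≫ syzMap m) x := by
    intro Z m
    rw [downι_map, hw, ← map_comp_el]
  refine ⟨w, ?_, ?_, ?_⟩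
  · intro Z y
    obtain ⟨g', hg'⟩ := hx (downι F Z y)
    obtain ⟨l, hl⟩ := hf.fac (g' ≫ syzι Z) (by rw [map_comp_el, hg', map_syzι_downι])
    obtain ⟨l', hl'⟩ := hY.2 l
    have hh : p ≫ cokernel.desc f (l ≫ Projective.π Z) (by
        rw [← Category.assoc, ← hl, Category.assoc, kernel.condition, comp_zero]) =
        cY ≫ l' ≫ Projective.π Z := by
      rw [cokernel.π_desc, hl', Category.assoc]
    refine ⟨pushout.desc _ _ hh, downι_injective F ?_⟩
    rw [hval, ← hg']
    refine hf.map_eq_of_lift ?_ (hmap _) hl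
    rw [hπ, pushout.inl_desc, hh, hl', Category.assoc]
  · apply downι_injective F
    rw [hval, map_zero]
    let q : Q' ⟶ Projective.over (pushout i cC) :=
      Projective.factorThru (pushout.inr i cC) (Projective.π _)
    have hq : q ≫ Projective.π _ = pushout.inr i cC := Projective.factorThru_comp _ _
    refine (hf.map_eq_of_lift (l' := p ≫ cC ≫ q) (g' := 0) ?_ (hmap _) ?_).trans
      (map_zero_el F _ _ _)
    · rw [hπ, Category.assoc, Category.assoc, hq, pushout.condition]
    · rw [zero_comp, reassoc_of% hp, zero_comp]
  · intro Z m hm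
    have h0 := hval m
    rw [hm, map_zero] at h0
    obtain ⟨j, hj⟩ := hf.fac _ h0.symm
    obtain ⟨n, hn⟩ := hC.2 (cokernel.desc f ((cY ≫ k) ≫ overMap m - j ≫ syzι Z) (by
      rw [Preadditive.comp_sub, ← hmap, hj, Category.assoc, sub_self]))
    have hm' : i ≫ m = cC ≫ n ≫ Projective.π Z := by
      rw [← cancel_epi p, ← hπ, ← Category.assoc cC, ← hn, cokernel.π_desc_assoc,
        Preadditive.sub_comp, Category.assoc j, kernel.condition, comp_zero, sub_zero]
    exact ⟨pushout.desc m _ hm', (pushout.inl_desc _ _ _).symm⟩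

end LeftSatellitePresentation

section CoherentModules

variable {A : Type u} [Ring A] [IsModAbelian A]

lemma FPMod.kernelι_injective {M N : FPMod A} (f : M ⟶ N) :
    Function.Injective (kernel.ι f).hom.hom := by
  refine (injective_iff_map_eq_zero _).2 fun y hy => ?_
  let t : FPMod.of A ⟶ kernel f := FPMod.ofHom (LinearMap.toSpanSingleton A _ y)
  have ht : t = 0 := by
    rw [← cancel_mono (kernel.ι f), zero_comp]
    apply ObjectProperty.hom_ext
    apply ModuleCat.hom_ext
    ext
    change (kernel.ι f).hom.hom ((1 : A) • y) = 0
    rw [one_smul, hy]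
  have := congrArg (fun s : FPMod.of A ⟶ kernel f => s.hom.hom (1 : A)) ht
  exact (one_smul A y).symm.trans this

lemma FPMod.kernelι_exact {M N : FPMod A} (f : M ⟶ N) :
    Function.Exact (kernel.ι f).hom.hom f.hom.hom := by
  intro x
  constructor
  · intro hx
    let t : FPMod.of A ⟶ M := FPMod.ofHom (LinearMap.toSpanSingleton A _ x)
    have ht : t ≫ f = 0 := by
      apply ObjectProperty.hom_ext
      apply ModuleCat.hom_ext
      ext
      change f.hom.hom ((1 : A) • x) = 0
      rw [one_smul, hx]
    refine ⟨(kernel.lift f t ht).hom.hom (1 : A), ?_⟩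
    have := congrArg (fun s : FPMod.of A ⟶ M => s.hom.hom (1 : A)) (kernel.lift_ι f t ht)
    exact this.trans (one_smul A x)
  · rintro ⟨y, rfl⟩
    exact congrArg (fun s : kernel f ⟶ N => s.hom.hom y) (kernel.condition f)

/-- Over a coherent ring kernels of finitely presented modules are finitely presented. -/
lemma finitePresentation_ker {M N : Type u} [AddCommGroup M] [Module A M] [AddCommGroup N]
    [Module A N] [Module.FinitePresentation A M] [Module.FinitePresentation A N] (f : M →ₗ[A] N) :
    Module.FinitePresentation A (LinearMap.ker f) := by
  let φ : FPMod.of M ⟶ FPMod.of N := FPMod.ofHom f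
  have e : LinearMap.ker f = LinearMap.range (kernel.ι φ).hom.hom :=
    (FPMod.kernelι_exact φ).linearMap_ker_eq
  rw [e]
  exact .of_equiv (LinearEquiv.ofInjective _ (FPMod.kernelι_injective φ))

/-- The syzygy sequence of a finitely presented module, as a sequence of modules. -/
abbrev modSyzSeq (M : FPMod A) : ShortComplex (ModuleCat.{u} A) :=
  ShortComplex.mk (syzι M).hom (Projective.π M).hom
    (congrArg (fun s => s.hom) (kernel.condition (Projective.π M)))

lemma modSyzSeq_shortExact (M : FPMod A) : (modSyzSeq M).ShortExact where
  exact := (ShortComplex.ShortExact.moduleCat_exact_iff_function_exact _).2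
    (FPMod.kernelι_exact (Projective.π M))
  mono_f := (ModuleCat.mono_iff_injective _).2 (FPMod.kernelι_injective (Projective.π M))
  epi_g := (ModuleCat.epi_iff_surjective _).2 (FPMod.surjective_of_epi (Projective.π M))

instance (P : FPMod A) [Projective P] : Projective P.obj :=
  have := P.module_projective
  (IsProjective.iff_projective (R := A) P.obj).1 inferInstance

instance (M : FPMod A) : Projective (modSyzSeq M).X₂ :=
  inferInstanceAs (Projective (Projective.over M).obj)

/-- `Ext¹(M, -)` is totally finitely presented for `M` finitely presented. -/
lemma isTFP_ext {X : ModuleCat.{u} A} (hX : isFPMod A X) :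
    isTFP A ((Abelian.extFunctor.{u} 1).obj (op X)) :=
  (isTFP_iff _).2 ⟨inferInstanceAs (Abelian.extFunctorObj X 1).Additive, _, _,
    (syz (C := FPMod A) ⟨X, hX⟩).property, (Projective.over (C := FPMod A) ⟨X, hX⟩).property, _, _,
    gen_extClass (modSyzSeq_shortExact ⟨X, hX⟩), ann_extClass (modSyzSeq_shortExact ⟨X, hX⟩)⟩

lemma isTFP_up {F : ModuleCat.{u} A ⥤ AddCommGrpCat.{u}} [F.Additive] (hF : isTFP A F) :
    isTFP A (upFunctor F) := by
  obtain ⟨-, X, Y, hX, hY, f, x, hx, hf⟩ := (isTFP_iff F).1 hF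
  exact isTFP.of_exact_right (isTFP_ext hY) (isTFP_ext hX) ((Abelian.extFunctor.{u} 1).map f.op)
    (extToUp F x) (fun _ => extToUp_surjective F hx) (fun _ => extToUp_comp F hf)
    (fun _ => extToUp_exact F hx hf)

end CoherentModules

section Approximations

variable {A : Type u} [Ring A]

/-- Over a ring coherent on the other side, duals of finitely presented modules are finitely
presented. -/
lemma finitePresentation_hom (B U : Type u) [Ring B] [AddCommGroup U] [Module A U] [Module B U]
    [SMulCommClass A B U] [Module.Finite B U] [Module.Projective B U] [IsModAbelian B]
    (Y : FPMod A) : Module.FinitePresentation B (Y.obj →ₗ[A] U) := by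
  let p := freePres Y
  let φ := p.d₁.lcomp B U
  have := finitePresentation_ker φ
  let ψ : (Y.obj →ₗ[A] U) →ₗ[B] LinearMap.ker φ :=
    (p.d₀.lcomp B U).codRestrict _ fun s => by
      change (s ∘ₗ p.d₀) ∘ₗ p.d₁ = 0
      rw [LinearMap.comp_assoc, p.exact.linearMap_comp_eq_zero, LinearMap.comp_zero]
  refine Module.FinitePresentation.of_equiv (LinearEquiv.ofBijective ψ ⟨?_, ?_⟩).symm
  · intro s t h
    exact (LinearMap.cancel_right p.surj).1 (congrArg Subtype.val h)
  · rintro ⟨t, ht⟩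
    have hle : LinearMap.ker p.d₀ ≤ LinearMap.ker t := by
      rw [p.exact.linearMap_ker_eq]
      rintro _ ⟨y, rfl⟩
      exact LinearMap.congr_fun ht y
    refine ⟨(LinearMap.ker p.d₀).liftQ t hle ∘ₗ
      (p.d₀.quotKerEquivOfSurjective p.surj).symm.toLinearMap, Subtype.ext ?_⟩
    refine LinearMap.ext fun y => ?_
    change (LinearMap.ker p.d₀).liftQ t hle
      ((p.d₀.quotKerEquivOfSurjective p.surj).symm (p.d₀ y)) = t y
    have : (p.d₀.quotKerEquivOfSurjective p.surj).symm (p.d₀ y) = Submodule.Quotient.mk y := by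
      rw [LinearEquiv.symm_apply_eq]
      rfl
    rw [this]
    rfl

/-- Over a ring coherent on the other side, a finitely presented module has an approximation by a
finitely generated projective module. -/
lemma exists_projApprox (B U : Type u) [Ring B] [AddCommGroup U] [Module A U] [Module B U]
    [SMulCommClass A B U] [Module.Finite B U] [Module.Projective B U] [IsModAbelian B]
    (e : U ≃ₗ[A] A) {Y : ModuleCat.{u} A} (hY : isFPMod A Y) :
    ∃ (Q : ModuleCat.{u} A) (_ : isFPMod A Q) (c : Y ⟶ Q), IsProjApprox c := by
  have : Module.FinitePresentation A Y := hY
  have : Module.Finite A U := Module.Finite.equiv e.symm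
  have : Module.Projective A U := Module.Projective.of_equiv e.symm
  have hproj (n : ℕ) : Module.Projective A (Fin n → U) := Module.Projective.of_equiv
    (DFinsupp.linearEquivFunOnFintype (R := A) (M := fun _ : Fin n => U))
  have : Module.FinitePresentation B (Y →ₗ[A] U) := finitePresentation_hom B U ⟨Y, hY⟩
  obtain ⟨n, s, hs⟩ := Module.Finite.exists_fin (R := B) (M := Y →ₗ[A] U)
  let c : Y →ₗ[A] (Fin n → U) := LinearMap.pi s
  have hU : ∀ φ : Y →ₗ[A] U, ∃ l : (Fin n → U) →ₗ[A] U, φ = l ∘ₗ c := by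
    intro φ
    have : φ ∈ Submodule.span B (Set.range s) := hs ▸ Submodule.mem_top
    obtain ⟨b, rfl⟩ := (Submodule.mem_span_range_iff_exists_fun B).1 this
    refine ⟨∑ i, b i • LinearMap.proj i, ?_⟩
    ext y
    simp [c]
  refine ⟨ModuleCat.of A (Fin n → U), Module.finitePresentation_of_projective A (Fin n → U),
    ModuleCat.ofHom c, ?_, ?_⟩
  · exact (IsProjective.iff_projective (R := A) _).1
      (hproj n)
  · intro P hP l
    have : Module.Projective A P := (IsProjective.iff_projective (R := A) P).2 hP
    obtain ⟨σ, hσ⟩ := Module.projective_def'.1 this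
    obtain ⟨S, hS⟩ := Module.Finite.fg_top (R := A) (M := Y)
    classical
    let l₁ : Y →ₗ[A] (P →₀ A) := σ ∘ₗ l.hom
    let T : Finset P := S.biUnion fun y => (l₁ y).support
    choose q hq using fun i : P => hU (e.symm.toLinearMap ∘ₗ Finsupp.lapply i ∘ₗ l₁)
    let l₂ : (Fin n → U) →ₗ[A] (P →₀ A) := ∑ i ∈ T, Finsupp.lsingle i ∘ₗ e.toLinearMap ∘ₗ q i
    have key : l₁ = l₂ ∘ₗ c := by
      refine LinearMap.ext_on (s := (S : Set Y)) hS fun y hy => ?_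
      have h1 : ∀ i, e (q i (c y)) = l₁ y i := by
        intro i
        have := LinearMap.congr_fun (hq i) y
        rw [← LinearMap.comp_apply, ← this]
        simp
      simp only [l₂, LinearMap.comp_apply, LinearMap.sum_apply, LinearEquiv.coe_coe, h1,
        Finsupp.lsingle_apply]
      refine ((l₁ y).sum_single.symm.trans ?_)
      refine Finsupp.sum_of_support_subset _ ?_ _ (by simp)
      intro i hi
      exact Finset.mem_biUnion.2 ⟨y, hy, hi⟩
    refine ⟨ModuleCat.ofHom (Finsupp.linearCombination A id ∘ₗ l₂), ?_⟩
    apply ModuleCat.hom_ext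
    change l.hom = (Finsupp.linearCombination A id ∘ₗ l₂) ∘ₗ c
    rw [LinearMap.comp_assoc, ← key, ← LinearMap.comp_assoc, hσ, LinearMap.id_comp]

lemma isTFP_down (B U : Type u) [Ring B] [AddCommGroup U] [Module A U] [Module B U]
    [SMulCommClass A B U] [Module.Finite B U] [Module.Projective B U] [IsModAbelian B]
    (e : U ≃ₗ[A] A) {F : ModuleCat.{u} A ⥤ AddCommGrpCat.{u}} [F.Additive]
    (hF : isTFP A F) : isTFP A (downFunctor F) := by
  obtain ⟨-, X, Y, hX, hY, f, x, hx, hf⟩ := (isTFP_iff F).1 hF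
  have hC := isFPMod_cokernel f hX hY
  obtain ⟨Q, hQ, cY, hcY⟩ := exists_projApprox B U e hY
  obtain ⟨Q', hQ', cC, hcC⟩ := exists_projApprox B U e hC
  obtain ⟨w, hw, hw'⟩ := exists_gen_ann_down hx hf hcY hcC
  have hW := isFPMod_pushout (cokernel.π f) cY hY hC hQ
  exact (isTFP_iff _).2 ⟨inferInstance, _, _, hW, isFPMod_pushout _ _ hC hW hQ', _, w, hw, hw'⟩

end Approximations

section FPExactness

variable {C : Type u} [Category.{v} C]

lemma exists_lift_of_injective {F G I : C ⥤ AddCommGrpCat.{v}} (v : F ⟶ I)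
    (hv : ∀ (A : C) (a b : F.obj A), v.app A a = v.app A b → a = b) (s : G ⟶ I)
    (h : ∀ (A : C) (b : G.obj A), ∃ a, v.app A a = s.app A b) : ∃ r : G ⟶ F, r ≫ v = s := by
  choose r hr using h
  refine ⟨{ app := fun A => AddCommGrpCat.ofHom
              { toFun := r A
                map_zero' := hv _ _ _ (by rw [hr, map_zero, map_zero])
                map_add' := fun a b => hv _ _ _ (by rw [hr, map_add, map_add, hr, hr]) }
            naturality := fun A B g => ?_ }, ?_⟩
  · ext a
    apply hv
    change v.app B (r B (G.map g a)) = v.app B (F.map g (r A a))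
    rw [hr, app_nat, app_nat, hr]
  · ext A b
    exact hr A b

variable [Abelian C]

lemma FP.mono_of_injective {F I : FP C} (v : F ⟶ I)
    (hv : ∀ (A : C) (a b : F.obj.obj A), v.hom.app A a = v.hom.app A b → a = b) : Mono v := by
  have : Mono v.hom := by
    rw [NatTrans.mono_iff_mono_app]
    intro A
    exact (AddCommGrpCat.mono_iff_injective _).2 fun a b h => hv A a b h
  exact (isFP C).ι.mono_of_mono_map this

lemma FP.exact_of_elements {F I J : FP C} (v : F ⟶ I) (t : I ⟶ J) (w : v ≫ t = 0)
    (hv : ∀ (A : C) (a b : F.obj.obj A), v.hom.app A a = v.hom.app A b → a = b)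
    (h : ∀ (A : C) (b : I.obj.obj A), t.hom.app A b = 0 → ∃ a, v.hom.app A a = b) :
    (ShortComplex.mk v t w).Exact := by
  have := FP.mono_of_injective v hv
  refine ShortComplex.exact_of_f_is_kernel _ (KernelFork.IsLimit.ofι' v w fun {G} s hs => ?_)
  have hl := exists_lift_of_injective v.hom hv s.hom fun A b => h A _
    (ConcreteCategory.congr_hom (NatTrans.congr_app (congrArg (fun q => q.hom) hs) A) b)
  exact ⟨ObjectProperty.homMk hl.choose, ObjectProperty.hom_ext _ hl.choose_spec⟩

lemma RightExact.exists_app {F G H : FP C} {f : F ⟶ G} {g : G ⟶ H} (h : RightExact f g) {A : C}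
    {b : G.obj.obj A} (hb : g.hom.app A b = 0) : ∃ a, f.hom.app A a = b := by
  let Q : FP C := ⟨cokernel f.hom,
    isFP.of_exact_right (ShortComplex.exact_cokernel f.hom) F.property G.property⟩
  let q : G ⟶ Q := ObjectProperty.homMk (cokernel.π f.hom)
  obtain ⟨s, hs⟩ := h.exists_desc q (ObjectProperty.hom_ext _ (cokernel.condition f.hom))
  refine exact_app (ShortComplex.exact_cokernel f.hom) ?_
  have e : q.hom = g.hom ≫ s.hom := congrArg (fun q => q.hom) hs.symm
  refine (ConcreteCategory.congr_hom (NatTrans.congr_app e A) b).trans ?_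
  change s.hom.app A (g.hom.app A b) = 0
  rw [hb, map_zero]

lemma RightExact.app_surj {F G H : FP C} {f : F ⟶ G} {g : G ⟶ H} (h : RightExact f g) {A : C}
    (b : H.obj.obj A) : ∃ a, g.hom.app A a = b := by
  let Q : FP C := ⟨cokernel g.hom,
    isFP.of_exact_right (ShortComplex.exact_cokernel g.hom) G.property H.property⟩
  let q : H ⟶ Q := ObjectProperty.homMk (cokernel.π g.hom)
  have := h.epi
  have hq : q = 0 := by
    rw [← cancel_epi g, comp_zero]
    exact ObjectProperty.hom_ext _ (cokernel.condition g.hom)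
  refine exact_app (ShortComplex.exact_cokernel g.hom) ?_
  exact ConcreteCategory.congr_hom (NatTrans.congr_app (congrArg (fun q => q.hom) hq) A) b

/-- A presented functor as an object of `fp(C, Ab)`. -/
def presFP {X Y : C} (f : X ⟶ Y) : FP C := ⟨presFun f, X, Y, _, ⟨Iso.refl _⟩⟩

lemma injective_presFP {X Y : C} [Projective X] [Projective Y] (f : X ⟶ Y) :
    Injective (presFP f) :=
  injective_of_projective (presFP f) (gen_presGen f) (ann_presGen f)

lemma gen_id (X : C) : Gen (preadditiveCoyoneda.obj (op X)) (𝟙 X) := fun A a =>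
  ⟨a, Category.id_comp (X := X) (Y := A) a⟩

lemma ann_id (X : C) : Ann (preadditiveCoyoneda.obj (op X)) (0 : X ⟶ 0) (𝟙 X) where
  ann := comp_zero (f := 𝟙 X)
  fac A g hg := by
    refine ⟨0, ?_⟩
    rw [comp_zero]
    exact (Category.id_comp g).symm.trans hg

instance (X : C) [Projective X] : Injective ((yonedaFP C).obj (op X)) :=
  injective_of_projective ((yonedaFP C).obj (op X)) (gen_id X) (ann_id X)

end FPExactness

section DualPresentation

variable (A B U : Type u) [Ring A] [Ring B] [AddCommGroup U] [Module A U] [Module B U]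
  [SMulCommClass A B U]

/-- The dual of an injective `I` is represented by `I(U)`. -/
def dualInjIso (I : FP (ModuleCat.{u} A)) [Injective I] :
    (dual A B U).obj (op I) ≅ (yonedaFP _).obj (op ((ev A B U).obj I)) :=
  projIso (yonedaEv A B U) (op I)

lemma map_dualInjIso {I J : FP (ModuleCat.{u} A)} [Injective I] [Injective J] (t : I ⟶ J) :
    (dual A B U).map t.op ≫ (dualInjIso A B U I).hom =
      (dualInjIso A B U J).hom ≫ (yonedaFP _).map ((ev A B U).map t).op :=
  map_projIso (yonedaEv A B U) t.op

/-- The element of the dual given by a morphism to an injective. -/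
def dualElem {F I : FP (ModuleCat.{u} A)} [Injective I] (v : F ⟶ I) :
    ((dual A B U).obj (op F)).obj.obj ((ev A B U).obj I) :=
  ((dualInjIso A B U I).inv ≫ (dual A B U).map v.op).hom.app _ (𝟙 ((ev A B U).obj I))

lemma map_dualElem {F I : FP (ModuleCat.{u} A)} [Injective I] (v : F ⟶ I)
    {Z : ModuleCat.{u} B} (g : (ev A B U).obj I ⟶ Z) :
    ((dual A B U).obj (op F)).obj.map g (dualElem A B U v) =
      ((dualInjIso A B U I).inv ≫ (dual A B U).map v.op).hom.app Z g := by
  refine (app_nat (((dualInjIso A B U I).inv ≫ (dual A B U).map v.op).hom) g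
    (𝟙 ((ev A B U).obj I))).symm.trans ?_
  exact congrArg (((dualInjIso A B U I).inv ≫ (dual A B U).map v.op).hom.app Z)
    (Category.id_comp g)

lemma dualElem_naturality {F G I J : FP (ModuleCat.{u} A)} [Injective I] [Injective J]
    (v : F ⟶ I) (v' : G ⟶ J) (φ : F ⟶ G) (ψ : I ⟶ J) (h : v ≫ ψ = φ ≫ v') :
    ((dual A B U).map φ.op).hom.app _ (dualElem A B U v') =
      ((dual A B U).obj (op F)).obj.map ((ev A B U).map ψ) (dualElem A B U v) := by
  rw [map_dualElem]
  have e : ((dualInjIso A B U J).inv ≫ (dual A B U).map v'.op) ≫ (dual A B U).map φ.op =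
      (yonedaFP _).map ((ev A B U).map ψ).op ≫ (dualInjIso A B U I).inv ≫
        (dual A B U).map v.op := by
    rw [Category.assoc, ← Functor.map_comp, ← op_comp, ← h, op_comp, Functor.map_comp,
      ← Category.assoc, ← Category.assoc]
    congr 1
    rw [Iso.inv_comp_eq, ← Category.assoc, ← map_dualInjIso, Category.assoc, Iso.hom_inv_id,
      Category.comp_id]
  refine (ConcreteCategory.congr_hom (NatTrans.congr_app (congrArg
    (fun q : (yonedaFP _).obj (op ((ev A B U).obj J)) ⟶ (dual A B U).obj (op F) => q.hom) e) _)
    (𝟙 ((ev A B U).obj J))).trans ?_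
  exact congrArg (((dualInjIso A B U I).inv ≫ (dual A B U).map v.op).hom.app _)
    (Category.comp_id ((ev A B U).map ψ))

/-- The presentation of the dual given by an injective copresentation. -/
lemma gen_ann_dualElem {F I J : FP (ModuleCat.{u} A)} [Injective I] [Injective J] (v : F ⟶ I)
    (t : I ⟶ J) (w : v ≫ t = 0)
    (hv : ∀ (X : ModuleCat.{u} A) (a b : F.obj.obj X), v.hom.app X a = v.hom.app X b → a = b)
    (h : ∀ (X : ModuleCat.{u} A) (b : I.obj.obj X), t.hom.app X b = 0 → ∃ a, v.hom.app X a = b) :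
    Gen ((dual A B U).obj (op F)).obj (dualElem A B U v) ∧
      Ann ((dual A B U).obj (op F)).obj ((ev A B U).map t) (dualElem A B U v) := by
  have := FP.mono_of_injective v hv
  have hex := (FP.exact_of_elements v t w hv h).op
  have hR : RightExact ((dual A B U).map t.op) ((dual A B U).map v.op) :=
    rightExact_leftDerived (yonedaEv A B U) hex
  have hR' : RightExact ((yonedaFP _).map ((ev A B U).map t).op)
      ((dualInjIso A B U I).inv ≫ (dual A B U).map v.op) :=
    hR.congr (dualInjIso A B U J) (dualInjIso A B U I) (Iso.refl _) (map_dualInjIso A B U t)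
      (by rw [Iso.refl_hom, Category.comp_id, Iso.hom_inv_id_assoc])
  refine ⟨fun Z b => ?_, ?_, fun Z g hg => ?_⟩
  · obtain ⟨g, hg⟩ := hR'.app_surj b
    exact ⟨g, (map_dualElem A B U v g).trans hg⟩
  · rw [map_dualElem]
    have := congrArg (fun q => q.hom) hR'.zero
    refine Eq.trans ?_ (ConcreteCategory.congr_hom (NatTrans.congr_app this _)
      (𝟙 ((ev A B U).obj J)))
    exact congrArg (((dualInjIso A B U I).inv ≫ (dual A B U).map v.op).hom.app _)
      (Category.comp_id ((ev A B U).map t)).symm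
  · rw [map_dualElem] at hg
    obtain ⟨k, hk⟩ := hR'.exists_app hg
    exact ⟨k, hk.symm⟩

variable {A}

/-- The map `Hom(X, U) ⟶ I(U)` given by an element of `I X`. -/
def evLin (I : FP (ModuleCat.{u} A)) {X : ModuleCat.{u} A} (x : I.obj.obj X) :
    (X →ₗ[A] U) →ₗ[B] ((ev A B U).obj I) where
  toFun g := I.obj.map (ModuleCat.ofHom g : X ⟶ ModuleCat.of A U) x
  map_add' g h := map_add_el I.obj (ModuleCat.ofHom g : X ⟶ ModuleCat.of A U) (ModuleCat.ofHom h) x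
  map_smul' b g := map_comp_el I.obj (ModuleCat.ofHom g) (mulEnd A B U b) x

lemma evLin_surjective {I : FP (ModuleCat.{u} A)} {X : ModuleCat.{u} A} {x : I.obj.obj X}
    (hx : Gen I.obj x) : Function.Surjective (evLin B U I x) := fun y => by
  obtain ⟨g, hg⟩ := hx (A := ModuleCat.of A U) y
  exact ⟨g.hom, hg⟩

lemma ker_evLin {I : FP (ModuleCat.{u} A)} {X Y : ModuleCat.{u} A} {f : X ⟶ Y} {x : I.obj.obj X}
    (hf : Ann I.obj f x) : LinearMap.ker (evLin B U I x) = LinearMap.range (f.hom.lcomp B U) := by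
  ext g
  constructor
  · intro hg
    obtain ⟨h, hh⟩ := hf.fac (ModuleCat.ofHom g : X ⟶ ModuleCat.of A U) hg
    exact ⟨h.hom, (congrArg (fun t : X ⟶ ModuleCat.of A U => t.hom) hh).symm⟩
  · rintro ⟨h, rfl⟩
    change I.obj.map (f ≫ (ModuleCat.ofHom h : Y ⟶ ModuleCat.of A U)) x = 0
    rw [map_comp_el, hf.ann, map_zero]

end DualPresentation

section Copresentation

variable {C : Type u} [Category.{v} C] [Abelian C]

/-- A presented functor embeds in a functor presented by a morphism of projectives. -/
lemma exists_embedding {F : C ⥤ AddCommGrpCat.{v}} [F.Additive] {X Y : C} {f : X ⟶ Y} {x : F.obj X}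
    (hx : Gen F x) (hf : Ann F f x) {P Q Q' : C} [Projective P] (p : P ⟶ X) [Epi p] (κ : Q' ⟶ Q)
    (q : Q ⟶ Y) [Epi q] (w : κ ≫ q = 0) (hq : (ShortComplex.mk κ q w).Exact) :
    ∃ (t : P ⊞ Q' ⟶ Q) (v : F ⟶ presFun t), ∀ (A : C) (a b : F.obj A),
      v.app A a = v.app A b → a = b := by
  let α := Projective.factorThru (p ≫ f) q
  have hα : α ≫ q = p ≫ f := Projective.factorThru_comp _ _
  let t := biprod.desc α κ
  obtain ⟨v, hv⟩ := exists_hom hx hf (G := presFun t)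
    (w := (presFun t).map (biprod.desc p 0) (presGen t)) (by
      have : biprod.desc p 0 ≫ f = t ≫ q := by
        ext
        · simp [t, hα]
        · simp [t, w]
      rw [← map_comp_el, this, map_comp_el, (ann_presGen t).ann, map_zero])
  refine ⟨t, v, fun A => (injective_iff_map_eq_zero (v.app A).hom).2 fun a ha => ?_⟩
  obtain ⟨h, rfl⟩ := hx a
  have ha' : v.app A (F.map h x) = 0 := ha
  rw [app_nat, hv, ← map_comp_el] at ha'
  obtain ⟨m, hm⟩ := (ann_presGen t).fac _ ha'
  have h1 : p ≫ h = α ≫ m := by simpa [t] using congrArg (biprod.inl ≫ ·) hm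
  have h2 : κ ≫ m = 0 := by simpa [t] using (congrArg (biprod.inr ≫ ·) hm).symm
  have h3 : q ≫ hq.desc m h2 = m := hq.g_desc m h2
  have h4 : h = f ≫ hq.desc m h2 := by
    rw [← cancel_epi p, h1, ← Category.assoc, ← hα, Category.assoc, h3]
  rw [h4, map_comp_el, hf.ann, map_zero]

end Copresentation

section DualTotallyFinitelyPresented

variable {A : Type u} [Ring A]

instance (n : ℕ) : Projective (ModuleCat.of A (Fin n → A)) :=
  (IsProjective.iff_projective (R := A) (Fin n → A)).1 inferInstance

lemma isFPMod_free (n : ℕ) : isFPMod A (ModuleCat.of A (Fin n → A)) :=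
  inferInstanceAs (Module.FinitePresentation A (Fin n → A))

lemma isTFP.exists_embedding {F : ModuleCat.{u} A ⥤ AddCommGrpCat.{u}} (hF : isTFP A F) :
    ∃ (P Q : ModuleCat.{u} A) (_ : isFPMod A P) (_ : isFPMod A Q) (_ : Projective P)
      (_ : Projective Q) (t : P ⟶ Q) (v : F ⟶ presFun t), ∀ (A : ModuleCat.{u} A) (a b : F.obj A),
        v.app A a = v.app A b → a = b := by
  have := hF.additive
  obtain ⟨-, X, Y, hX, hY, f, x, hx, hf⟩ := (isTFP_iff F).1 hF
  let r := freePres (A := A) ⟨X, hX⟩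
  let s := freePres (A := A) ⟨Y, hY⟩
  let p : ModuleCat.of A (Fin r.n → A) ⟶ X := ModuleCat.ofHom r.d₀
  let κ : ModuleCat.of A (Fin s.m → A) ⟶ ModuleCat.of A (Fin s.n → A) := ModuleCat.ofHom s.d₁
  let q : ModuleCat.of A (Fin s.n → A) ⟶ Y := ModuleCat.ofHom s.d₀
  have : Epi p := (ModuleCat.epi_iff_surjective p).2 r.surj
  have : Epi q := (ModuleCat.epi_iff_surjective q).2 s.surj
  have w : κ ≫ q = 0 := ModuleCat.hom_ext s.exact.linearMap_comp_eq_zero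
  have hq : (ShortComplex.mk κ q w).Exact :=
    (ShortComplex.ShortExact.moduleCat_exact_iff_function_exact _).2 s.exact
  obtain ⟨t, v, hv⟩ := Linkage.exists_embedding hx hf p κ q w hq
  exact ⟨_, _, isFPMod_biprod (isFPMod_free _) (isFPMod_free _), isFPMod_free _, inferInstance,
    inferInstance, t, v, hv⟩

variable (B U : Type u) [Ring B] [AddCommGroup U] [Module A U] [Module B U] [SMulCommClass A B U]
  [Module.Finite B U] [Module.Projective B U] [IsModAbelian B]

lemma isFPMod_ev {X Y : ModuleCat.{u} A} (hX : isFPMod A X) (hY : isFPMod A Y) (f : X ⟶ Y) :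
    isFPMod B ((ev A B U).obj (presFP f)) := by
  have : Module.FinitePresentation B (X →ₗ[A] U) := finitePresentation_hom B U ⟨X, hX⟩
  have : Module.FinitePresentation B (Y →ₗ[A] U) := finitePresentation_hom B U ⟨Y, hY⟩
  refine Module.finitePresentation_of_surjective (evLin B U (presFP f) (presGen f))
    (evLin_surjective B U (I := presFP f) (gen_presGen f)) ?_
  rw [ker_evLin B U (I := presFP f) (ann_presGen f), LinearMap.range_eq_map]
  exact (Module.Finite.fg_top).map _

/-- The dual of a totally finitely presented functor is totally finitely presented. -/
lemma isTFP_dual (F : FP (ModuleCat.{u} A)) (hF : isTFP A F.obj) :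
    isTFP B ((dual A B U).obj (op F)).obj := by
  obtain ⟨P, Q, hP, hQ, _, _, t, v, hv⟩ := hF.exists_embedding
  have hC : isTFP A (cokernel v) := isTFP.of_exact_right hF (isTFP_presFun hP hQ t) v
    (cokernel.π v) (fun _ => app_surj (cokernel.π v))
    (fun _ => app_comp_zero (cokernel.condition v))
    (fun _ _ => exact_app (ShortComplex.exact_cokernel v))
  obtain ⟨P', Q', hP', hQ', _, _, t', v', hv'⟩ := hC.exists_embedding
  have := injective_presFP t
  have := injective_presFP t'
  let i : F ⟶ presFP t := ObjectProperty.homMk v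
  let j : presFP t ⟶ presFP t' := ObjectProperty.homMk (cokernel.π v ≫ v')
  have hg := gen_ann_dualElem A B U i j
    (ObjectProperty.hom_ext _ (by
      change v ≫ cokernel.π v ≫ v' = 0
      rw [cokernel.condition_assoc, zero_comp])) hv fun X b hb =>
      exact_app (ShortComplex.exact_cokernel v) (hv' X _ _ (hb.trans (map_zero _).symm))
  exact (isTFP_iff _).2 ⟨inferInstance, _, _, isFPMod_ev B U hP hQ t, isFPMod_ev B U hP' hQ' t', _,
    _, hg.1, hg.2⟩

lemma arrowsRestrict [IsModAbelian A] (e : U ≃ₗ[A] A) : ArrowsRestrict A B U where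
  ext M := isTFP_ext M.as.property
  up F := isTFP_up F.property
  down F := isTFP_down B U e F.property
  dual F := isTFP_dual B U _ F.unop.property

end DualTotallyFinitelyPresented

section GenTransport

variable {C : Type u} [Category.{v} C] {F : C ⥤ AddCommGrpCat.{v}} {X X' : C}
  {x : F.obj X}

lemma Gen.map_iso (hx : Gen F x) (e : X ≅ X') : Gen F (F.map e.hom x) := fun A a => by
  obtain ⟨g, rfl⟩ := hx a
  exact ⟨e.inv ≫ g, by rw [← map_comp_el, e.hom_inv_id_assoc]⟩

lemma Ann.map_iso {Y Y' : C} {f : X ⟶ Y} (hf : Ann F f x) (e : X ≅ X') (i : Y ≅ Y') :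
    Ann F (e.inv ≫ f ≫ i.hom) (F.map e.hom x) where
  ann := by rw [← map_comp_el, e.hom_inv_id_assoc, map_comp_el, hf.ann, map_zero]
  fac A g hg := by
    rw [← map_comp_el] at hg
    obtain ⟨h, hh⟩ := hf.fac _ hg
    refine ⟨i.inv ≫ h, ?_⟩
    rw [Category.assoc, Category.assoc, i.hom_inv_id_assoc, ← hh, e.inv_hom_id_assoc]

end GenTransport

section DualOfExt

variable {A : Type u} [Ring A]

/-- The generators of the chosen presentation. -/
abbrev presGens (M : FPMod A) : ModuleCat.{u} A := ModuleCat.of A (Fin (freePres M).n → A)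

/-- The relations of the chosen presentation. -/
abbrev presRels (M : FPMod A) : ModuleCat.{u} A := ModuleCat.of A (Fin (freePres M).m → A)

/-- The differential of the chosen presentation. -/
def presD (M : FPMod A) : presRels M ⟶ presGens M := ModuleCat.ofHom (freePres M).d₁

/-- The short exact sequence given by the generators of the chosen presentation. -/
abbrev presSeq (M : FPMod A) : ShortComplex (ModuleCat.{u} A) where
  X₁ := ModuleCat.of A (LinearMap.ker (freePres M).d₀)
  X₂ := presGens M
  X₃ := M.obj
  f := ModuleCat.ofHom (LinearMap.ker (freePres M).d₀).subtype
  g := ModuleCat.ofHom (freePres M).d₀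
  zero := by ext x; exact x.2

lemma presSeq_shortExact (M : FPMod A) : (presSeq M).ShortExact where
  exact := (ShortComplex.ShortExact.moduleCat_exact_iff_function_exact _).2
    (LinearMap.exact_subtype_ker_map _)
  mono_f := (ModuleCat.mono_iff_injective _).2 Subtype.val_injective
  epi_g := (ModuleCat.epi_iff_surjective _).2 (freePres M).surj

instance (M : FPMod A) : Projective (presSeq M).X₂ := inferInstanceAs (Projective (presGens M))

instance (M : FPMod A) : Mono (presSeq M).f := (presSeq_shortExact M).mono_f

/-- The projection of the relations onto the first syzygy. -/
def presProj (M : FPMod A) : presRels M ⟶ (presSeq M).X₁ :=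
  ModuleCat.ofHom ((freePres M).d₁.codRestrict _ fun x => (freePres M).exact.apply_apply_eq_zero x)

lemma presProj_f (M : FPMod A) : presProj M ≫ (presSeq M).f = presD M := rfl

instance (M : FPMod A) : Epi (presProj M) :=
  (ModuleCat.epi_iff_surjective _).2 fun ⟨y, hy⟩ => by
    obtain ⟨x, hx⟩ := ((freePres M).exact y).1 hy
    exact ⟨x, Subtype.ext hx⟩

/-- The functor `Ext¹(M, -)`, for `M` finitely presented. -/
def extFP [IsModAbelian A] (M : FPMod A) : FP (ModuleCat.{u} A) :=
  ⟨(Abelian.extFunctor.{u} 1).obj (op M.obj), isTFP_le_isFP _ _ (isTFP_ext M.property)⟩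

/-- The map `Ext¹(N, -) ⟶ Ext¹(M, -)` given by `M ⟶ N`. -/
def extFPMap [IsModAbelian A] {M N : FPMod A} (φ : M ⟶ N) : extFP N ⟶ extFP M :=
  ObjectProperty.homMk ((Abelian.extFunctor.{u} 1).map φ.hom.op)

/-- The class of the extension given by the chosen presentation. -/
def extElem [IsModAbelian A] (M : FPMod A) : (extFP M).obj.obj (presSeq M).X₁ :=
  (presSeq_shortExact M).extClass

lemma gen_extElem [IsModAbelian A] (M : FPMod A) : Gen (extFP M).obj (extElem M) :=
  gen_extClass (presSeq_shortExact M)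

lemma ann_extElem [IsModAbelian A] (M : FPMod A) :
    Ann (extFP M).obj (presSeq M).f (extElem M) :=
  ann_extClass (presSeq_shortExact M)

/-- An injective functor containing `Ext¹(M, -)`. -/
abbrev extInj (M : FPMod A) : FP (ModuleCat.{u} A) := presFP (presD M)

instance (M : FPMod A) : Injective (extInj M) := injective_presFP (presD M)

/-- The generator of the injective functor containing `Ext¹(M, -)`. -/
abbrev extInjGen (M : FPMod A) : (extInj M).obj.obj (presRels M) := presGen (presD M)

lemma exists_extEmb [IsModAbelian A] (M : FPMod A) : ∃ v : (extFP M).obj ⟶ (extInj M).obj,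
    v.app _ (extElem M) = (extInj M).obj.map (presProj M) (extInjGen M) := by
  refine exists_hom (gen_extElem M) (ann_extElem M) ?_
  rw [← map_comp_el, presProj_f]
  exact (ann_presGen (presD M)).ann

/-- The embedding of `Ext¹(M, -)` in an injective functor. -/
def extEmb [IsModAbelian A] (M : FPMod A) : extFP M ⟶ extInj M :=
  ObjectProperty.homMk (exists_extEmb M).choose

lemma extEmb_extElem [IsModAbelian A] (M : FPMod A) : (extEmb M).hom.app _ (extElem M) =
    (extInj M).obj.map (presProj M) (extInjGen M) :=
  (exists_extEmb M).choose_spec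

lemma extEmb_injective [IsModAbelian A] (M : FPMod A) (X : ModuleCat.{u} A) :
    ∀ a b : (extFP M).obj.obj X, (extEmb M).hom.app X a = (extEmb M).hom.app X b → a = b := by
  refine (injective_iff_map_eq_zero ((extEmb M).hom.app X).hom).2 fun a ha => ?_
  obtain ⟨g, rfl⟩ := gen_extElem M a
  have ha' : (extEmb M).hom.app X ((extFP M).obj.map g (extElem M)) = 0 := ha
  rw [app_nat, extEmb_extElem, ← map_comp_el] at ha'
  obtain ⟨h, hh⟩ := (ann_presGen (presD M)).fac _ ha'
  have : g = (presSeq M).f ≫ h := by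
    rw [← cancel_epi (presProj M), hh, ← presProj_f, Category.assoc]
  rw [this, map_comp_el, (ann_extElem M).ann, map_zero]

lemma exists_presD₂ [IsModAbelian A] (M : FPMod A) : ∃ (l : ℕ)
    (d : (Fin l → A) →ₗ[A] (Fin (freePres M).m → A)), Function.Exact d (freePres M).d₁ := by
  have := finitePresentation_ker (freePres M).d₁
  obtain ⟨l, s, hs⟩ := Module.Finite.exists_fin' A (LinearMap.ker (freePres M).d₁)
  refine ⟨l, (LinearMap.ker (freePres M).d₁).subtype ∘ₗ s, fun y => ⟨fun hy => ?_, ?_⟩⟩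
  · obtain ⟨x, hx⟩ := hs ⟨y, hy⟩
    exact ⟨x, congrArg Subtype.val hx⟩
  · rintro ⟨x, rfl⟩
    exact (s x).2

lemma extFPMap_extElem [IsModAbelian A] {M N : FPMod A} (φ : M ⟶ N)
    (k : (presSeq M).X₁ ⟶ (presSeq N).X₁) (f₀ : presGens M ⟶ presGens N)
    (h : k ≫ (presSeq N).f = (presSeq M).f ≫ f₀) (h' : f₀ ≫ (presSeq N).g = (presSeq M).g ≫ φ.hom) :
    (extFPMap φ).hom.app _ (extElem N) = (extFP M).obj.map k (extElem M) :=
  (ShortComplex.ShortExact.extClass_naturality (presSeq_shortExact M) (presSeq_shortExact N)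
    { τ₁ := k, τ₂ := f₀, τ₃ := φ.hom, comm₁₂ := h, comm₂₃ := h' }).symm

lemma exists_extInjMap {M N : FPMod A} {f : M.obj →ₗ[A] N.obj}
    (F : PresHom (freePres M) (freePres N) f) : ∃ ψ : (extInj N).obj ⟶ (extInj M).obj,
      ψ.app _ (extInjGen N) = (extInj M).obj.map (ModuleCat.ofHom F.f₁) (extInjGen M) := by
  refine exists_hom (gen_presGen (presD N)) (ann_presGen (presD N)) ?_
  have : (ModuleCat.ofHom F.f₁ : presRels M ⟶ presRels N) ≫ presD N =
      presD M ≫ ModuleCat.ofHom F.f₀ := ModuleCat.hom_ext F.comm₁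
  rw [← map_comp_el, this, map_comp_el]
  exact (congrArg _ (ann_presGen (presD M)).ann).trans (map_zero _)

/-- The map of injective functors induced by a map of presentations. -/
def extInjMap {M N : FPMod A} {f : M.obj →ₗ[A] N.obj}
    (F : PresHom (freePres M) (freePres N) f) : extInj N ⟶ extInj M :=
  ObjectProperty.homMk (exists_extInjMap F).choose

lemma extInjMap_extInjGen {M N : FPMod A} {f : M.obj →ₗ[A] N.obj}
    (F : PresHom (freePres M) (freePres N) f) : (extInjMap F).hom.app _ (extInjGen N) =
      (extInj M).obj.map (ModuleCat.ofHom F.f₁) (extInjGen M) :=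
  (exists_extInjMap F).choose_spec

lemma extEmb_extInjMap [IsModAbelian A] {M N : FPMod A} (φ : M ⟶ N)
    (F : PresHom (freePres M) (freePres N) φ.hom.hom) :
    extEmb N ≫ extInjMap F = extFPMap φ ≫ extEmb M := by
  apply ObjectProperty.hom_ext
  refine (gen_extElem N).hom_ext ?_
  let f₀ : presGens M ⟶ presGens N := ModuleCat.ofHom F.f₀
  let f₁ : presRels M ⟶ presRels N := ModuleCat.ofHom F.f₁
  have h₀ : f₀ ≫ (presSeq N).g = (presSeq M).g ≫ φ.hom := ModuleCat.hom_ext F.comm₀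
  have h₁ : f₁ ≫ presD N = presD M ≫ f₀ := ModuleCat.hom_ext F.comm₁
  obtain ⟨k, hk⟩ : ∃ k, k ≫ (presSeq N).f = (presSeq M).f ≫ f₀ := by
    have := (presSeq_shortExact N)
    refine ⟨this.exact.lift ((presSeq M).f ≫ f₀) ?_, this.exact.lift_f _ _⟩
    rw [Category.assoc, h₀, (presSeq M).zero_assoc, zero_comp]
  have hk₁ : presProj M ≫ k = f₁ ≫ presProj N := by
    rw [← cancel_mono (presSeq N).f, Category.assoc, Category.assoc, hk, presProj_f, h₁,
      ← presProj_f, Category.assoc]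
  change (extInjMap F).hom.app _ ((extEmb N).hom.app _ (extElem N)) =
    (extEmb M).hom.app _ ((extFPMap φ).hom.app _ (extElem N))
  rw [extFPMap_extElem φ k f₀ hk h₀, app_nat, extEmb_extElem, extEmb_extElem, app_nat,
    extInjMap_extInjGen, ← map_comp_el, ← map_comp_el]
  exact congrArg (fun t => (extInj M).obj.map t (extInjGen M)) hk₁.symm

variable (B U : Type u) [Ring B] [AddCommGroup U] [Module A U] [Module B U] [SMulCommClass A B U]

/-- The copresentation `0 ⟶ Ext¹(M, -) ⟶ I ⟶ (P, -)` dualizes to a presentation. -/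
lemma exists_gen_ann_dualElem [IsModAbelian A] (M : FPMod A) :
    ∃ (l : ℕ) (t : (ev A B U).obj (extInj M) ⟶
      (ev A B U).obj ((yonedaFP _).obj (op (ModuleCat.of A (Fin l → A))))),
      Gen ((dual A B U).obj (op (extFP M))).obj (dualElem A B U (extEmb M)) ∧
        Ann ((dual A B U).obj (op (extFP M))).obj t (dualElem A B U (extEmb M)) := by
  obtain ⟨l, d, hd⟩ := exists_presD₂ M
  let d₂ : ModuleCat.of A (Fin l → A) ⟶ presRels M := ModuleCat.ofHom d
  have w : d₂ ≫ presProj M = 0 := by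
    rw [← cancel_mono (presSeq M).f, Category.assoc, presProj_f, zero_comp]
    exact ModuleCat.hom_ext hd.linearMap_comp_eq_zero
  have hex : (ShortComplex.mk d₂ (presProj M) w).Exact := by
    refine (ShortComplex.ShortExact.moduleCat_exact_iff_function_exact _).2 fun y => ?_
    refine Iff.trans ?_ (hd y)
    exact Subtype.ext_iff
  obtain ⟨t, ht⟩ := exists_hom (gen_presGen (presD M)) (ann_presGen (presD M))
    (G := preadditiveCoyoneda.obj (op (ModuleCat.of A (Fin l → A)))) (w := d₂)
    (ModuleCat.hom_ext hd.linearMap_comp_eq_zero)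
  let J : FP (ModuleCat.{u} A) := (yonedaFP _).obj (op (ModuleCat.of A (Fin l → A)))
  let τ : extInj M ⟶ J := ObjectProperty.homMk t
  have hτ : ∀ {Z : ModuleCat.{u} A} (g : presRels M ⟶ Z),
      τ.hom.app Z ((extInj M).obj.map g (extInjGen M)) = d₂ ≫ g := fun g =>
    (app_nat t g _).trans (congrArg _ ht)
  refine ⟨l, (ev A B U).map τ, gen_ann_dualElem A B U (extEmb M) τ ?_ (extEmb_injective M) ?_⟩
  · apply ObjectProperty.hom_ext
    refine (gen_extElem M).hom_ext ?_
    change τ.hom.app _ ((extEmb M).hom.app _ (extElem M)) = 0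
    rw [extEmb_extElem, hτ, w]
    rfl
  · intro Z b hb
    obtain ⟨g, rfl⟩ := gen_presGen (presD M) b
    have hg : d₂ ≫ g = 0 := (hτ g).symm.trans hb
    refine ⟨(extFP M).obj.map (hex.desc g hg) (extElem M), ?_⟩
    rw [app_nat, extEmb_extElem, ← map_comp_el]
    exact congrArg (fun s => (extInj M).obj.map s (extInjGen M)) (hex.g_desc g hg)

lemma projective_ev_yonedaFP [Module.Finite B U] [Module.Projective B U] (l : ℕ) :
    Projective ((ev A B U).obj ((yonedaFP _).obj (op (ModuleCat.of A (Fin l → A))))) := by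
  let X := ModuleCat.of A (Fin l → A)
  have hb : Function.Bijective (evLin B U ((yonedaFP _).obj (op X)) (X := X) (𝟙 X)) := by
    refine ⟨?_, evLin_surjective B U (I := (yonedaFP _).obj (op X)) (gen_id X)⟩
    rw [← LinearMap.ker_eq_bot, ker_evLin B U (I := (yonedaFP _).obj (op X)) (ann_id X),
      LinearMap.range_eq_bot]
    ext φ x
    exact map_zero φ
  let e := (LinearEquiv.ofBijective _ hb).toModuleIso
  have : Projective (ModuleCat.of B (X →ₗ[A] U)) :=
    (IsProjective.iff_projective (R := B) _).1
      (inferInstanceAs (Module.Projective B ((Fin l → A) →ₗ[A] U)))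
  exact Projective.of_iso e this

/-- The comparison of the transpose with the value of an injective functor. -/
def trLinEv (M : FPMod A) : trModule B U (freePres M) →ₗ[B] (ev A B U).obj (extInj M) :=
  Submodule.liftQ _ (evLin B U (extInj M) (extInjGen M))
    (ker_evLin B U (I := extInj M) (ann_presGen (presD M))).ge

lemma trLinEv_bijective (M : FPMod A) : Function.Bijective (trLinEv B U M) := by
  constructor
  · rw [← LinearMap.ker_eq_bot, trLinEv]
    refine Submodule.ker_liftQ_eq_bot _ _ _ ?_
    exact (ker_evLin B U (I := extInj M) (ann_presGen (presD M))).le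
  · intro y
    obtain ⟨g, hg⟩ := evLin_surjective B U (I := extInj M) (gen_presGen (presD M)) y
    exact ⟨Submodule.Quotient.mk g, hg⟩

variable [Module.Finite B U] [Module.Projective B U]

/-- The transpose of `M` is the value at `U` of the injective functor containing `Ext¹(M, -)`. -/
def trEvIso (M : FPMod A) : (trObj B U M).obj ≅ (ev A B U).obj (extInj M) :=
  (LinearEquiv.ofBijective _ (trLinEv_bijective B U M)).toModuleIso

lemma trHom_trEvIso {M N : FPMod A} {f : M.obj →ₗ[A] N.obj}
    (F : PresHom (freePres M) (freePres N) f) :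
    (trHom B U F).hom ≫ (trEvIso B U M).hom = (trEvIso B U N).hom ≫ (ev A B U).map (extInjMap F) := by
  apply ModuleCat.hom_ext
  apply Submodule.linearMap_qext
  ext1 φ
  let g : presRels N ⟶ ModuleCat.of A U := ModuleCat.ofHom φ
  change (extInj M).obj.map ((ModuleCat.ofHom F.f₁ : presRels M ⟶ presRels N) ≫ g) (extInjGen M) =
    (extInjMap F).hom.app _ ((extInj N).obj.map g (extInjGen N))
  rw [app_nat, extInjMap_extInjGen, map_comp_el]

variable [IsModAbelian A]

/-- The generator of the dual of `Ext¹(M, -)`, at the transpose of `M`. -/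
def dualExtElem (M : FPMod A) : ((dual A B U).obj (op (extFP M))).obj.obj (trObj B U M).obj :=
  ((dual A B U).obj (op (extFP M))).obj.map (trEvIso B U M).inv (dualElem A B U (extEmb M))

lemma exists_gen_ann_dualExtElem (M : FPMod A) : ∃ (P : ModuleCat.{u} B) (_ : Projective P)
    (f : (trObj B U M).obj ⟶ P), Gen ((dual A B U).obj (op (extFP M))).obj (dualExtElem B U M) ∧
      Ann ((dual A B U).obj (op (extFP M))).obj f (dualExtElem B U M) := by
  obtain ⟨l, t, h₁, h₂⟩ := exists_gen_ann_dualElem B U M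
  exact ⟨_, projective_ev_yonedaFP B U l, _, h₁.map_iso (trEvIso B U M).symm,
    h₂.map_iso (trEvIso B U M).symm (Iso.refl _)⟩

lemma dualExtElem_naturality {M N : FPMod A} (φ : M ⟶ N)
    (F : PresHom (freePres M) (freePres N) φ.hom.hom) :
    ((dual A B U).map (extFPMap φ).op).hom.app _ (dualExtElem B U M) =
      ((dual A B U).obj (op (extFP N))).obj.map (trHom B U F).hom (dualExtElem B U N) := by
  rw [dualExtElem, dualExtElem, app_nat, dualElem_naturality A B U (extEmb N) (extEmb M) (extFPMap φ)
    (extInjMap F) (extEmb_extInjMap φ F), ← map_comp_el, ← map_comp_el]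
  refine congrArg (fun s => ((dual A B U).obj (op (extFP N))).obj.map s
    (dualElem A B U (extEmb N))) ?_
  rw [Iso.eq_inv_comp, ← Category.assoc, ← trHom_trEvIso, Category.assoc, Iso.hom_inv_id,
    Category.comp_id]

end DualOfExt

section HiltonReesEmbedding

lemma exists_extFunctor_map {C : Type u} [Category.{v} C] [Abelian C] [HasExt.{v} C]
    {S : ShortComplex C} (hS : S.ShortExact) [Projective S.X₂] {X : C}
    (α : (Abelian.extFunctor.{v} 1).obj (op S.X₃) ⟶ (Abelian.extFunctor.{v} 1).obj (op X)) :
    ∃ f : X ⟶ S.X₃, (Abelian.extFunctor.{v} 1).map f.op = α := by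
  obtain ⟨z, hz⟩ := Abelian.Ext.covariant_sequence_exact₁ (X := X) hS (α.app S.X₁ hS.extClass) (by
    refine (app_nat α S.f hS.extClass).symm.trans ?_
    rw [(ann_extClass hS).ann, map_zero]
    rfl) (zero_add 1)
  obtain ⟨f, rfl⟩ := Abelian.Ext.addEquiv₀.symm.surjective z
  exact ⟨f, (gen_extClass hS).hom_ext hz⟩

lemma exists_eq_comp_of_extFunctor_map_eq {C : Type u} [Category.{v} C] [Abelian C] [HasExt.{v} C]
    {S : ShortComplex C} (hS : S.ShortExact) {X : C} {f g : X ⟶ S.X₃}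
    (h : (Abelian.extFunctor.{v} 1).map f.op = (Abelian.extFunctor.{v} 1).map g.op) :
    ∃ l : X ⟶ S.X₂, f - g = l ≫ S.g := by
  have h' : (Abelian.Ext.mk₀ f).comp hS.extClass (zero_add 1) =
      (Abelian.Ext.mk₀ g).comp hS.extClass (zero_add 1) := by
    rw [← extFunctor_map_app, h, extFunctor_map_app]
  have h₀ : Abelian.Ext.mk₀ f = Abelian.Ext.mk₀ (f - g) + Abelian.Ext.mk₀ g := by
    rw [← Abelian.Ext.mk₀_add, sub_add_cancel]
  rw [h₀, Abelian.Ext.add_comp] at h'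
  obtain ⟨z, hz⟩ := Abelian.Ext.covariant_sequence_exact₃ X hS (Abelian.Ext.mk₀ (f - g))
    (zero_add 1) (add_eq_right.1 h')
  obtain ⟨l, rfl⟩ := Abelian.Ext.addEquiv₀.symm.surjective z
  refine ⟨l, ?_⟩
  have : Abelian.Ext.mk₀ (l ≫ S.g) = Abelian.Ext.mk₀ (f - g) :=
    (Abelian.Ext.mk₀_comp_mk₀ l S.g).symm.trans hz
  exact (Abelian.Ext.mk₀_bijective _ _).1 this.symm

variable {A : Type u} [Ring A] [IsModAbelian A]

lemma stableRel_of_extFunctor_map_eq {M N : FPMod A} {f g : M ⟶ N}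
    (h : (Abelian.extFunctor.{u} 1).map f.hom.op = (Abelian.extFunctor.{u} 1).map g.hom.op) :
    stableRel (FPMod A) f g := by
  obtain ⟨l, hl⟩ := exists_eq_comp_of_extFunctor_map_eq (modSyzSeq_shortExact N) h
  exact ⟨Projective.over N, inferInstance, ObjectProperty.homMk l, Projective.π N,
    ObjectProperty.hom_ext _ hl⟩

variable {B U : Type u} [Ring B] [AddCommGroup U] [Module A U] [Module B U] [SMulCommClass A B U]
  (h : ArrowsRestrict A B U)

lemma ArrowsRestrict.full_E : h.E.Full where
  map_surjective {M N} g := by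
    obtain ⟨f, hf⟩ := exists_extFunctor_map (modSyzSeq_shortExact N.as) (X := M.as.obj) g.unop.hom
    refine ⟨(CategoryTheory.Quotient.functor (stableRel (FPMod A))).map (ObjectProperty.homMk f), ?_⟩
    apply Quiver.Hom.unop_inj
    exact ObjectProperty.hom_ext _ hf

lemma ArrowsRestrict.faithful_E : h.E.Faithful where
  map_injective {M N} f g e := by
    obtain ⟨f, rfl⟩ := (CategoryTheory.Quotient.functor (stableRel (FPMod A))).map_surjective f
    obtain ⟨g, rfl⟩ := (CategoryTheory.Quotient.functor (stableRel (FPMod A))).map_surjective g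
    exact CategoryTheory.Quotient.sound _ (stableRel_of_extFunctor_map_eq
      (congrArg (fun t => t.unop.hom) e))

end HiltonReesEmbedding

section Commutation

variable {A : Type u} [Ring A] [IsModAbelian A]

/-- The map of syzygy sequences induced by a morphism. -/
def modSyzSeqMap {M N : FPMod A} (f : M ⟶ N) : modSyzSeq M ⟶ modSyzSeq N where
  τ₁ := (syzMap f).hom
  τ₂ := (overMap f).hom
  τ₃ := f.hom
  comm₁₂ := congrArg (fun t => t.hom) (syzMap_ι f)
  comm₂₃ := congrArg (fun t => t.hom) (overMap_π f)

/-- The canonical map `Ext¹(Ω M, -) ⟶ S¹ Ext¹(M, -)`. -/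
def extSyzToUp (M : FPMod A) : (Abelian.extFunctor.{u} 1).obj (op (syz M).obj) ⟶
    upFunctor (extFP M).obj :=
  extToUp (extFP M).obj (X := (syz M).obj) (modSyzSeq_shortExact M).extClass

instance (M : FPMod A) : IsIso (extSyzToUp M) :=
  isIso_extToUp (extFP M).obj (gen_extClass (modSyzSeq_shortExact M))
    (ann_extClass (modSyzSeq_shortExact M))

/-- The functor `Ext¹(Ω M, -)` is the right satellite of `Ext¹(M, -)`. -/
def extSyzIso (M : FPMod A) : (Abelian.extFunctor.{u} 1).obj (op (syz M).obj) ≅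
    upFunctor (extFP M).obj :=
  asIso (extSyzToUp M)

lemma extSyzToUp_naturality {M N : FPMod A} (f : M ⟶ N) :
    extSyzToUp N ≫ upTrans (extFPMap f).hom =
      (Abelian.extFunctor.{u} 1).map (syzMap f).hom.op ≫ extSyzToUp M :=
  extToUp_naturality (extFPMap f).hom _ _ _ (ShortComplex.ShortExact.extClass_naturality
    (modSyzSeq_shortExact M) (modSyzSeq_shortExact N) (modSyzSeqMap f)).symm

variable {B U : Type u} [Ring B] [AddCommGroup U] [Module A U] [Module B U] [SMulCommClass A B U]
  (h : ArrowsRestrict A B U)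

lemma ArrowsRestrict.E_map {M N : FPMod A} (f : M ⟶ N) :
    (TFP.toFP A).map (h.E.map ((CategoryTheory.Quotient.functor (stableRel (FPMod A))).map f)).unop =
      extFPMap f := rfl

lemma ArrowsRestrict.E_S1_map {M N : FPMod A} (f : M ⟶ N) :
    ((h.E.leftOp ⋙ h.S1).map
      ((CategoryTheory.Quotient.functor (stableRel (FPMod A))).map f).op).hom =
      upTrans (extFPMap f).hom := by
  rw [← h.E_map]
  rfl

/-- `S¹ E ≅ E Ω`. -/
def ArrowsRestrict.leftOpS1Iso : h.E.leftOp ⋙ h.S1 ≅ (Omega (FPMod A)).op ⋙ h.E.leftOp :=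
  (NatIso.ofComponents (fun M => (isTFP A).isoMk (extSyzIso M.unop.as)) (by
    rintro ⟨M⟩ ⟨N⟩ ⟨f⟩
    obtain ⟨f, rfl⟩ := (CategoryTheory.Quotient.functor (stableRel (FPMod A))).map_surjective f
    apply ObjectProperty.hom_ext
    refine Eq.trans ?_ ((extSyzToUp_naturality f).symm.trans ?_)
    · rfl
    · exact congrArg (extSyzToUp M.as ≫ ·) (h.E_S1_map f).symm)).symm

/-- `Sᵏ E ≅ E Ωᵏ`. -/
def ArrowsRestrict.leftOpIterS1Iso : ∀ k : ℕ,
    h.E.leftOp ⋙ iter h.S1 k ≅ (iter (Omega (FPMod A)) k).op ⋙ h.E.leftOp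
  | 0 => Iso.refl _
  | k + 1 => Functor.isoWhiskerRight (leftOpIterS1Iso k) h.S1 ≪≫
      Functor.isoWhiskerLeft (iter (Omega (FPMod A)) k).op h.leftOpS1Iso

variable {V : Type u} [AddCommGroup V] [Module B V] [Module A V]
  [SMulCommClass B A V] (h' : ArrowsRestrict B A V)

lemma ArrowsRestrict.E_D_S1_map {M N : FPMod A} (f : M ⟶ N) :
    ((h.E ⋙ h.D ⋙ h'.S1).map
      ((CategoryTheory.Quotient.functor (stableRel (FPMod A))).map f)).hom =
      upTrans ((Linkage.dual A B U).map (extFPMap f).op).hom := by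
  rw [← h.E_map]
  rfl

variable [Module.Finite B U] [Module.Projective B U]

/-- The canonical map `Ext¹(Tr M, -) ⟶ S¹ D Ext¹(M, -)`. -/
def extTrToUp (B U : Type u) [Ring B] [AddCommGroup U] [Module A U] [Module B U]
    [SMulCommClass A B U] [Module.Finite B U] [Module.Projective B U] (M : FPMod A) :
    (Abelian.extFunctor.{u} 1).obj (op (trObj B U M).obj) ⟶
      upFunctor ((dual A B U).obj (op (extFP M))).obj :=
  extToUp ((dual A B U).obj (op (extFP M))).obj (dualExtElem B U M)

instance (M : FPMod A) : IsIso (extTrToUp B U M) := by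
  obtain ⟨P, _, f, h₁, h₂⟩ := exists_gen_ann_dualExtElem B U M
  exact isIso_extToUp _ h₁ h₂

/-- The functor `Ext¹(Tr M, -)` is the right satellite of the dual of `Ext¹(M, -)`. -/
def extTrIso (B U : Type u) [Ring B] [AddCommGroup U] [Module A U] [Module B U]
    [SMulCommClass A B U] [Module.Finite B U] [Module.Projective B U] (M : FPMod A) :
    (Abelian.extFunctor.{u} 1).obj (op (trObj B U M).obj) ≅
      upFunctor ((dual A B U).obj (op (extFP M))).obj :=
  asIso (extTrToUp B U M)

lemma extTrToUp_naturality {M N : FPMod A} (f : M ⟶ N) :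
    extTrToUp B U M ≫ upTrans ((dual A B U).map (extFPMap f).op).hom =
      (Abelian.extFunctor.{u} 1).map (trHom B U (presHom f)).hom.op ≫ extTrToUp B U N :=
  extToUp_naturality ((dual A B U).map (extFPMap f).op).hom _ _ _
    (dualExtElem_naturality B U f (presHom f))

variable [IsModAbelian B]

/-- `S¹ D E ≅ E Tr`. -/
def ArrowsRestrict.dualIso : h.E ⋙ h.D ⋙ h'.S1 ≅ Tr B U ⋙ h'.E.leftOp :=
  (NatIso.ofComponents (fun M => (isTFP B).isoMk (extTrIso B U M.as)) (by
    intro M N f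
    obtain ⟨f, rfl⟩ := (CategoryTheory.Quotient.functor (stableRel (FPMod A))).map_surjective f
    apply ObjectProperty.hom_ext
    refine Eq.trans ?_ ((extTrToUp_naturality f).symm.trans ?_)
    · rfl
    · exact congrArg (extTrToUp B U M.as ≫ ·) (h.E_D_S1_map h' f).symm)).symm

/-- `Sᵏ S¹ D E ≅ E Ωᵏ Tr`. -/
def ArrowsRestrict.dualIterIso (k : ℕ) : h.E ⋙ h.D ⋙ h'.S1 ⋙ iter h'.S1 k ≅
    Tr B U ⋙ (iter (Omega (FPMod B)) k).op ⋙ h'.E.leftOp :=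
  Functor.isoWhiskerRight (h.dualIso h') (iter h'.S1 k) ≪≫
    Functor.isoWhiskerLeft (Tr B U) (h'.leftOpIterS1Iso k)

end Commutation

end Linkage

end

theorem mainTheorem9 (R : Type u) [Ring R] [Linkage.IsCoherent R] :
    -- the arrows of the diagram are well defined, on right modules (`h`) and left modules (`h'`)
    ∃ (h : Linkage.ArrowsRestrict Rᵐᵒᵖ R R) (h' : Linkage.ArrowsRestrict R Rᵐᵒᵖ R),
      -- the vertical arrows are contravariant embeddings
      (h.E.Full ∧ h.E.Faithful ∧ h'.E.Full ∧ h'.E.Faithful) ∧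
      -- `S¹ D E ≅ E Tr`
      (Nonempty (h.E ⋙ h.D ⋙ h'.S1 ≅ Linkage.Tr R R ⋙ h'.E.leftOp) ∧
        Nonempty (h'.E ⋙ h'.D ⋙ h.S1 ≅ Linkage.Tr Rᵐᵒᵖ R ⋙ h.E.leftOp)) ∧
      -- `Sᵏ S¹ D E ≅ E Ωᵏ Tr`
      (∀ k : ℕ,
        Nonempty (h.E ⋙ h.D ⋙ h'.S1 ⋙ Linkage.iter h'.S1 k ≅
          Linkage.Tr R R ⋙ (Linkage.iter (Linkage.Omega (Linkage.FPMod R)) k).op ⋙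
            h'.E.leftOp) ∧
        Nonempty (h'.E ⋙ h'.D ⋙ h.S1 ⋙ Linkage.iter h.S1 k ≅
          Linkage.Tr Rᵐᵒᵖ R ⋙ (Linkage.iter (Linkage.Omega (Linkage.FPMod Rᵐᵒᵖ)) k).op ⋙
            h.E.leftOp)) ∧
      -- there is a counit of adjunction `S² S₂ ⟶ 1`
      ((∃ (c : Linkage.iter h.S_1 2 ⋙ Linkage.iter h.S1 2 ⟶ 𝟭 (Linkage.TFP Rᵐᵒᵖ))
          (adj : Linkage.iter h.S1 2 ⊣ Linkage.iter h.S_1 2), adj.counit = c) ∧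
        (∃ (c : Linkage.iter h'.S_1 2 ⋙ Linkage.iter h'.S1 2 ⟶ 𝟭 (Linkage.TFP R))
          (adj : Linkage.iter h'.S1 2 ⊣ Linkage.iter h'.S_1 2), adj.counit = c)) := by
  let h : Linkage.ArrowsRestrict Rᵐᵒᵖ R R := Linkage.arrowsRestrict R R (Linkage.selfEquivOp R).symm
  let h' : Linkage.ArrowsRestrict R Rᵐᵒᵖ R := Linkage.arrowsRestrict Rᵐᵒᵖ R (LinearEquiv.refl R R)
  exact ⟨h, h', ⟨h.full_E, h.faithful_E, h'.full_E, h'.faithful_E⟩,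
    ⟨⟨h.dualIso h'⟩, ⟨h'.dualIso h⟩⟩, fun k => ⟨⟨h.dualIterIso h' k⟩, ⟨h'.dualIterIso h k⟩⟩,
    ⟨_, h.adjunctionTwo, rfl⟩, ⟨_, h'.adjunctionTwo, rfl⟩⟩
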